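/- Let $n\ge 1$, $N=2n$, and for $X=(X_1,X_2)$, $Y=(Y_1,Y_2)$ in $\mathbb C^N=\mathbb C^n\times\mathbb C^n$ put $\omega(X,Y)=\langle X_2,Y_1\rangle-\langle X_1,Y_2\rangle$, where $\langle\cdot,\cdot\rangle$ is the standard bilinear form. Let $G=\mathrm{Sp}(n,\mathbb C)$ be the group of complex linear maps preserving $\omega$, let $S$ be the Euclidean unit sphere of $\mathbb C^N\simeq\mathbb R^{2N}$ and $d\sigma$ its Euclidean surface measure. Write $[a]=a/|a|$ for $a\in\mathbb C^\times$. For $(\mu,\delta)\in\mathbb C\times\mathbb Z$ let $$V^\infty_{\mu,\delta}=\{f\in C^\infty(\mathbb C^N\setminus\{0\}) : f(aX)=|a|^{-\mu-N}[a]^{-\delta}f(X)\ \text{ for all } a\in\mathbb C^\times\}.$$ For $\mu\in i\mathbb R$ let $V_{\mu,\delta}$ be its completion for the norm of $L^2(S)$; the elements of $V_{\mu,\delta}$ are viewed as functions of $X\neq 0$, homogeneous of degree $-\mu-N$ under positive dilations. Let $\pi_{\mu,\delta}$ be the unitary representation of $G$ on $V_{\mu,\delta}$ given by $f\mapsto f(g^{-1}\,\cdot)$.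 Let $\mathcal F_{\mathrm{symp}}f(\xi)=\int_{\mathbb C^N}f(X)e^{-2i\pi\operatorname{Re}\omega(X,\xi)}\,dX$ on $\mathcal S(\mathbb C^N)$, extended to $\mathcal S'(\mathbb C^N)$ by duality. The Knapp–Stein operator $\mathcal T_{\mu,\delta}$ is the meromorphic continuation in $\mu$ of $$\mathcal T_{\mu,\delta}f(Y)=\int_S f(X)\,|\operatorname{Re}\omega(X,Y)|^{-\mu-N}[\operatorname{Re}\omega(X,Y)]^{-\delta}\,d\sigma(X)\qquad(Y\ne0),$$ where $f|_S$ is kept fixed as $\mu$ varies. Let $$C_N(\mu,\delta)=\begin{cases}2\pi^{\mu+N-\frac12}\,\dfrac{\Gamma\left(\frac{1-\mu-N}2\right)}{\Gamma\left(\frac{\mu+N}2\right)}&\delta\text{ even},\\[3mm] 2i\,\pi^{\mu+N-\frac12}\,\dfrac{\Gamma\left(\frac{2-\mu-N}2\right)}{\Gamma\left(\frac{1+\mu+N}2\right)}&\delta\text{ odd},\end{cases}$$ and let $\widetilde{\mathcal T}_{\mu,\delta}=C_N(\mu,\delta)^{-1}\,\mathcal T_{\mu,\delta}$, as a quotient of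 meromorphic functions of $\mu$ (removable singularities are removed). Let $P_\delta=\{-N-k : k\in\mathbb Z_{\ge0},\ k\equiv\delta \bmod 2\}$. (1) Let $h\in C^\infty(S)$ satisfy $h(e^{i\theta}X)=e^{i\delta\theta}h(X)$ for all $\theta\in\mathbb R$, $X\in S$, and let $h_{\mu-N}(rX)=r^{\mu-N}h(X)$ ($r>0$, $X\in S$), so that $h_{\mu-N}\in V^\infty_{-\mu,-\delta}$. For every $Y\neq0$ the integral $\mathcal T_{\mu,\delta}h_{\mu-N}(Y)$ converges absolutely for $\operatorname{Re}\mu<1-N$ and has a meromorphic continuation to $\mu\in\mathbb C$. The function $\mu\mapsto\widetilde{\mathcal T}_{\mu,\delta}h_{\mu-N}(Y)$ is meromorphic on $\mathbb C$ and holomorphic off $P_\delta$, and $\widetilde{\mathcal T}_{\mu,\delta}h_{\mu-N}\in V^\infty_{\mu,\delta}$ for $\mu\notin P_\delta$. The tempered distributions $h_{\mu-N}$, $\operatorname{Re}\mu>-N$, extend to a family of tempered distributions that is (weakly) meromorphic in $\mu\in\mathbb C$ and holomorphic off $P_\delta$, and $$\widetilde{\mathcal T}_{\mu,\delta}h_{\mu-N}=\mathcal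 F_{\mathrm{symp}}h_{\mu-N}\qquad(\mu\notin P_\delta),$$ as tempered distributions on $\mathbb C^N$ if $\operatorname{Re}\mu<N$ (the left-hand side then being locally integrable), and for arbitrary $\mu\notin P_\delta$ when tested on Schwartz functions whose support does not contain $0$. (2) Let $\mu\in i\mathbb R$. Then $\widetilde{\mathcal T}_{\mu,\delta}$ maps $V^\infty_{-\mu,-\delta}$ to $V^\infty_{\mu,\delta}$ and extends to a unitary operator $U:V_{-\mu,-\delta}\to V_{\mu,\delta}$; this operator is $\mathcal F_{\mathrm{symp}}|_{V_{-\mu,-\delta}}$, that is $UF=\mathcal F_{\mathrm{symp}}F$ as tempered distributions for all $F\in V_{-\mu,-\delta}$; and $U\,\pi_{-\mu,-\delta}(g)=\pi_{\mu,\delta}(g)\,U$ for all $g\in G$. Thus $\widetilde{\mathcal T}_{\mu,\delta}$ yields a unitary equivalence between $\pi_{-\mu,-\delta}$ and $\pi_{\mu,\delta}$. -/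

import Mathlib

open MeasureTheory Set Filter Topology
open scoped SchwartzMap FourierTransform ContDiff

noncomputable section

namespace KnappStein

/-! ### The symplectic space `ℂ^N`, `N = 2n`, and the group `Sp(n, ℂ)` -/

/-- `ℂ^N = ℂ^n × ℂ^n`, a point being `X = (X₁, X₂)` with `X₁ = X ∘ inl` and `X₂ = X ∘ inr`. It
carries the Hermitian norm, which is the Euclidean norm of `ℝ^{2N}`. -/
abbrev CN (n : ℕ) : Type := EuclideanSpace ℂ (Fin n ⊕ Fin n)

/-- The unit sphere of `ℂ^N`, that is the Euclidean sphere of dimension `2N - 1`. -/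
abbrev Sph (n : ℕ) : Type := Metric.sphere (0 : CN n) 1

/-- The Euclidean (surface) measure on the unit sphere. -/
abbrev sphMeas (n : ℕ) : Measure (Sph n) := (volume : Measure (CN n)).toSphere

/-- The complex symplectic form `ω(X, Y) = ⟨X₂, Y₁⟩ - ⟨X₁, Y₂⟩`. -/
def sympForm {n : ℕ} (X Y : CN n) : ℂ :=
  ∑ k : Fin n, X (Sum.inr k) * Y (Sum.inl k) - ∑ k : Fin n, X (Sum.inl k) * Y (Sum.inr k)

/-- The complex symplectic group `G = Sp(n, ℂ)`. -/
abbrev Sp (n : ℕ) : Type := ↥(Matrix.symplecticGroup (Fin n) ℂ)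

/-- The linear action of `G` on `ℂ^N`. -/
def act {n : ℕ} (g : Sp n) : CN n →L[ℂ] CN n :=
  Matrix.toEuclideanCLM (n := Fin n ⊕ Fin n) (𝕜 := ℂ) (g : Matrix _ _ ℂ)

theorem act_one {n : ℕ} : act (1 : Sp n) = 1 := by
  simp [act]

theorem act_mul {n : ℕ} (g g' : Sp n) (x : CN n) : act (g * g') x = act g (act g' x) := by
  simp [act]

theorem act_inv_act {n : ℕ} (g : Sp n) (x : CN n) : act g⁻¹ (act g x) = x := by
  rw [← act_mul, inv_mul_cancel, act_one]; rfl

theorem act_act_inv {n : ℕ} (g : Sp n) (x : CN n) : act g (act g⁻¹ x) = x := by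
  rw [← act_mul, mul_inv_cancel, act_one]; rfl

theorem act_ne_zero {n : ℕ} (g : Sp n) {x : CN n} (hx : x ≠ 0) : act g x ≠ 0 := by
  intro h
  apply hx
  rw [← act_inv_act g x, h, map_zero]

/-- The group acting is the group of linear maps that preserve `ω`. -/
theorem sympForm_act {n : ℕ} (g : Sp n) (X Y : CN n) :
    sympForm (act g X) (act g Y) = sympForm X Y := by
  have key : ∀ X Y : CN n, sympForm X Y = X.ofLp ⬝ᵥ (Matrix.J (Fin n) ℂ).mulVec Y.ofLp := by
    intro X Y
    simp [sympForm, Matrix.J, dotProduct, Matrix.mulVec, Fintype.sum_sum_type, Matrix.fromBlocks,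
      Matrix.one_apply, sub_eq_neg_add]
  have h := SymplecticGroup.mem_iff'.1 g.2
  have ha : ∀ X : CN n, (act g X).ofLp = (g : Matrix _ _ ℂ).mulVec X.ofLp := fun X => rfl
  rw [key, key X Y, ha, ha]
  conv_rhs => rw [← h, ← Matrix.mulVec_mulVec, ← Matrix.mulVec_mulVec,
    Matrix.dotProduct_mulVec X.ofLp, Matrix.vecMul_transpose]

/-! ### Homogeneous functions and the spaces `V^∞_{μ,δ}`, `V_{μ,δ}` -/

/-- `[a] = a / |a|`. -/
def bracket (a : ℂ) : ℂ := a / (‖a‖ : ℂ)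

/-- The space `V^∞_{μ,δ}` of smooth functions on `ℂ^N \ {0}` such that
`f(aX) = |a|^{-μ-N} [a]^{-δ} f(X)` for all `a ∈ ℂˣ`. Functions on `ℂ^N \ {0}` are represented by
functions on `ℂ^N` that vanish at the origin. -/
def Vsmooth (n : ℕ) (μ : ℂ) (δ : ℤ) : Submodule ℂ (CN n → ℂ) where
  carrier := {f | ContDiffOn ℝ ∞ f {0}ᶜ ∧ f 0 = 0 ∧ ∀ a : ℂ, a ≠ 0 → ∀ X : CN n, X ≠ 0 →
    f (a • X) = (‖a‖ : ℂ) ^ (-μ - (2 * n : ℂ)) * bracket a ^ (-δ) * f X}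
  add_mem' := by
    rintro f g ⟨hf, hf0, hfa⟩ ⟨hg, hg0, hga⟩
    refine ⟨hf.add hg, by simp [hf0, hg0], fun a ha X hX => ?_⟩
    simp only [Pi.add_apply, hfa a ha X hX, hga a ha X hX, mul_add]
  zero_mem' := ⟨contDiffOn_const, rfl, by simp⟩
  smul_mem' := by
    rintro c f ⟨hf, hf0, hfa⟩
    refine ⟨contDiffOn_const.smul hf, by simp [hf0], fun a ha X hX => ?_⟩
    simp only [Pi.smul_apply, smul_eq_mul, hfa a ha X hX]
    ring

/-- Restriction to the unit sphere. -/
def restr {n : ℕ} (f : CN n → ℂ) : Sph n → ℂ := fun X => f X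

theorem continuous_restr {n : ℕ} {μ : ℂ} {δ : ℤ} (f : Vsmooth n μ δ) :
    Continuous (restr (f : CN n → ℂ)) := by
  have h := f.2.1.continuousOn
  exact h.comp_continuous continuous_subtype_val fun X hX => by
    have := X.2
    simp_all

theorem memLp_restr {n : ℕ} {μ : ℂ} {δ : ℤ} (f : Vsmooth n μ δ) :
    MemLp (restr (f : CN n → ℂ)) 2 (sphMeas n) := by
  have hc := continuous_restr f
  obtain ⟨C, hC⟩ := (isCompact_range hc).isBounded.exists_norm_le
  exact MemLp.of_bound hc.aestronglyMeasurable C (ae_of_all _ fun X => hC _ ⟨X, rfl⟩)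

/-- The map `V^∞_{μ,δ} → L²(S)`, `f ↦ f|_S`. -/
def toL2 (n : ℕ) (μ : ℂ) (δ : ℤ) : Vsmooth n μ δ →ₗ[ℂ] Lp ℂ 2 (sphMeas n) where
  toFun f := (memLp_restr f).toLp _
  map_add' _ _ := rfl
  map_smul' _ _ := rfl

/-- The Hilbert space `V_{μ,δ}`: the completion of `V^∞_{μ,δ}` for the `L²`-norm on the sphere,
realised as the closure of its image in `L²(S)`. -/
abbrev V (n : ℕ) (μ : ℂ) (δ : ℤ) : Submodule ℂ (Lp ℂ 2 (sphMeas n)) :=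
  (LinearMap.range (toL2 n μ δ)).topologicalClosure

/-- The inclusion `V^∞_{μ,δ} → V_{μ,δ}`. -/
def incl (n : ℕ) (μ : ℂ) (δ : ℤ) : Vsmooth n μ δ →ₗ[ℂ] V n μ δ :=
  (toL2 n μ δ).codRestrict _ fun f => Submodule.le_topologicalClosure _ ⟨f, rfl⟩

theorem denseRange_incl (n : ℕ) (μ : ℂ) (δ : ℤ) : DenseRange (incl n μ δ) := by
  intro x
  rw [closure_subtype]
  have hx : (x : Lp ℂ 2 (sphMeas n)) ∈ closure (LinearMap.range (toL2 n μ δ) : Set _) := x.2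
  refine closure_mono ?_ hx
  rintro _ ⟨f, rfl⟩
  exact ⟨_, ⟨f, rfl⟩, rfl⟩

/-- The extension `h_λ(rX) = r^λ h(X)` (`r > 0`, `X ∈ S`) of a function on the sphere to a
homogeneous function on `ℂ^N \ {0}`. -/
def homExt {n : ℕ} (lam : ℂ) (h : Sph n → ℂ) (x : CN n) : ℂ :=
  if hx : x = 0 then 0
  else (‖x‖ : ℂ) ^ lam * h ⟨(‖x‖⁻¹ : ℝ) • x, by simp [norm_smul, hx]⟩

/-- Smooth functions on the sphere that belong to
`L²(S)_δ = {h | h(e^{iθ} X) = e^{-iδθ} h(X)}`. Smoothness on the sphere is smoothness of the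
extension that is constant along rays. -/
def SmoothSphere (n : ℕ) (δ : ℤ) : Set (Sph n → ℂ) :=
  {h | ContDiffOn ℝ ∞ (homExt 0 h) {0}ᶜ ∧ ∀ (c : ℂ) (X X' : Sph n), ‖c‖ = 1 →
    (X' : CN n) = c • (X : CN n) → h X' = c ^ (-δ) * h X}

/-! ### The degenerate principal series -/

/-- The action of `G` on `V^∞_{μ,δ}` by left translations, `f ↦ f(g⁻¹ ·)`. -/
def smoothAct {n : ℕ} (μ : ℂ) (δ : ℤ) (g : Sp n) : Vsmooth n μ δ →ₗ[ℂ] Vsmooth n μ δ where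
  toFun f := ⟨fun X => f.1 (act g⁻¹ X), by
    refine ⟨?_, ?_, ?_⟩
    · exact f.2.1.comp ((act g⁻¹).restrictScalars ℝ).contDiff.contDiffOn
        fun x hx => act_ne_zero g⁻¹ hx
    · simpa using f.2.2.1
    · intro a ha X hX
      simpa using f.2.2.2 a ha (act g⁻¹ X) (act_ne_zero g⁻¹ hX)⟩
  map_add' _ _ := rfl
  map_smul' _ _ := rfl

section isometry

variable {n : ℕ}

theorem lintegral_polar (G : CN n → ENNReal) (hG : Measurable G) [Nontrivial (CN n)] :
    ∫⁻ x, G x = ∫⁻ X : Sph n, (∫⁻ r in Ioi (0 : ℝ),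
      ENNReal.ofReal (r ^ (Module.finrank ℝ (CN n) - 1)) * G (r • (X : CN n))) ∂sphMeas n := by
  have h1 : ∫⁻ x, G x = ∫⁻ x : ({0}ᶜ : Set (CN n)), G x ∂(volume.comap Subtype.val) := by
    rw [lintegral_subtype_comap (measurableSet_singleton _).compl,
      restrict_compl_singleton]
  have h2 := (volume : Measure (CN n)).measurePreserving_homeomorphUnitSphereProd
  have h3 : ∀ x : ({0}ᶜ : Set (CN n)), G x =
      (fun p : Sph n × Ioi (0 : ℝ) => G (p.2.1 • (p.1 : CN n))) (homeomorphUnitSphereProd _ x) := by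
    intro x
    have hx : ‖(x : CN n)‖ ≠ 0 := norm_ne_zero_iff.2 x.2
    simp [smul_smul, hx]
  have hm : Measurable fun p : Sph n × Ioi (0 : ℝ) => G (p.2.1 • (p.1 : CN n)) :=
    hG.comp (by fun_prop)
  rw [h1, lintegral_congr h3, h2.lintegral_comp hm, lintegral_prod _ hm.aemeasurable]
  refine lintegral_congr fun X => ?_
  have hm' : Measurable fun r : Ioi (0 : ℝ) => G (r.1 • (X : CN n)) := hG.comp (by fun_prop)
  rw [← lintegral_subtype_comap measurableSet_Ioi]
  exact lintegral_withDensity_eq_lintegral_mul _ (by fun_prop) hm'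

theorem lintegral_weight [Nontrivial (CN n)] (Φ : CN n → ENNReal) (hΦ : Measurable Φ)
    (hhom : ∀ r : ℝ, 0 < r → ∀ X : CN n, X ≠ 0 →
      ENNReal.ofReal (r ^ (Module.finrank ℝ (CN n))) * Φ (r • X) = Φ X)
    (p : CN n → ℝ) (hp : Continuous p) (hpos : ∀ X, X ≠ 0 → 0 < p X)
    (hph : ∀ r : ℝ, 0 < r → ∀ X, p (r • X) = r * p X) :
    ∫⁻ x, Φ x * {x | p x < 1}.indicator (fun x => ENNReal.ofReal (p x)) x
      = ∫⁻ X : Sph n, Φ X ∂sphMeas n := by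
  have hm : Measurable fun x => Φ x * {x | p x < 1}.indicator (fun x => ENNReal.ofReal (p x)) x :=
    hΦ.mul ((by fun_prop : Measurable fun x => ENNReal.ofReal (p x)).indicator
      (measurableSet_lt hp.measurable measurable_const))
  rw [lintegral_polar _ hm]
  refine lintegral_congr fun X => ?_
  have hX : (X : CN n) ≠ 0 := by
    intro h
    have := X.2
    simp_all
  have hpX := hpos X hX
  have hd : 0 < Module.finrank ℝ (CN n) := Module.finrank_pos
  calc _ = ∫⁻ r in Ioi (0 : ℝ), (Iio (p X)⁻¹).indicator
            (fun _ => Φ X * ENNReal.ofReal (p X)) r := by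
        refine setLIntegral_congr_fun measurableSet_Ioi fun r (hr : 0 < r) => ?_
        by_cases hr1 : r < (p X)⁻¹
        · have h1 : r * p X < 1 := by
            rwa [lt_inv_comm₀ hr hpX, inv_eq_one_div, lt_div_iff₀ hr, mul_comm] at hr1
          rw [indicator_of_mem (s := Iio (p X)⁻¹) hr1, indicator_of_mem (by
            show p _ < 1
            rw [hph r hr]; exact h1), hph r hr, ENNReal.ofReal_mul hr.le, ← hhom r hr X hX]
          conv_rhs => rw [← Nat.sub_add_cancel hd, pow_succ,
            ENNReal.ofReal_mul (pow_nonneg hr.le _)]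
          ring
        · have h1 : ¬ r * p X < 1 := by
            rwa [lt_inv_comm₀ hr hpX, inv_eq_one_div, lt_div_iff₀ hr, mul_comm] at hr1
          rw [indicator_of_notMem (s := Iio (p X)⁻¹) hr1, indicator_of_notMem (by
            show ¬ p _ < 1
            rw [hph r hr]; exact h1), mul_zero, mul_zero]
    _ = Φ X := by
        rw [setLIntegral_indicator measurableSet_Iio, setLIntegral_const, inter_comm,
          Ioi_inter_Iio, Real.volume_Ioo, sub_zero, mul_assoc, ← ENNReal.ofReal_mul hpX.le,
          mul_inv_cancel₀ hpX.ne', ENNReal.ofReal_one, mul_one]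

theorem lintegral_comp_act (g : Sp n) (H : CN n → ENNReal) (hH : Measurable H) :
    ∫⁻ x, H (act g x) = ∫⁻ x, H x := by
  have hdet : LinearMap.det ((act g : CN n →ₗ[ℂ] CN n).restrictScalars ℝ) = 1 := by
    rw [LinearMap.det_restrictScalars]
    have : LinearMap.det (act g : CN n →ₗ[ℂ] CN n) = 1 := by
      rw [act, Matrix.coe_toEuclideanCLM_eq_toEuclideanLin]
      have h2 : Matrix.toEuclideanLin (g : Matrix (Fin n ⊕ Fin n) (Fin n ⊕ Fin n) ℂ) =
          Matrix.toLin (PiLp.basisFun 2 ℂ (Fin n ⊕ Fin n)) (PiLp.basisFun 2 ℂ (Fin n ⊕ Fin n))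
            (g : Matrix (Fin n ⊕ Fin n) (Fin n ⊕ Fin n) ℂ) := by
        rw [← Matrix.toLpLin_eq_toLin]
      rw [h2, LinearMap.det_toLin]
      exact SymplecticGroup.det_eq_one g.2
    rw [this, map_one]
  have h := Measure.map_linearMap_addHaar_eq_smul_addHaar (volume : Measure (CN n))
    (f := (act g : CN n →ₗ[ℂ] CN n).restrictScalars ℝ) (by rw [hdet]; exact one_ne_zero)
  rw [hdet] at h
  simp only [inv_one, abs_one, ENNReal.ofReal_one, one_smul] at h
  conv_rhs => rw [← h]
  exact (lintegral_map hH (act g).continuous.measurable).symm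

/-- For imaginary `μ` the translations preserve the `L²`-norm on the sphere. -/
theorem norm_incl_smoothAct {μ : ℂ} (hμ : μ.re = 0) (δ : ℤ) (g : Sp n) (f : Vsmooth n μ δ) :
    ‖incl n μ δ (smoothAct μ δ g f)‖ = ‖incl n μ δ f‖ := by
  have hn : ∀ f : Vsmooth n μ δ, ‖incl n μ δ f‖ =
      (eLpNorm (restr (f : CN n → ℂ)) 2 (sphMeas n)).toReal := fun f => Lp.norm_toLp _ (memLp_restr f)
  rw [hn, hn, eLpNorm_eq_lintegral_rpow_enorm_toReal two_ne_zero ENNReal.ofNat_ne_top,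
    eLpNorm_eq_lintegral_rpow_enorm_toReal two_ne_zero ENNReal.ofNat_ne_top]
  congr 2
  rcases subsingleton_or_nontrivial (CN n) with hs | hs
  · refine lintegral_congr fun X => ?_
    have := X.2
    rw [Subsingleton.elim (X : CN n) 0] at this
    simp at this
  have hmeas : ∀ f : Vsmooth n μ δ, Measurable fun x => ‖(f : CN n → ℂ) x‖ₑ ^ (2 : ENNReal).toReal := by
    intro f
    exact ((measurable_of_continuousOn_compl_singleton 0 f.2.1.continuousOn).enorm).pow_const _
  have hhom : ∀ f : Vsmooth n μ δ, ∀ r : ℝ, 0 < r → ∀ X : CN n, X ≠ 0 →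
      ENNReal.ofReal (r ^ (Module.finrank ℝ (CN n))) *
        ‖(f : CN n → ℂ) (r • X)‖ₑ ^ (2 : ENNReal).toReal
      = ‖(f : CN n → ℂ) X‖ₑ ^ (2 : ENNReal).toReal := by
    intro f r hr X hX
    have h1 := f.2.2.2 (r : ℂ) (by exact_mod_cast hr.ne') X hX
    have hb : bracket (r : ℂ) = 1 := by
      have : (r : ℂ) ≠ 0 := by exact_mod_cast hr.ne'
      simp [bracket, abs_of_pos hr, this]
    have hd : Module.finrank ℝ (CN n) = 2 * (2 * n) := by
      rw [← Module.finrank_mul_finrank ℝ ℂ (CN n), Complex.finrank_real_complex,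
        finrank_euclideanSpace]
      simp
      ring
    have hnorm : ‖(f : CN n → ℂ) (r • X)‖ = r ^ (-(2 * n : ℝ)) * ‖(f : CN n → ℂ) X‖ := by
      have : (r • X : CN n) = (r : ℂ) • X := rfl
      rw [this, h1, hb, one_zpow, mul_one, norm_mul]
      congr 1
      rw [Complex.norm_real, Real.norm_of_nonneg hr.le, Complex.norm_cpow_eq_rpow_re_of_pos hr]
      simp [hμ]
    rw [← ofReal_norm, ← ofReal_norm, hnorm, ENNReal.toReal_ofNat,
      ENNReal.ofReal_rpow_of_nonneg (by positivity) (by norm_num),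
      ENNReal.ofReal_rpow_of_nonneg (by positivity) (by norm_num),
      ← ENNReal.ofReal_mul (by positivity)]
    congr 1
    rw [Real.mul_rpow (by positivity) (by positivity), ← Real.rpow_mul hr.le, ← mul_assoc,
      ← Real.rpow_natCast, ← Real.rpow_add hr, hd]
    push_cast
    ring_nf
    simp
  have e1 := lintegral_weight _ (hmeas (smoothAct μ δ g f)) (hhom _) (fun x => ‖x‖) continuous_norm
    (fun X hX => norm_pos_iff.2 hX)
    (fun r hr X => by rw [norm_smul, Real.norm_of_nonneg hr.le])
  have e2 := lintegral_weight _ (hmeas f) (hhom _) (fun x => ‖act g x‖) (act g).continuous.norm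
    (fun X hX => norm_pos_iff.2 (act_ne_zero g hX))
    (fun r hr X => by
      have : (r • X : CN n) = (r : ℂ) • X := rfl
      rw [this, map_smul, norm_smul, Complex.norm_real, Real.norm_of_nonneg hr.le])
  refine e1.symm.trans (Eq.trans ?_ e2)
  rw [← lintegral_comp_act g]
  · refine lintegral_congr fun x => ?_
    have : (smoothAct μ δ g f : CN n → ℂ) (act g x) = (f : CN n → ℂ) x := by
      show (f : CN n → ℂ) (act g⁻¹ (act g x)) = _
      rw [act_inv_act]
    rw [this]
    rfl
  · exact (hmeas _).mul ((by fun_prop : Measurable fun x : CN n => ENNReal.ofReal ‖x‖).indicator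
      (measurableSet_lt measurable_norm measurable_const))

end isometry

/-- The bounded operator on `V_{μ,δ}` that extends `f ↦ f(g⁻¹ ·)` on `V^∞_{μ,δ}`. -/
def piOp {n : ℕ} (μ : ℂ) (δ : ℤ) (g : Sp n) : V n μ δ →L[ℂ] V n μ δ :=
  (incl n μ δ ∘ₗ smoothAct μ δ g).extendOfNorm (incl n μ δ)

theorem piOp_incl {n : ℕ} {μ : ℂ} (hμ : μ.re = 0) (δ : ℤ) (g : Sp n) (f : Vsmooth n μ δ) :
    piOp μ δ g (incl n μ δ f) = incl n μ δ (smoothAct μ δ g f) :=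
  LinearMap.extendOfNorm_eq (denseRange_incl n μ δ)
    ⟨1, fun f => by rw [one_mul]; exact (norm_incl_smoothAct hμ δ g f).le⟩ f

theorem norm_piOp {n : ℕ} {μ : ℂ} (hμ : μ.re = 0) (δ : ℤ) (g : Sp n) (F : V n μ δ) :
    ‖piOp μ δ g F‖ = ‖F‖ := by
  refine (denseRange_incl n μ δ).induction_on F ?_ fun f => ?_
  · exact isClosed_eq (piOp μ δ g).continuous.norm continuous_norm
  · rw [piOp_incl hμ, norm_incl_smoothAct hμ]

theorem piOp_one {n : ℕ} {μ : ℂ} (hμ : μ.re = 0) (δ : ℤ) (F : V n μ δ) :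
    piOp μ δ (1 : Sp n) F = F := by
  refine (denseRange_incl n μ δ).induction_on F ?_ fun f => ?_
  · exact isClosed_eq (piOp μ δ 1).continuous continuous_id
  · rw [piOp_incl hμ]
    congr 1
    ext x
    show (f : CN n → ℂ) (act 1⁻¹ x) = _
    rw [inv_one, act_one]
    rfl

theorem piOp_mul {n : ℕ} {μ : ℂ} (hμ : μ.re = 0) (δ : ℤ) (g g' : Sp n) (F : V n μ δ) :
    piOp μ δ (g * g') F = piOp μ δ g (piOp μ δ g' F) := by
  refine (denseRange_incl n μ δ).induction_on F ?_ fun f => ?_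
  · exact isClosed_eq (piOp μ δ _).continuous
      ((piOp μ δ g).continuous.comp (piOp μ δ g').continuous)
  · rw [piOp_incl hμ, piOp_incl hμ, piOp_incl hμ]
    congr 1
    ext x
    show (f : CN n → ℂ) (act (g * g')⁻¹ x) = (f : CN n → ℂ) (act g'⁻¹ (act g⁻¹ x))
    rw [mul_inv_rev, act_mul]

/-- The degenerate principal series representation `π_{μ,δ}` of `G` on `V_{μ,δ}`, `μ ∈ iℝ`: the
unitary representation that acts on `V^∞_{μ,δ}` by `f ↦ f(g⁻¹ ·)`. -/
def principalSeries (n : ℕ) (μ : ℂ) (hμ : μ.re = 0) (δ : ℤ) :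
    Sp n →* (V n μ δ ≃ₗᵢ[ℂ] V n μ δ) where
  toFun g :=
    { toLinearEquiv := LinearEquiv.ofLinearMap (piOp μ δ g : V n μ δ →ₗ[ℂ] V n μ δ) (piOp μ δ g⁻¹)
        (by
          ext1 F
          simpa [piOp_one hμ] using (piOp_mul hμ δ g g⁻¹ F).symm)
        (by
          ext1 F
          simpa [piOp_one hμ] using (piOp_mul hμ δ g⁻¹ g F).symm)
      norm_map' := fun F => norm_piOp hμ δ g F }
  map_one' := LinearIsometryEquiv.ext fun F => piOp_one hμ δ F
  map_mul' g g' := LinearIsometryEquiv.ext fun F => piOp_mul hμ δ g g' F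

/-! ### The complex symplectic Fourier transform -/

/-- The real-linear automorphism `ξ ↦ conj (J ξ)`, `J(ξ₁, ξ₂) = (-ξ₂, ξ₁)`. It turns the real
scalar product `Re ⟨X, conj Y⟩` of `ℂ^N` into `Re ω`. -/
def conjJ (n : ℕ) : CN n ≃L[ℝ] CN n :=
  LinearEquiv.toContinuousLinearEquiv
    { toFun := fun ξ => WithLp.toLp 2 (Sum.elim (fun k => -(starRingEnd ℂ) (ξ (Sum.inr k)))
        (fun k => (starRingEnd ℂ) (ξ (Sum.inl k))))
      invFun := fun ξ => WithLp.toLp 2 (Sum.elim (fun k => (starRingEnd ℂ) (ξ (Sum.inr k)))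
        (fun k => -(starRingEnd ℂ) (ξ (Sum.inl k))))
      map_add' := fun x y => by ext (k | k) <;> simp [add_comm]
      map_smul' := fun c x => by ext (k | k) <;> simp
      left_inv := fun x => by ext (k | k) <;> simp
      right_inv := fun x => by ext (k | k) <;> simp }

theorem inner_conjJ {n : ℕ} (X ξ : CN n) : inner ℝ X (conjJ n ξ) = (sympForm X ξ).re := by
  simp [PiLp.inner_apply, Fintype.sum_sum_type, conjJ, sympForm, Complex.inner, sub_eq_add_neg,
    Finset.sum_add_distrib, mul_comm]
  ring

/-- The complex symplectic Fourier transform on `𝓢(ℂ^N)`. -/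
def sympFourier (n : ℕ) : 𝓢(CN n, ℂ) →L[ℂ] 𝓢(CN n, ℂ) :=
  SchwartzMap.compCLMOfContinuousLinearEquiv ℂ (conjJ n) ∘L
    FourierTransform.fourierCLM ℂ 𝓢(CN n, ℂ)

theorem sympFourier_apply {n : ℕ} (f : 𝓢(CN n, ℂ)) (ξ : CN n) :
    sympFourier n f ξ =
      ∫ X, f X * Complex.exp (-2 * Complex.I * Real.pi * ((sympForm X ξ).re : ℂ)) := by
  show (𝓕 (f : CN n → ℂ)) (conjJ n ξ) = _
  rw [Real.fourier_eq']
  refine integral_congr_ae (ae_of_all _ fun X => ?_)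
  simp only [inner_conjJ, smul_eq_mul]
  rw [mul_comm]
  congr 2
  push_cast
  ring

/-- The transpose of `sympFourier`, `φ ↦ (X ↦ ∫ φ(ξ) e^{-2iπ Re ω(X,ξ)} dξ)`. -/
def sympFourierTranspose (n : ℕ) : 𝓢(CN n, ℂ) →L[ℂ] 𝓢(CN n, ℂ) :=
  SchwartzMap.compCLMOfContinuousLinearEquiv ℂ (ContinuousLinearEquiv.neg ℝ) ∘L sympFourier n

theorem sympForm_neg_swap {n : ℕ} (X Y : CN n) : sympForm X (-Y) = sympForm Y X := by
  simp [sympForm, mul_comm]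
  ring

theorem sympFourierTranspose_apply {n : ℕ} (φ : 𝓢(CN n, ℂ)) (X : CN n) :
    sympFourierTranspose n φ X =
      ∫ ξ, φ ξ * Complex.exp (-2 * Complex.I * Real.pi * ((sympForm X ξ).re : ℂ)) := by
  show sympFourier n φ (-X) = _
  simp only [sympFourier_apply, sympForm_neg_swap]

/-- The complex symplectic Fourier transform on `𝓢'(ℂ^N)`, defined by duality. -/
def sympFourierDist (n : ℕ) : 𝓢'(CN n, ℂ) →L[ℂ] 𝓢'(CN n, ℂ) :=
  PointwiseConvergenceCLM.precomp ℂ (sympFourierTranspose n)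

/-- The two definitions agree on Schwartz functions. -/
theorem sympFourierDist_coe {n : ℕ} (f : 𝓢(CN n, ℂ)) :
    sympFourierDist n (SchwartzMap.toTemperedDistributionCLM (CN n) ℂ volume f) =
      SchwartzMap.toTemperedDistributionCLM (CN n) ℂ volume (sympFourier n f) := by
  let L : CN n →ₗ[ℝ] CN n →ₗ[ℝ] ℝ :=
    (innerₗ (CN n)).compl₂ ((conjJ n : CN n →L[ℝ] CN n) : CN n →ₗ[ℝ] CN n)
  have hL : ∀ X Y, L X Y = (sympForm X Y).re := fun X Y => inner_conjJ X Y
  have hLc : Continuous fun p : CN n × CN n => L p.1 p.2 :=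
    continuous_inner.comp (continuous_fst.prodMk ((conjJ n).continuous.comp continuous_snd))
  have key : ∀ (X ξ : CN n) (c : ℂ), Real.fourierChar (-(L X ξ)) • c =
      c * Complex.exp (-2 * Complex.I * Real.pi * ((sympForm X ξ).re : ℂ)) := by
    intro X ξ c
    rw [hL, Circle.smul_def, Real.fourierChar_apply, smul_eq_mul, mul_comm]
    congr 2
    push_cast
    ring
  apply UniformConvergenceCLM.ext
  intro φ
  have h := VectorFourier.integral_bilin_fourierIntegral_eq_flip (ContinuousLinearMap.mul ℂ ℂ)
    (μ := volume) (ν := volume) (L := L) Real.continuous_fourierChar hLc f.integrable φ.integrable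
  have e1 : ∫ x, sympFourierTranspose n φ x • f x =
      ∫ x, f x * VectorFourier.fourierIntegral Real.fourierChar volume L.flip φ x := by
    refine integral_congr_ae (ae_of_all _ fun x => ?_)
    simp only [sympFourierTranspose_apply, VectorFourier.fourierIntegral, LinearMap.flip_apply, key,
      smul_eq_mul]
    rw [mul_comm]
  have e2 : ∫ x, φ x • sympFourier n f x =
      ∫ x, VectorFourier.fourierIntegral Real.fourierChar volume L f x * φ x := by
    refine integral_congr_ae (ae_of_all _ fun x => ?_)
    simp only [sympFourier_apply, VectorFourier.fourierIntegral, key, smul_eq_mul]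
    rw [mul_comm]
  have e3 := SchwartzMap.toTemperedDistributionCLM_apply_apply volume f (sympFourierTranspose n φ)
  have e4 := SchwartzMap.toTemperedDistributionCLM_apply_apply volume (sympFourier n f) φ
  exact e3.trans (e1.trans (h.symm.trans (e2.symm.trans e4.symm)))

/-- The tempered distribution `T` is given by the function `f`: for every test function `φ` the
product `φ f` is integrable and `T φ = ∫ φ f`. -/
def IsGivenBy {n : ℕ} (T : 𝓢'(CN n, ℂ)) (f : CN n → ℂ) : Prop :=
  ∀ φ : 𝓢(CN n, ℂ), Integrable (fun x => φ x * f x) ∧ T φ = ∫ x, φ x * f x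

/-! ### Knapp–Stein operators -/

/-- `F` is the meromorphic continuation to `ℂ` of the function `F₀` on `U`. -/
def IsMeroExt (U : Set ℂ) (F₀ F : ℂ → ℂ) : Prop :=
  MeromorphicNFOn F univ ∧ ∀ z ∈ U, F z = F₀ z

open Classical in
/-- The meromorphic continuation to `ℂ` of a function `F₀` on `U` (`0` if there is none). If `U` is
open and nonempty, it is unique. -/
def meroExt (U : Set ℂ) (F₀ : ℂ → ℂ) : ℂ → ℂ :=
  if h : ∃ F, IsMeroExt U F₀ F then h.choose else 0

/-- The Knapp–Stein kernel `|Re ω(X,Y)|^{-μ-N} [Re ω(X,Y)]^{-δ}`. -/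
def ksKernel {n : ℕ} (μ : ℂ) (δ : ℤ) (X Y : CN n) : ℂ :=
  ((|(sympForm X Y).re| : ℝ) : ℂ) ^ (-μ - (2 * n : ℂ)) * bracket ((sympForm X Y).re : ℂ) ^ (-δ)

/-- The half-plane `Re μ < 1 - N`, where the Knapp–Stein integral converges. -/
def ksDomain (n : ℕ) : Set ℂ := {μ | μ.re < 1 - 2 * n}

/-- The integral `∫_S h(X) |Re ω(X,Y)|^{-μ-N} [Re ω(X,Y)]^{-δ} dσ(X)`. -/
def ksIntegral {n : ℕ} (μ : ℂ) (δ : ℤ) (h : Sph n → ℂ) (Y : CN n) : ℂ :=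
  ∫ X : Sph n, h X * ksKernel μ δ X Y ∂sphMeas n

open Classical in
/-- The Knapp–Stein operator `T_{μ,δ}`, defined by meromorphic continuation in `μ` of the integral.
It is applied to `f|_S`, the only data of `f ∈ V_{-μ,-δ}` that enters the integral and that can be
kept fixed as `μ` varies. Its values are functions on `ℂ^N \ {0}`, with value `0` at the origin. -/
def knappStein {n : ℕ} (μ : ℂ) (δ : ℤ) (h : Sph n → ℂ) (Y : CN n) : ℂ :=
  if Y = 0 then 0 else meroExt (ksDomain n) (fun ν => ksIntegral ν δ h Y) μ

/-- The normalising constant `C_N(μ,δ)`, `N = 2n`. -/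
def normConst (n : ℕ) (μ : ℂ) (δ : ℤ) : ℂ :=
  if Even δ then
    2 * (Real.pi : ℂ) ^ (μ + 2 * n - 1 / 2) *
      (Complex.Gamma ((1 - μ - 2 * n) / 2) / Complex.Gamma ((μ + 2 * n) / 2))
  else
    2 * Complex.I * (Real.pi : ℂ) ^ (μ + 2 * n - 1 / 2) *
      (Complex.Gamma ((2 - μ - 2 * n) / 2) / Complex.Gamma ((1 + μ + 2 * n) / 2))

/-- The normalised Knapp–Stein operator: the quotient of `T_{μ,δ}` by `C_N(μ,δ)` as meromorphic
functions of `μ` (removable singularities being removed). -/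
def normKnappStein {n : ℕ} (μ : ℂ) (δ : ℤ) (h : Sph n → ℂ) (Y : CN n) : ℂ :=
  toMeromorphicNFOn (fun ν => knappStein ν δ h Y / normConst n ν δ) univ μ

/-- The poles of the Gamma factor of `1 / C_N(μ,δ)`: the `μ` with `μ + N = -k` for an integer
`k ≥ 0` of the parity of `δ`. -/
def ksPoles (n : ℕ) (δ : ℤ) : Set ℂ :=
  {μ | ∃ k : ℕ, Even ((k : ℤ) - δ) ∧ μ + 2 * n = -(k : ℂ)}

end KnappStein

end

open KnappStein

open MeasureTheory Set Filter Topology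
open scoped SchwartzMap FourierTransform ContDiff

noncomputable section

namespace KnappStein

/-! ### Holomorphic dependence on an exponent -/

/-! Write N = 2n and s = μ + N, let b = `bumpMellin 0`, and let χ be a bump function around 1. Up to
the constant b, the homogeneous function h_{μ-N} is a superposition of the dilates of a single
Schwartz function G(x) = χ(‖x‖) h_{μ-N}(x) (`annularSchwartz`). Under the Fourier transform F this
becomes b · F h_{μ-N}(Y) = ∫₀^∞ u^{s-1} (F G)(uY) du, the Mellin transform of F G along the ray
through Y (`integral_mul_rayMellin_sympFourier`). The right-hand side makes sense for Re s > 0 and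
is smooth in Y ≠ 0.

For 0 < Re s < 1, insert the integral that defines F G and integrate over u first. With t = Re ω(x,
Y) the inner integral is Γ(s) (2πit)^{-s}, which a factor e^{-εu} makes rigorous
(`rayMellin_sympFourier`). Since G has the parity of δ, averaging over x and -x replaces this by
|t|^{-s} [t]^{-δ} times a cosine or sine factor, and the functional equation of Γ identifies the
constant as 1/C_N (`cpow_form_add`). Integrating out the radius leaves C_N⁻¹ times the Knapp–Stein
integral over the sphere (`rayMellin_annular_of_strip`).

So the Mellin formula (Re s > 0) and the normalised sphere integral (Re s < 1) agree on the common
strip. Glued together they form `normKS`, defined for all μ, whose only possible poles are those of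
1/C_N in Re s ≤ 0. By uniqueness of meromorphic continuation it is the normalised operator. The
distributions h_{μ-N} are given directly for Re s > 0; for Re s ≤ 0 they are obtained as Fourier
transforms of `normKS`, because the symplectic transform is an involution.

For imaginary μ a homogeneous function is determined by being the Fourier transform of another one
(`IsFourierPair.unique`), so linearity, invertibility and commutation with Sp(n, ℂ) are inherited
from the Fourier transform. Unitarity is the Parseval formula for G against a homogeneous function:
integrating out the radius turns it into an identity of sphere pairings
(`integral_sphere_normKnappStein_mul_conj`). Density carries everything to the Hilbert spaces. -/

theorem abs_log_mul_rpow_le {k ε σ : ℝ} (hk : 0 < k) (hε : 0 < ε) :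
    |Real.log k| * k ^ σ ≤ ε⁻¹ * (k ^ (σ + ε) + k ^ (σ - ε)) := by
  have h1 : |Real.log k| ≤ ε⁻¹ * (k ^ ε + k ^ (-ε)) := by
    have a1 := Real.log_le_rpow_div hk.le hε
    have a2 := Real.log_le_rpow_div (inv_nonneg.2 hk.le) hε
    rw [Real.log_inv, Real.inv_rpow hk.le, ← Real.rpow_neg hk.le] at a2
    have b1 : 0 < k ^ ε := Real.rpow_pos_of_pos hk _
    have b2 : 0 < k ^ (-ε) := Real.rpow_pos_of_pos hk _
    have c1 : 0 ≤ k ^ ε / ε := by positivity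
    have c2 : 0 ≤ k ^ (-ε) / ε := by positivity
    rw [mul_add, inv_mul_eq_div, inv_mul_eq_div, abs_le]
    constructor <;> linarith
  calc _ ≤ ε⁻¹ * (k ^ ε + k ^ (-ε)) * k ^ σ :=
        mul_le_mul_of_nonneg_right h1 (Real.rpow_nonneg hk.le _)
    _ = _ := by
        rw [sub_eq_add_neg, Real.rpow_add hk, Real.rpow_add hk]
        ring

theorem rpow_le_add_of_mem_Icc {k a b σ : ℝ} (hk : 0 < k) (ha : a ≤ σ) (hb : σ ≤ b) :
    k ^ σ ≤ k ^ a + k ^ b := by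
  rcases le_total 1 k with h | h
  · exact (Real.rpow_le_rpow_of_exponent_le h hb).trans
      (le_add_of_nonneg_left (Real.rpow_nonneg hk.le _))
  · exact (Real.rpow_le_rpow_of_exponent_ge hk h ha).trans
      (le_add_of_nonneg_right (Real.rpow_nonneg hk.le _))

/-- Differentiation under the integral sign. The derivative brings down log k, which costs an
arbitrarily small shift of the exponent in both directions; as `s` is open, integrability at nearby
real exponents supplies the majorant. All holomorphy in μ of sphere integrals and of distributions
comes from here, as does (with k = e^{-u}) that of Laplace integrals. -/
theorem differentiableOn_integral_cpow {α : Type*} [MeasurableSpace α] {ν : Measure α} {f : α → ℂ}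
    {k : α → ℝ} {s : Set ℝ} (hs : IsOpen s) (hf : AEStronglyMeasurable f ν)
    (hk : AEMeasurable k ν) (hpos : ∀ᵐ x ∂ν, 0 < k x)
    (hint : ∀ σ ∈ s, Integrable (fun x => ‖f x‖ * k x ^ σ) ν) :
    DifferentiableOn ℂ (fun z : ℂ => ∫ x, f x * (k x : ℂ) ^ z ∂ν) {z | z.re ∈ s} := by
  intro z hz
  obtain ⟨ε, hε, hball⟩ := Metric.isOpen_iff.1 hs z.re hz
  -- One η is spent on the radius of the ball around z and one on the logarithm; the exponents Re z
  -- ± 2η still lie in `s`.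
  set η := ε / 4 with hη
  have hη0 : 0 < η := by positivity
  have hmem : ∀ τ : ℝ, |τ| ≤ 2 * η → z.re + τ ∈ s := by
    intro τ hτ
    apply hball
    rw [Metric.mem_ball, Real.dist_eq, add_sub_cancel_left]
    linarith
  have hmeas : ∀ w : ℂ, AEStronglyMeasurable (fun x => f x * (k x : ℂ) ^ w) ν := fun w =>
    hf.mul ((Complex.measurable_ofReal.comp_aemeasurable hk).pow_const w).aestronglyMeasurable
  refine (hasDerivAt_integral_of_dominated_loc_of_deriv_le (𝕜 := ℂ)
    (F := fun (w : ℂ) x => f x * (k x : ℂ) ^ w)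
    (F' := fun (w : ℂ) x => f x * ((k x : ℂ) ^ w * Real.log (k x)))
    (bound := fun x => η⁻¹ * 2 * (‖f x‖ * k x ^ (z.re + 2 * η) + ‖f x‖ * k x ^ (z.re + -(2 * η))))
    (s := Metric.ball z η) (Metric.ball_mem_nhds _ hη0) (Eventually.of_forall hmeas)
    ?_ ?_ ?_ ?_ ?_).2.differentiableAt.differentiableWithinAt
  · refine (hint z.re hz).mono' (hmeas z) ?_
    filter_upwards [hpos] with x hx
    rw [norm_mul, Complex.norm_cpow_eq_rpow_re_of_pos hx]
  · exact hf.mul (((Complex.measurable_ofReal.comp_aemeasurable hk).pow_const z).mul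
      (Complex.measurable_ofReal.comp_aemeasurable
        (Real.measurable_log.comp_aemeasurable hk))).aestronglyMeasurable
  · filter_upwards [hpos] with x hx w hw
    rw [norm_mul, norm_mul, Complex.norm_cpow_eq_rpow_re_of_pos hx, Complex.norm_real,
      Real.norm_eq_abs, mul_comm (k x ^ w.re)]
    have hre : |w.re - z.re| < η := by
      rw [← Complex.sub_re]
      exact (Complex.abs_re_le_norm _).trans_lt (by rwa [mem_ball_iff_norm] at hw)
    rw [abs_lt] at hre
    have h1 := abs_log_mul_rpow_le (σ := w.re) hx hη0
    have h2 := rpow_le_add_of_mem_Icc (a := z.re + -(2 * η)) (b := z.re + 2 * η) (σ := w.re + η) hx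
      (by linarith) (by linarith)
    have h3 := rpow_le_add_of_mem_Icc (a := z.re + -(2 * η)) (b := z.re + 2 * η) (σ := w.re - η) hx
      (by linarith) (by linarith)
    calc _ ≤ ‖f x‖ * (η⁻¹ * (2 * (k x ^ (z.re + -(2 * η)) + k x ^ (z.re + 2 * η)))) := by
          refine mul_le_mul_of_nonneg_left (h1.trans ?_) (norm_nonneg _)
          exact mul_le_mul_of_nonneg_left (by linarith) (by positivity)
      _ = _ := by ring
  · exact (((hint _ (hmem (2 * η) (by rw [abs_of_nonneg (by positivity)]))).add
      (hint _ (hmem (-(2 * η)) (by rw [abs_neg, abs_of_nonneg (by positivity)])))).const_mul _)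
  · filter_upwards [hpos] with x hx w _
    have hx' : (k x : ℂ) ≠ 0 := by exact_mod_cast hx.ne'
    have := ((hasDerivAt_id' w).const_cpow (c := (k x : ℂ)) (Or.inl hx')).const_mul (f x)
    rwa [mul_one, ← Complex.ofReal_log hx.le] at this

/-! ### Polar coordinates -/

theorem finrank_CN (n : ℕ) : Module.finrank ℝ (CN n) = 4 * n := by
  rw [← Module.finrank_mul_finrank ℝ ℂ (CN n), Complex.finrank_real_complex,
    finrank_euclideanSpace]
  simp
  ring

/-- The radial measure `r^{4n-1} dr` on the half-line. -/
def radial (n : ℕ) : Measure ℝ :=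
  (volume.restrict (Ioi (0 : ℝ))).withDensity fun r => ENNReal.ofReal (r ^ (4 * n - 1))

instance (n : ℕ) : SFinite (radial n) := by unfold radial; infer_instance

/-- In this form, polar coordinates reduce integrability and Fubini to the general theorems on
product measures. -/
theorem measurePreserving_polar (n : ℕ) [Nontrivial (CN n)] :
    MeasurePreserving (fun p : Sph n × ℝ => p.2 • (p.1 : CN n)) ((sphMeas n).prod (radial n))
      volume := by
  have hm : Measurable fun p : Sph n × ℝ => p.2 • (p.1 : CN n) := by fun_prop
  refine ⟨hm, Measure.ext fun A hA => ?_⟩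
  rw [Measure.map_apply hm hA, ← lintegral_indicator_one (hm hA), ← lintegral_indicator_one hA,
    lintegral_polar _ (measurable_one.indicator hA), lintegral_prod _ (by
      exact (measurable_one.indicator (hm hA)).aemeasurable)]
  refine lintegral_congr fun X => ?_
  rw [radial, lintegral_withDensity_eq_lintegral_mul _ (by fun_prop)
    (by exact (measurable_one.indicator (hm hA)).comp measurable_prodMk_left), finrank_CN]
  rfl

theorem integrable_polar {n : ℕ} [Nontrivial (CN n)] {G : CN n → ℂ}
    (hG : AEStronglyMeasurable G volume) :
    Integrable G ↔ Integrable (fun p : Sph n × ℝ => G (p.2 • (p.1 : CN n)))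
      ((sphMeas n).prod (radial n)) :=
  ((measurePreserving_polar n).integrable_comp hG).symm

theorem integral_polar {n : ℕ} [Nontrivial (CN n)] {G : CN n → ℂ}
    (hG : AEStronglyMeasurable G volume) :
    ∫ x, G x = ∫ p : Sph n × ℝ, G (p.2 • (p.1 : CN n)) ∂((sphMeas n).prod (radial n)) := by
  conv_lhs => rw [← (measurePreserving_polar n).map_eq]
  rw [integral_map (measurePreserving_polar n).measurable.aemeasurable]
  rwa [(measurePreserving_polar n).map_eq]

theorem integral_radial {n : ℕ} (g : ℝ → ℂ) :
    ∫ r, g r ∂radial n = ∫ r in Ioi (0 : ℝ), ((r ^ (4 * n - 1) : ℝ) : ℂ) * g r := by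
  rw [radial, integral_withDensity_eq_integral_toReal_smul (by fun_prop)
    (ae_of_all _ fun _ => ENNReal.ofReal_lt_top)]
  refine setIntegral_congr_fun measurableSet_Ioi fun r (hr : 0 < r) => ?_
  rw [ENNReal.toReal_ofReal (by positivity), Complex.real_smul]

theorem integrable_radial {n : ℕ} (g : ℝ → ℂ) :
    Integrable g (radial n) ↔
      IntegrableOn (fun r : ℝ => ((r ^ (4 * n - 1) : ℝ) : ℂ) * g r) (Ioi 0) := by
  rw [radial, integrable_withDensity_iff_integrable_smul' (by fun_prop)
    (ae_of_all _ fun _ => ENNReal.ofReal_lt_top)]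
  refine integrableOn_congr_fun (fun r (hr : 0 < r) => ?_) measurableSet_Ioi
  rw [ENNReal.toReal_ofReal (by positivity), Complex.real_smul]

theorem ae_radial_pos (n : ℕ) : ∀ᵐ r ∂radial n, 0 < r :=
  (withDensity_absolutelyContinuous _ _).ae_le (ae_restrict_mem measurableSet_Ioi)

theorem sphere_ne_zero {n : ℕ} (X : Sph n) : (X : CN n) ≠ 0 := by
  intro h
  have := X.2
  simp_all

theorem norm_sphere {n : ℕ} (X : Sph n) : ‖(X : CN n)‖ = 1 := by simp

/-! ### Powers of a linear form -/

theorem integrable_abs_rpow_mul_exp {a : ℝ} (ha : -1 < a) :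
    Integrable fun t : ℝ => |t| ^ a * Real.exp (-t ^ 2) := by
  have h := integrableOn_rpow_mul_exp_neg_mul_sq one_pos ha
  have h1 : IntegrableOn (fun t : ℝ => |t| ^ a * Real.exp (-t ^ 2)) (Ioi 0) := by
    refine h.congr_fun (fun t (ht : 0 < t) => ?_) measurableSet_Ioi
    simp [abs_of_pos ht]
  rw [← integrableOn_univ, ← Iic_union_Ioi (a := (0 : ℝ)), integrableOn_union,
    integrableOn_Iic_iff_integrableOn_Iio]
  refine ⟨?_, h1⟩
  have := h1.comp_neg
  simpa using this

theorem integrable_abs_re_rpow_mul_exp {a : ℝ} (ha : -1 < a) :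
    Integrable fun z : ℂ => |z.re| ^ a * Real.exp (-‖z‖ ^ 2) := by
  have h := (integrable_abs_rpow_mul_exp ha).mul_prod
    (integrable_exp_neg_mul_sq (one_pos : (0 : ℝ) < 1))
  have h2 := (Complex.volume_preserving_equiv_real_prod.integrable_comp_emb
    Complex.measurableEquivRealProd.measurableEmbedding).2 h
  refine h2.congr (ae_of_all _ fun z => ?_)
  simp only [Function.comp, Complex.measurableEquivRealProd_apply]
  rw [mul_assoc, ← Real.exp_add, ← Complex.normSq_eq_norm_sq, Complex.normSq_apply]
  ring_nf

/-- The Gaussian factorises over the coordinates, so this is a product of one-variable integrals of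
which only the `i`-th is singular. -/
theorem integrable_abs_re_coord_rpow_mul_exp {n : ℕ} {a : ℝ} (ha : -1 < a) (i : Fin n ⊕ Fin n) :
    Integrable fun x : CN n => |(x i).re| ^ a * Real.exp (-‖x‖ ^ 2) := by
  classical
  have h := Integrable.fintype_prod (ι := Fin n ⊕ Fin n) (E := ℂ)
    (μ := fun _ => (volume : Measure ℂ))
    (f := fun j (z : ℂ) => (if j = i then |z.re| ^ a else 1) * Real.exp (-‖z‖ ^ 2)) (fun j => by
      by_cases hj : j = i
      · simpa [hj] using integrable_abs_re_rpow_mul_exp ha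
      · have := integrable_abs_re_rpow_mul_exp (a := 0) (by norm_num)
        simpa [hj] using this)
  rw [← volume_pi] at h
  let e : CN n ≃L[ℝ] (Fin n ⊕ Fin n → ℂ) :=
    PiLp.continuousLinearEquiv 2 ℝ (fun _ : Fin n ⊕ Fin n => ℂ)
  -- Uniqueness of Haar measure is enough: the value of the proportionality constant does not affect
  -- integrability.
  have hme : (volume : Measure (CN n)).map e =
      Measure.addHaarScalarFactor ((volume : Measure (CN n)).map e) volume •
        (volume : Measure (Fin n ⊕ Fin n → ℂ)) :=
    Measure.isAddLeftInvariant_eq_smul _ _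
  have h2 := h.smul_measure_nnreal (c := Measure.addHaarScalarFactor
    ((volume : Measure (CN n)).map e) (volume : Measure (Fin n ⊕ Fin n → ℂ)))
  rw [← hme] at h2
  refine (h2.comp_measurable e.continuous.measurable).congr (ae_of_all _ fun x => ?_)
  simp only [Function.comp, Finset.prod_mul_distrib]
  rw [← Real.exp_sum, EuclideanSpace.norm_sq_eq]
  simp [e]

/-- The Gaussian integral of a power of a linear form. -/
def gaussPow {n : ℕ} (a : ℝ) (y : CN n) : ENNReal :=
  ∫⁻ x : CN n, ENNReal.ofReal (|inner ℝ x y| ^ a * Real.exp (-‖x‖ ^ 2))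

theorem gaussPow_isometry {n : ℕ} (a : ℝ) (g : CN n ≃ₗᵢ[ℝ] CN n) (y : CN n) :
    gaussPow a (g y) = gaussPow a y := by
  have hm : Measurable fun x : CN n =>
      ENNReal.ofReal (|inner ℝ x (g y)| ^ a * Real.exp (-‖x‖ ^ 2)) := by fun_prop
  rw [gaussPow, ← g.measurePreserving.lintegral_comp hm]
  simp [gaussPow, g.inner_map_map]

theorem gaussPow_smul {n : ℕ} (a : ℝ) {r : ℝ} (hr : 0 < r) (y : CN n) :
    gaussPow a (r • y) = ENNReal.ofReal (r ^ a) * gaussPow a y := by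
  rw [gaussPow, gaussPow, ← lintegral_const_mul _ (by fun_prop)]
  refine lintegral_congr fun x => ?_
  rw [inner_smul_right, abs_mul, abs_of_pos hr, Real.mul_rpow hr.le (abs_nonneg _), mul_assoc,
    ENNReal.ofReal_mul (by positivity)]

/-- The Gaussian is rotation invariant, so only ‖y‖ matters, and homogeneity in y fixes how.
Finiteness is then a matter of one coordinate vector. -/
theorem exists_gaussPow_eq {n : ℕ} [Nontrivial (CN n)] {a : ℝ} (ha : -1 < a) :
    ∃ K : ENNReal, K ≠ ⊤ ∧ ∀ y : CN n, y ≠ 0 → gaussPow a y = ENNReal.ofReal (‖y‖ ^ a) * K := by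
  classical
  have hne : Nonempty (Fin n ⊕ Fin n) := by
    by_contra h
    rw [not_nonempty_iff] at h
    exact not_subsingleton (CN n) inferInstance
  obtain ⟨i⟩ := hne
  set e : CN n := EuclideanSpace.single i 1 with he
  refine ⟨gaussPow a e, ?_, fun y hy => ?_⟩
  · have h := (integrable_abs_re_coord_rpow_mul_exp ha i).lintegral_lt_top
    have : gaussPow a e = ∫⁻ x : CN n, ENNReal.ofReal (|(x i).re| ^ a * Real.exp (-‖x‖ ^ 2)) := by
      refine lintegral_congr fun x => ?_
      have : inner ℝ x e = (x i).re := by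
        rw [he, PiLp.inner_apply, Finset.sum_eq_single i]
        · simp [Complex.inner]
        · intro j _ hj
          simp [hj]
        · simp
      rw [this]
    rw [this]
    exact h.ne
  · have hy0 : 0 < ‖y‖ := norm_pos_iff.2 hy
    have hn : ‖e‖ = ‖(‖y‖⁻¹ : ℝ) • y‖ := by
      rw [norm_smul, norm_inv, norm_norm, inv_mul_cancel₀ hy0.ne', he]
      simp
    -- The reflection in the hyperplane orthogonal to e - y/‖y‖ exchanges these two unit vectors.
    rw [← gaussPow_isometry a (Submodule.reflection (ℝ ∙ (e - (‖y‖⁻¹ : ℝ) • y))ᗮ) e,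
      Submodule.reflection_sub hn, ← gaussPow_smul a hy0, smul_smul, mul_inv_cancel₀ hy0.ne',
      one_smul]

theorem norm_conjJ {n : ℕ} (Y : CN n) : ‖conjJ n Y‖ = ‖Y‖ := by
  have : ‖conjJ n Y‖ ^ 2 = ‖Y‖ ^ 2 := by
    rw [EuclideanSpace.norm_sq_eq, EuclideanSpace.norm_sq_eq]
    simp [conjJ, Fintype.sum_sum_type, add_comm]
  exact (sq_eq_sq₀ (norm_nonneg _) (norm_nonneg _)).1 this

theorem integrable_abs_form_rpow_mul_exp {n : ℕ} [Nontrivial (CN n)] {a : ℝ} (ha : -1 < a)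
    {Y : CN n} (hY : Y ≠ 0) :
    Integrable fun x : CN n => |(sympForm x Y).re| ^ a * Real.exp (-‖x‖ ^ 2) := by
  obtain ⟨K, hK, h⟩ := exists_gaussPow_eq (n := n) ha
  have h1 := h (conjJ n Y) (by simpa using hY)
  simp only [← inner_conjJ]
  have hm : Measurable fun x : CN n => |inner ℝ x (conjJ n Y)| ^ a * Real.exp (-‖x‖ ^ 2) := by
    fun_prop
  refine ⟨hm.aestronglyMeasurable, ?_⟩
  rw [hasFiniteIntegral_iff_ofReal (ae_of_all _ fun x => by positivity)]
  exact h1.trans_lt (ENNReal.mul_lt_top ENNReal.ofReal_lt_top hK.lt_top)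

/-- The integral over the sphere of a power of `|Re ω(·, Y)|` is finite, and is a multiple of the
corresponding power of `‖Y‖`. -/
theorem exists_lintegral_sphere_eq {n : ℕ} [Nontrivial (CN n)] {a : ℝ} (ha : -1 < a) :
    ∃ K : ENNReal, K ≠ ⊤ ∧ ∀ Y : CN n, Y ≠ 0 →
      ∫⁻ X : Sph n, ENNReal.ofReal (|(sympForm (X : CN n) Y).re| ^ a) ∂sphMeas n =
        ENNReal.ofReal (‖Y‖ ^ a) * K := by
  obtain ⟨K, hK, h⟩ := exists_gaussPow_eq (n := n) ha
  have hd : 0 < 4 * n := by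
    rw [← finrank_CN]
    exact Module.finrank_pos
  -- The radial part of the Gaussian integral, the same for all points of the sphere. Dividing by it
  -- requires 0 < κ < ∞.
  set κ : ENNReal := ∫⁻ r in Ioi (0 : ℝ),
    ENNReal.ofReal (r ^ (4 * n - 1) * (r ^ a * Real.exp (-r ^ 2))) with hκ
  have hκtop : κ ≠ ⊤ := by
    have h1 := (integrableOn_rpow_mul_exp_neg_mul_sq one_pos
      (s := ((4 * n - 1 : ℕ) : ℝ) + a) (by
        have : (0 : ℝ) ≤ ((4 * n - 1 : ℕ) : ℝ) := Nat.cast_nonneg _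
        linarith)).lintegral_lt_top
    refine ne_of_lt (lt_of_le_of_lt (le_of_eq ?_) h1)
    refine setLIntegral_congr_fun measurableSet_Ioi fun r (hr : 0 < r) => ?_
    rw [Real.rpow_add hr, Real.rpow_natCast, neg_one_mul, mul_assoc]
  have hκ0 : κ ≠ 0 := by
    rw [hκ, ne_eq, setLIntegral_eq_zero_iff measurableSet_Ioi (by fun_prop)]
    intro hae
    have : ∀ᵐ r : ℝ, r ∉ Ioi (0 : ℝ) := by
      filter_upwards [hae] with r hr hr0
      have hr0' : 0 < r := hr0
      have := hr hr0
      rw [ENNReal.ofReal_eq_zero] at this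
      have h3 : 0 < r ^ (4 * n - 1) * (r ^ a * Real.exp (-r ^ 2)) := by positivity
      linarith
    have h2 : volume (Ioi (0 : ℝ)) = 0 := by
      rw [ae_iff] at this
      exact measure_mono_null (fun r hr => by simpa using hr) this
    rw [Real.volume_Ioi] at h2
    exact ENNReal.top_ne_zero h2
  refine ⟨K / κ, ENNReal.div_ne_top hK hκ0, fun Y hY => ?_⟩
  have h1 := h (conjJ n Y) (by simpa using hY)
  rw [norm_conjJ, gaussPow, lintegral_polar _ (by fun_prop)] at h1
  have h2 : ∀ X : Sph n, (∫⁻ r in Ioi (0 : ℝ),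
      ENNReal.ofReal (r ^ (Module.finrank ℝ (CN n) - 1)) * ENNReal.ofReal
        (|inner ℝ (r • (X : CN n)) (conjJ n Y)| ^ a * Real.exp (-‖r • (X : CN n)‖ ^ 2))) =
      ENNReal.ofReal (|(sympForm (X : CN n) Y).re| ^ a) * κ := by
    intro X
    rw [hκ, ← lintegral_const_mul _ (by fun_prop)]
    refine setLIntegral_congr_fun measurableSet_Ioi fun r (hr : 0 < r) => ?_
    rw [finrank_CN, inner_smul_left, inner_conjJ, norm_smul, norm_sphere,
      ← ENNReal.ofReal_mul (by positivity), ← ENNReal.ofReal_mul (by positivity)]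
    congr 1
    simp only [conj_trivial, abs_mul, abs_of_pos hr, Real.norm_eq_abs, mul_one]
    rw [Real.mul_rpow hr.le (abs_nonneg _)]
    ring
  simp only [h2] at h1
  rw [lintegral_mul_const _ (by simp only [← inner_conjJ]; fun_prop)] at h1
  rw [← mul_div_assoc, ← h1, ENNReal.mul_div_cancel_right hκ0 hκtop]

theorem integrable_sphere_form_rpow {n : ℕ} [Nontrivial (CN n)] {a : ℝ} (ha : -1 < a) {Y : CN n}
    (hY : Y ≠ 0) :
    Integrable (fun X : Sph n => |(sympForm (X : CN n) Y).re| ^ a) (sphMeas n) := by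
  obtain ⟨K, hK, h⟩ := exists_lintegral_sphere_eq (n := n) ha
  simp only [← inner_conjJ] at h ⊢
  have hm : Measurable fun X : Sph n => |inner ℝ (X : CN n) (conjJ n Y)| ^ a := by fun_prop
  refine ⟨hm.aestronglyMeasurable, ?_⟩
  rw [hasFiniteIntegral_iff_ofReal (ae_of_all _ fun x => by positivity), h Y hY]
  exact ENNReal.mul_lt_top ENNReal.ofReal_lt_top hK.lt_top

theorem exists_integral_sphere_form_rpow {n : ℕ} [Nontrivial (CN n)] {a : ℝ} (ha : -1 < a) :
    ∃ C : ℝ, 0 ≤ C ∧ ∀ Y : CN n, Y ≠ 0 →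
      ∫ X : Sph n, |(sympForm (X : CN n) Y).re| ^ a ∂sphMeas n = C * ‖Y‖ ^ a := by
  obtain ⟨K, hK, h⟩ := exists_lintegral_sphere_eq (n := n) ha
  refine ⟨K.toReal, ENNReal.toReal_nonneg, fun Y hY => ?_⟩
  rw [integral_eq_lintegral_of_nonneg_ae (ae_of_all _ fun x => by positivity)
    (integrable_sphere_form_rpow ha hY).1, h Y hY, ENNReal.toReal_mul,
    ENNReal.toReal_ofReal (by positivity), mul_comm]

/-! ### Hyperplanes are null sets -/

theorem ae_form_ne_zero {n : ℕ} {Y : CN n} (hY : Y ≠ 0) :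
    ∀ᵐ x : CN n, (sympForm x Y).re ≠ 0 := by
  have h : (volume : Measure (CN n)) ((innerₗ (CN n) (conjJ n Y)).ker : Set (CN n)) = 0 := by
    apply Measure.addHaar_submodule
    intro htop
    rw [LinearMap.ker_eq_top] at htop
    have := LinearMap.congr_fun htop (conjJ n Y)
    simp at this
    exact hY this
  rw [ae_iff]
  convert h using 2
  ext x
  simp [← inner_conjJ, real_inner_comm]

theorem ae_sphere_form_ne_zero {n : ℕ} {Y : CN n} (hY : Y ≠ 0) :
    ∀ᵐ X : Sph n ∂sphMeas n, (sympForm (X : CN n) Y).re ≠ 0 := by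
  have hms : MeasurableSet {X : Sph n | ¬ (sympForm (X : CN n) Y).re ≠ 0} := by
    simp only [← inner_conjJ, not_not]
    exact measurableSet_eq_fun (by fun_prop) measurable_const
  rw [ae_iff, sphMeas, Measure.toSphere_apply' _ hms]
  -- The surface measure of a set is a multiple of the volume of the cone over it, and this cone
  -- lies in the hyperplane Re ω(·, Y) = 0.
  refine mul_eq_zero_of_right _ (measure_mono_null ?_ (ae_iff.1 (ae_form_ne_zero hY)))
  rintro _ ⟨r, hr, _, ⟨X, hX, rfl⟩, rfl⟩
  simp only [not_not, mem_ofPred_eq] at hX ⊢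
  rw [← inner_conjJ] at hX ⊢
  simp only [inner_smul_left, hX, mul_zero]

/-! ### Homogeneous extensions -/

section homExt

variable {n : ℕ}

theorem homExt_zero (lam : ℂ) (h : Sph n → ℂ) : homExt lam h 0 = 0 := by simp [homExt]

theorem homExt_smul_sphere (lam : ℂ) (h : Sph n → ℂ) {r : ℝ} (hr : 0 < r) (X : Sph n) :
    homExt lam h (r • (X : CN n)) = (r : ℂ) ^ lam * h X := by
  have h0 : r • (X : CN n) ≠ 0 := smul_ne_zero hr.ne' (sphere_ne_zero X)
  have hn : ‖r • (X : CN n)‖ = r := by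
    rw [norm_smul, norm_sphere, mul_one, Real.norm_of_nonneg hr.le]
  rw [homExt, dif_neg h0]
  congr 2
  · rw [hn]
  · ext1
    simp only [hn, smul_smul]
    rw [inv_mul_cancel₀ hr.ne', one_smul]

theorem homExt_sphere (lam : ℂ) (h : Sph n → ℂ) (X : Sph n) : homExt lam h (X : CN n) = h X := by
  have := homExt_smul_sphere lam h one_pos X
  simpa using this

theorem homExt_eq (lam : ℂ) (h : Sph n → ℂ) (x : CN n) :
    homExt lam h x = (‖x‖ : ℂ) ^ lam * homExt 0 h x := by
  by_cases hx : x = 0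
  · simp [hx, homExt_zero]
  · simp [homExt, hx]

/-- Every non-zero vector is a positive multiple of a vector on the sphere. -/
theorem exists_smul_sphere {x : CN n} (hx : x ≠ 0) :
    ∃ X : Sph n, x = ‖x‖ • (X : CN n) := by
  refine ⟨⟨(‖x‖⁻¹ : ℝ) • x, by simp [norm_smul, hx]⟩, ?_⟩
  rw [smul_smul, mul_inv_cancel₀ (norm_ne_zero_iff.2 hx), one_smul]

theorem measurable_homExt (lam : ℂ) {h : Sph n → ℂ} (hh : Measurable h) :
    Measurable (homExt lam h) := by
  refine measurable_of_measurable_on_compl_singleton 0 ?_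
  have : ({x : CN n | x ≠ 0}.domRestrict (homExt lam h)) = fun x : {x : CN n | x ≠ 0} =>
      (‖(x : CN n)‖ : ℂ) ^ lam * h ⟨(‖(x : CN n)‖⁻¹ : ℝ) • (x : CN n), by
        have := x.2
        simp only [mem_ofPred_eq] at this
        simp [norm_smul, this]⟩ := by
    funext x
    have hx : (x : CN n) ≠ 0 := x.2
    simp only [domRestrict_apply, homExt, dif_neg hx]
  rw [this]
  refine ((Complex.measurable_ofReal.comp (by fun_prop)).pow_const _).mul (hh.comp ?_)
  exact Measurable.subtype_mk (by fun_prop)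

theorem contDiffOn_norm_cpow (lam : ℂ) :
    ContDiffOn ℝ ∞ (fun x : CN n => (‖x‖ : ℂ) ^ lam) {0}ᶜ := by
  have h1 : ContDiffOn ℝ ∞ (fun x : CN n => Complex.exp ((Real.log ‖x‖ : ℝ) * lam)) {0}ᶜ := by
    refine Complex.contDiff_exp.comp_contDiffOn (ContDiffOn.mul ?_ contDiffOn_const)
    refine Complex.ofRealCLM.contDiff.comp_contDiffOn fun x hx => ?_
    have hx' : x ≠ 0 := hx
    exact (((contDiffAt_norm ℝ hx').log (norm_ne_zero_iff.2 hx'))).contDiffWithinAt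
  refine h1.congr fun x hx => ?_
  have hx' : x ≠ 0 := hx
  rw [Complex.cpow_def_of_ne_zero (by exact_mod_cast norm_ne_zero_iff.2 hx'),
    ← Complex.ofReal_log (norm_nonneg _)]

theorem contDiffOn_homExt {h : Sph n → ℂ} (hh : ContDiffOn ℝ ∞ (homExt 0 h) {0}ᶜ) (lam : ℂ) :
    ContDiffOn ℝ ∞ (homExt lam h) {0}ᶜ :=
  ((contDiffOn_norm_cpow lam).mul hh).congr fun x _ => homExt_eq lam h x

theorem continuous_of_contDiffOn_homExt {h : Sph n → ℂ}
    (hh : ContDiffOn ℝ ∞ (homExt 0 h) {0}ᶜ) : Continuous h := by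
  have h1 := hh.continuousOn.comp_continuous continuous_subtype_val
    fun X : Sph n => sphere_ne_zero X
  refine h1.congr fun X => ?_
  rw [Function.comp_apply]
  exact homExt_sphere 0 h X

theorem integrable_sphere_of_continuous {h : Sph n → ℂ} (hh : Continuous h) :
    Integrable h (sphMeas n) := by
  obtain ⟨C, hC⟩ := (isCompact_range hh).isBounded.exists_norm_le
  exact Integrable.of_bound hh.aestronglyMeasurable C (ae_of_all _ fun X => hC _ ⟨X, rfl⟩)

theorem homExt_phase {δ : ℤ} {h : Sph n → ℂ} (hh : h ∈ SmoothSphere n δ) (lam : ℂ) {c : ℂ}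
    (hc : ‖c‖ = 1) (x : CN n) : homExt lam h (c • x) = c ^ (-δ) * homExt lam h x := by
  by_cases hx : x = 0
  · simp [hx, homExt_zero]
  · obtain ⟨X, hX⟩ := exists_smul_sphere hx
    have hn : 0 < ‖x‖ := norm_pos_iff.2 hx
    let X' : Sph n := ⟨c • (X : CN n), by simp [norm_smul, hc]⟩
    have e : c • x = ‖x‖ • (X' : CN n) := by
      conv_lhs => rw [hX]
      exact smul_comm _ _ _
    rw [e, homExt_smul_sphere _ _ hn, hh.2 c X X' hc rfl]
    conv_rhs => rw [hX, homExt_smul_sphere _ _ hn]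
    ring

theorem homExt_neg {δ : ℤ} {h : Sph n → ℂ} (hh : h ∈ SmoothSphere n δ) (lam : ℂ) (x : CN n) :
    homExt lam h (-x) = (-1) ^ (-δ) * homExt lam h x := by
  have := homExt_phase hh lam (c := -1) (by simp) x
  rwa [neg_one_smul] at this

end homExt

/-! ### Cut-off functions supported in an annulus -/

/-- A smooth bump function around `1` with support in `(0, ∞)`. -/
def bumpOne : ContDiffBump (1 : ℝ) := ⟨1 / 4, 1 / 2, by norm_num, by norm_num⟩

theorem bumpOne_eq_zero {r : ℝ} (hr : 1 / 2 ≤ |r - 1|) : bumpOne r = 0 :=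
  bumpOne.zero_of_le_dist (by rwa [Real.dist_eq])

/-- The homogeneous extension, cut off to an annulus. -/
def annular {n : ℕ} (lam : ℂ) (h : Sph n → ℂ) (x : CN n) : ℂ :=
  ((bumpOne ‖x‖ : ℝ) : ℂ) * homExt lam h x

theorem annular_eq_zero {n : ℕ} (lam : ℂ) (h : Sph n → ℂ) {x : CN n} (hx : ‖x‖ ≤ 1 / 2) :
    annular lam h x = 0 := by
  rw [annular, bumpOne_eq_zero]
  · simp
  · rw [abs_of_nonpos (by linarith)]
    linarith

theorem annular_eq_zero' {n : ℕ} (lam : ℂ) (h : Sph n → ℂ) {x : CN n} (hx : 2 ≤ ‖x‖) :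
    annular lam h x = 0 := by
  rw [annular, bumpOne_eq_zero]
  · simp
  · rw [abs_of_nonneg (by linarith)]
    linarith

theorem hasCompactSupport_annular {n : ℕ} (lam : ℂ) (h : Sph n → ℂ) :
    HasCompactSupport (annular lam h) := by
  refine HasCompactSupport.intro (isCompact_closedBall (0 : CN n) 2) fun x hx => ?_
  refine annular_eq_zero' lam h ?_
  simp only [Metric.mem_closedBall, dist_zero_right, not_le] at hx
  exact hx.le

theorem contDiff_annular {n : ℕ} (lam : ℂ) {h : Sph n → ℂ}
    (hh : ContDiffOn ℝ ∞ (homExt 0 h) {0}ᶜ) : ContDiff ℝ ∞ (annular lam h) := by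
  rw [contDiff_iff_contDiffAt]
  intro x
  by_cases hx : x = 0
  · have : annular lam h =ᶠ[𝓝 x] fun _ => 0 := by
      have hb : Metric.ball (0 : CN n) (1 / 2) ∈ 𝓝 x := by
        rw [hx]
        exact Metric.ball_mem_nhds _ (by norm_num)
      filter_upwards [hb] with y hy
      rw [Metric.mem_ball, dist_zero_right] at hy
      exact annular_eq_zero lam h hy.le
    exact contDiffAt_const.congr_of_eventuallyEq this
  · have h1 : ContDiffAt ℝ ∞ (homExt lam h) x :=
      (contDiffOn_homExt hh lam).contDiffAt (isOpen_compl_singleton.mem_nhds hx)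
    have h2 : ContDiffAt ℝ ∞ (fun y : CN n => bumpOne ‖y‖) x :=
      bumpOne.contDiff.contDiffAt.comp x (contDiffAt_norm ℝ hx)
    exact (Complex.ofRealCLM.contDiff.contDiffAt.comp x h2).mul h1

/-- The cut-off homogeneous extension as a Schwartz function. -/
def annularSchwartz {n : ℕ} (lam : ℂ) {h : Sph n → ℂ}
    (hh : ContDiffOn ℝ ∞ (homExt 0 h) {0}ᶜ) : 𝓢(CN n, ℂ) :=
  (hasCompactSupport_annular lam h).toSchwartzMap (contDiff_annular lam hh)

theorem annularSchwartz_apply {n : ℕ} (lam : ℂ) {h : Sph n → ℂ}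
    (hh : ContDiffOn ℝ ∞ (homExt 0 h) {0}ᶜ) (x : CN n) :
    annularSchwartz lam hh x = annular lam h x := rfl

/-- The Mellin transform of the bump function. -/
def bumpMellin (z : ℂ) : ℂ := mellin (fun r => ((bumpOne r : ℝ) : ℂ)) z

theorem differentiable_bumpMellin : Differentiable ℂ bumpMellin := by
  intro z
  have hc : Continuous fun r : ℝ => ((bumpOne r : ℝ) : ℂ) :=
    Complex.continuous_ofReal.comp bumpOne.continuous
  refine mellin_differentiableAt_of_isBigO_rpow (a := z.re + 1) (b := z.re - 1)
    (hc.locallyIntegrable.locallyIntegrableOn _) ?_ (by linarith) ?_ (by linarith)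
  · refine (Asymptotics.isBigO_zero _ _).congr' ?_ EventuallyEq.rfl
    filter_upwards [eventually_ge_atTop (2 : ℝ)] with r hr
    rw [bumpOne_eq_zero]
    · simp
    · rw [abs_of_nonneg (by linarith)]
      linarith
  · refine (Asymptotics.isBigO_zero _ _).congr' ?_ EventuallyEq.rfl
    have : Iio (1 / 2 : ℝ) ∈ 𝓝[>] (0 : ℝ) :=
      mem_nhdsWithin_of_mem_nhds (Iio_mem_nhds (by norm_num))
    filter_upwards [this] with r hr
    have hr' : r < 1 / 2 := hr
    rw [bumpOne_eq_zero]
    · simp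
    · rw [abs_of_nonpos (by linarith)]
      linarith

/-- The integrand r⁻¹χ(r) is nonnegative and positive near 1. Dividing by this number undoes the
cut-off to the annulus. -/
theorem bumpMellin_zero_ne : bumpMellin 0 ≠ 0 := by
  have h1 : bumpMellin 0 = ((∫ r in Ioi (0 : ℝ), r⁻¹ * bumpOne r : ℝ) : ℂ) := by
    rw [bumpMellin, mellin, ← integral_complex_ofReal]
    refine setIntegral_congr_fun measurableSet_Ioi fun r (hr : 0 < r) => ?_
    simp [Complex.cpow_neg_one]
  rw [h1, Complex.ofReal_ne_zero]
  have hcont : Continuous fun r : ℝ => r⁻¹ * bumpOne r := by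
    rw [continuous_iff_continuousAt]
    intro r
    by_cases hr : r = 0
    · have : (fun r : ℝ => r⁻¹ * bumpOne r) =ᶠ[𝓝 r] fun _ => 0 := by
        have : Iio (1 / 2 : ℝ) ∈ 𝓝 r := by
          rw [hr]
          exact Iio_mem_nhds (by norm_num)
        filter_upwards [this] with t ht
        have ht' : t < 1 / 2 := ht
        rw [bumpOne_eq_zero, mul_zero]
        rw [abs_of_nonpos (by linarith)]
        linarith
      exact continuousAt_const.congr this.symm
    · exact (continuousAt_inv₀ hr).mul bumpOne.continuous.continuousAt
  have hsupp : HasCompactSupport fun r : ℝ => r⁻¹ * bumpOne r := bumpOne.hasCompactSupport.mul_left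
  refine ne_of_gt ?_
  rw [setIntegral_pos_iff_support_of_nonneg_ae]
  · have hsub : Ioo (3 / 4 : ℝ) (5 / 4) ⊆ (Function.support fun r : ℝ => r⁻¹ * bumpOne r) ∩ Ioi 0 := by
      intro r hr
      have h0 : 0 < r := by linarith [hr.1]
      refine ⟨?_, h0⟩
      have : bumpOne r ≠ 0 := by
        rw [bumpOne.one_of_mem_closedBall]
        · exact one_ne_zero
        · rw [Metric.mem_closedBall, Real.dist_eq, abs_le]
          show -(1 / 4 : ℝ) ≤ _ ∧ _ ≤ (1 / 4 : ℝ)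
          constructor <;> linarith [hr.1, hr.2]
      exact mul_ne_zero (inv_ne_zero h0.ne') this
    refine lt_of_lt_of_le ?_ (measure_mono hsub)
    rw [Real.volume_Ioo]
    norm_num
  · filter_upwards [ae_restrict_mem measurableSet_Ioi] with r hr
    have : 0 < r := hr
    exact mul_nonneg (by positivity) bumpOne.nonneg
  · exact (hcont.integrable_of_hasCompactSupport hsupp).integrableOn

/-- Integrals of cut-off homogeneous functions against homogeneous functions. -/
theorem integral_annular_mul {n : ℕ} [Nontrivial (CN n)] {lam ν : ℂ} {h : Sph n → ℂ}
    (hh : ContDiffOn ℝ ∞ (homExt 0 h) {0}ᶜ) {Q : CN n → ℂ} (hQm : AEStronglyMeasurable Q volume)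
    (hQ : ∀ r : ℝ, 0 < r → ∀ X : Sph n, Q (r • (X : CN n)) = (r : ℂ) ^ ν * Q X) :
    ∫ x, annular lam h x * Q x =
      (∫ X : Sph n, h X * Q X ∂sphMeas n) * bumpMellin (4 * n + lam + ν) := by
  have hd : 1 ≤ 4 * n := by
    rw [← finrank_CN]
    exact Module.finrank_pos
  rw [integral_polar (G := fun x => annular lam h x * Q x)
    ((contDiff_annular lam hh).continuous.aestronglyMeasurable.mul hQm)]
  have h1 : ∀ᵐ p : Sph n × ℝ ∂(sphMeas n).prod (radial n),
      annular lam h (p.2 • (p.1 : CN n)) * Q (p.2 • (p.1 : CN n)) =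
        (h p.1 * Q p.1) * ((p.2 : ℂ) ^ (lam + ν) * ((bumpOne p.2 : ℝ) : ℂ)) := by
    have : ∀ᵐ p : Sph n × ℝ ∂(sphMeas n).prod (radial n), 0 < p.2 :=
      Measure.quasiMeasurePreserving_snd.ae (ae_radial_pos n)
    filter_upwards [this] with p hp
    rw [hQ _ hp, annular, homExt_smul_sphere _ _ hp, norm_smul, norm_sphere, mul_one,
      Real.norm_of_nonneg hp.le, Complex.cpow_add _ _ (by exact_mod_cast hp.ne')]
    ring
  rw [integral_congr_ae h1, integral_prod_mul (fun X : Sph n => h X * Q X)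
    (fun r : ℝ => (r : ℂ) ^ (lam + ν) * ((bumpOne r : ℝ) : ℂ)), integral_radial, bumpMellin, mellin]
  congr 1
  refine setIntegral_congr_fun measurableSet_Ioi fun r (hr : 0 < r) => ?_
  have hr' : (r : ℂ) ≠ 0 := by exact_mod_cast hr.ne'
  rw [smul_eq_mul, ← mul_assoc, Complex.ofReal_pow, ← Complex.cpow_natCast, ← Complex.cpow_add _ _ hr',
    Nat.cast_sub hd]
  congr 2
  push_cast
  ring

/-! ### Mellin transforms of Schwartz functions along rays -/

/-- The standard majorant for a Schwartz function along rays through points of norm at least c: σ >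
0 gives convergence at 0, σ < M at infinity. -/
theorem integrableOn_rpow_mul_inv_one_add_pow {c σ : ℝ} (hc : 0 < c) (hσ : 0 < σ) {M : ℕ}
    (hM : σ < M) :
    IntegrableOn (fun u : ℝ => u ^ (σ - 1) * ((1 + u * c) ^ M)⁻¹) (Ioi 0) := by
  have hcont : ContinuousOn (fun u : ℝ => ((1 + u * c) ^ M)⁻¹) (Ici 0) := by
    refine ContinuousOn.inv₀ (by fun_prop) fun u (hu : 0 ≤ u) => ?_
    positivity
  refine mellin_convergent_of_isBigO_scalar (a := M) (b := 0)
    ((hcont.mono Ioi_subset_Ici_self).locallyIntegrableOn measurableSet_Ioi) ?_ hM ?_ hσ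
  · refine Asymptotics.IsBigO.of_bound ((c ^ M)⁻¹) ?_
    filter_upwards [eventually_gt_atTop (0 : ℝ)] with u hu
    rw [Real.norm_of_nonneg (by positivity), Real.norm_of_nonneg (by positivity),
      Real.rpow_neg hu.le, Real.rpow_natCast, ← mul_inv, ← mul_pow]
    gcongr
    rw [mul_comm]
    linarith
  · refine Asymptotics.IsBigO.of_bound 1 ?_
    filter_upwards [self_mem_nhdsWithin] with u hu
    have hu' : 0 < u := hu
    rw [Real.norm_of_nonneg (by positivity), neg_zero, Real.rpow_zero, norm_one, mul_one]
    refine inv_le_one_of_one_le₀ (one_le_pow₀ ?_)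
    nlinarith

theorem schwartz_decay {E F : Type*} [NormedAddCommGroup E] [NormedSpace ℝ E]
    [NormedAddCommGroup F] [NormedSpace ℝ F] (f : 𝓢(E, F)) (M : ℕ) :
    ∃ C : ℝ, 0 ≤ C ∧ ∀ x, ‖f x‖ ≤ C * ((1 + ‖x‖) ^ M)⁻¹ := by
  refine ⟨2 ^ M * (Finset.Iic (M, 0)).sup (fun m => SchwartzMap.seminorm ℝ m.1 m.2) f,
    by positivity, fun x => ?_⟩
  have := SchwartzMap.one_add_le_sup_seminorm_apply (𝕜 := ℝ) (m := (M, 0)) (k := M) (n := 0)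
    le_rfl le_rfl f x
  rw [norm_iteratedFDeriv_zero] at this
  rw [← div_eq_mul_inv, le_div_iff₀ (by positivity), mul_comm]
  exact this

section rays

variable {n : ℕ}

/-- The Mellin transform of a function along the ray through a point. -/
def rayMellin (s : ℂ) (f : CN n → ℂ) (Y : CN n) : ℂ := mellin (fun u : ℝ => f (u • Y)) s

theorem rayMellin_eq (s : ℂ) (f : CN n → ℂ) (Y : CN n) :
    rayMellin s f Y = ∫ u in Ioi (0 : ℝ), (u : ℂ) ^ (s - 1) * f (u • Y) := rfl

theorem rayMellin_smul (s : ℂ) (f : CN n → ℂ) {r : ℝ} (hr : 0 < r) (Y : CN n) :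
    rayMellin s f (r • Y) = (r : ℂ) ^ (-s) * rayMellin s f Y := by
  rw [rayMellin, rayMellin, ← smul_eq_mul, ← mellin_comp_mul_left _ _ hr]
  simp [smul_smul, mul_comm]

theorem exists_ray_bound (f : 𝓢(CN n, ℂ)) {σ : ℝ} (hσ : 0 < σ) {c : ℝ} (hc : 0 < c) :
    ∃ b : ℝ → ℝ, IntegrableOn b (Ioi 0) ∧ ∀ (s : ℂ) (u : ℝ) (Y : CN n), s.re = σ → 0 < u →
      c ≤ ‖Y‖ → ‖(u : ℂ) ^ (s - 1) * f (u • Y)‖ ≤ b u := by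
  obtain ⟨M, hM⟩ := exists_nat_gt σ
  obtain ⟨C, hC, h⟩ := schwartz_decay f M
  refine ⟨fun u => C * (u ^ (σ - 1) * ((1 + u * c) ^ M)⁻¹),
    (integrableOn_rpow_mul_inv_one_add_pow hc hσ hM).const_mul C, fun s u Y hs hu hY => ?_⟩
  rw [norm_mul, Complex.norm_cpow_eq_rpow_re_of_pos hu, Complex.sub_re, hs, Complex.one_re]
  simp only
  rw [mul_left_comm]
  refine mul_le_mul_of_nonneg_left ((h _).trans ?_) (by positivity)
  rw [norm_smul, Real.norm_of_nonneg hu.le]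
  gcongr

theorem measurable_ray (f : 𝓢(CN n, ℂ)) (s : ℂ) (Y : CN n) :
    AEStronglyMeasurable (fun u : ℝ => (u : ℂ) ^ (s - 1) * f (u • Y))
      (volume.restrict (Ioi 0)) := by
  refine Measurable.aestronglyMeasurable (Measurable.mul ?_ ?_)
  · exact Complex.measurable_ofReal.pow_const _
  · exact (f.continuous.comp (continuous_id.smul continuous_const)).measurable

theorem integrableOn_ray (f : 𝓢(CN n, ℂ)) {s : ℂ} (hs : 0 < s.re) {Y : CN n} (hY : Y ≠ 0) :
    IntegrableOn (fun u : ℝ => (u : ℂ) ^ (s - 1) * f (u • Y)) (Ioi 0) := by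
  obtain ⟨b, hb, h⟩ := exists_ray_bound f hs (norm_pos_iff.2 hY)
  refine Integrable.mono' hb (measurable_ray f s Y) ?_
  filter_upwards [ae_restrict_mem measurableSet_Ioi] with u hu
  exact h s u Y rfl hu le_rfl

theorem differentiableAt_rayMellin (f : 𝓢(CN n, ℂ)) {s : ℂ} (hs : 0 < s.re) {Y : CN n}
    (hY : Y ≠ 0) : DifferentiableAt ℂ (fun s => rayMellin s f Y) s := by
  have hn := norm_pos_iff.2 hY
  obtain ⟨M, hM⟩ := exists_nat_gt s.re
  obtain ⟨C, hC, h⟩ := schwartz_decay f M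
  have hc : Continuous fun u : ℝ => f (u • Y) := f.continuous.comp (by fun_prop)
  refine mellin_differentiableAt_of_isBigO_rpow (a := M) (b := 0)
    (hc.locallyIntegrable.locallyIntegrableOn _) ?_ hM ?_ hs
  · refine Asymptotics.IsBigO.of_bound (C * (‖Y‖ ^ M)⁻¹) ?_
    filter_upwards [eventually_gt_atTop (0 : ℝ)] with u hu
    rw [Real.norm_of_nonneg (r := _ ^ _) (by positivity), Real.rpow_neg hu.le, Real.rpow_natCast,
      mul_assoc, ← mul_inv, ← mul_pow]
    refine (h _).trans ?_
    gcongr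
    rw [norm_smul, Real.norm_of_nonneg hu.le, mul_comm]
    linarith
  · refine Asymptotics.IsBigO.of_bound C ?_
    filter_upwards with u
    simp only [neg_zero, Real.rpow_zero, norm_one]
    refine (h _).trans ?_
    refine mul_le_mul_of_nonneg_left (inv_le_one_of_one_le₀ (one_le_pow₀ ?_)) hC
    linarith [norm_nonneg (u • Y)]

/-- The chain rule produces a factor u, so a directional derivative of a ray transform is again a
ray transform, of a Schwartz function and with s + 1 for s. This closure under differentiation is
what yields smoothness in `contDiffOn_rayMellin`. -/
theorem hasFDerivAt_rayMellin (f : 𝓢(CN n, ℂ)) {s : ℂ} (hs : 0 < s.re) {Y : CN n} (hY : Y ≠ 0) :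
    ∃ L : CN n →L[ℝ] ℂ, HasFDerivAt (rayMellin s f) L Y ∧
      ∀ v, L v = rayMellin (s + 1) (LineDeriv.lineDerivOp v f : 𝓢(CN n, ℂ)) Y := by
  set D : 𝓢(CN n, CN n →L[ℝ] ℂ) := SchwartzMap.fderivCLM ℝ (CN n) ℂ f with hD
  have hn := norm_pos_iff.2 hY
  have hs1 : 0 < s.re + 1 := by linarith
  obtain ⟨M, hM⟩ := exists_nat_gt (s.re + 1)
  obtain ⟨C, hC, h⟩ := schwartz_decay D M
  set F' : CN n → ℝ → CN n →L[ℝ] ℂ := fun Y u => (u : ℂ) ^ s • D (u • Y) with hF'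
  have hmeas : AEStronglyMeasurable (F' Y) (volume.restrict (Ioi 0)) := by
    refine AEStronglyMeasurable.smul (f := fun u : ℝ => (u : ℂ) ^ s) (g := fun u : ℝ => D (u • Y))
      ?_ ?_
    · exact (Complex.measurable_ofReal.pow_const _).aestronglyMeasurable
    · exact (D.continuous.comp (continuous_id.smul continuous_const)).aestronglyMeasurable
  -- On the ball of radius ‖Y‖/2 all points have norm at least ‖Y‖/2, so one majorant serves them
  -- all.
  have hbound : ∀ᵐ u ∂volume.restrict (Ioi (0 : ℝ)), ∀ Z ∈ Metric.ball Y (‖Y‖ / 2),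
      ‖F' Z u‖ ≤ C * (u ^ (s.re + 1 - 1) * ((1 + u * (‖Y‖ / 2)) ^ M)⁻¹) := by
    filter_upwards [ae_restrict_mem measurableSet_Ioi] with u hu Z hZ
    have hu' : 0 < u := hu
    have hZ' : ‖Y‖ / 2 ≤ ‖Z‖ := by
      rw [mem_ball_iff_norm] at hZ
      have := norm_sub_norm_le Y Z
      rw [norm_sub_rev] at this
      linarith
    rw [hF', norm_smul, Complex.norm_cpow_eq_rpow_re_of_pos hu', add_sub_cancel_right,
      mul_left_comm]
    refine mul_le_mul_of_nonneg_left ((h _).trans ?_) (by positivity)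
    rw [norm_smul, Real.norm_of_nonneg hu'.le]
    gcongr
  have hbi := (integrableOn_rpow_mul_inv_one_add_pow (half_pos hn) hs1 hM).const_mul C
  have hder := hasFDerivAt_integral_of_dominated_of_fderiv_le (𝕜 := ℝ)
    (F := fun (Z : CN n) (u : ℝ) => (u : ℂ) ^ (s - 1) * f (u • Z)) (F' := F')
    (Metric.ball_mem_nhds Y (half_pos hn)) (Eventually.of_forall fun Z => measurable_ray f s Z)
    (integrableOn_ray f hs hY) hmeas hbound hbi (by
      filter_upwards [ae_restrict_mem measurableSet_Ioi] with u hu Z _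
      have hu' : (u : ℂ) ≠ 0 := by
        have : 0 < u := hu
        exact_mod_cast this.ne'
      have h1 : HasFDerivAt (fun Z : CN n => f (u • Z)) (u • D (u • Z)) Z := by
        have a1 : HasFDerivAt (fun Z : CN n => u • Z) (u • ContinuousLinearMap.id ℝ (CN n)) Z :=
          (hasFDerivAt_id Z).const_smul u
        have a2 := (f.differentiableAt (x := u • Z)).hasFDerivAt.comp Z a1
        refine a2.congr_fderiv ?_
        ext v
        simp [hD]
      have h2 := h1.const_mul ((u : ℂ) ^ (s - 1))
      refine h2.congr_fderiv ?_
      rw [hF']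
      ext v
      simp only [_root_.smul_apply, smul_eq_mul, Complex.real_smul]
      rw [← mul_assoc]
      congr 1
      conv_lhs => rw [← Complex.cpow_one (u : ℂ)]
      nth_rewrite 1 [Complex.cpow_one]
      rw [← Complex.cpow_add _ _ hu', sub_add_cancel])
  refine ⟨_, hder, fun v => ?_⟩
  have hint : Integrable (F' Y) (volume.restrict (Ioi 0)) :=
    Integrable.mono' hbi hmeas (by
      filter_upwards [hbound] with u hu
      exact hu Y (Metric.mem_ball_self (half_pos hn)))
  rw [ContinuousLinearMap.integral_apply hint, rayMellin_eq]
  refine integral_congr_ae (ae_of_all _ fun u => ?_)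
  simp only [hF', add_sub_cancel_right, hD, _root_.smul_apply, smul_eq_mul,
    SchwartzMap.fderivCLM_apply, SchwartzMap.lineDerivOp_apply_eq_fderiv]

theorem contDiffOn_rayMellin (f : 𝓢(CN n, ℂ)) {s : ℂ} (hs : 0 < s.re) :
    ContDiffOn ℝ ∞ (rayMellin s f) {0}ᶜ := by
  rw [contDiffOn_infty]
  intro k
  -- Both `f` and `s` must vary, since the induction step passes to ∂_v f and s + 1.
  induction k generalizing f s with
  | zero =>
    rw [Nat.cast_zero, contDiffOn_zero]
    intro Y hY
    obtain ⟨L, hL, -⟩ := hasFDerivAt_rayMellin f hs hY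
    exact hL.continuousAt.continuousWithinAt
  | succ k ih =>
    rw [Nat.cast_succ]
    refine contDiffOn_succ_of_fderiv_apply ?_ (by simp) fun v => ?_
    · intro Y hY
      obtain ⟨L, hL, -⟩ := hasFDerivAt_rayMellin f hs hY
      exact hL.differentiableAt.differentiableWithinAt
    · refine (ih (LineDeriv.lineDerivOp v f : 𝓢(CN n, ℂ)) (s := s + 1) (by
        simp only [Complex.add_re, Complex.one_re]
        linarith)).congr fun Y hY => ?_
      obtain ⟨L, hL, hv⟩ := hasFDerivAt_rayMellin f hs hY
      rw [fderivWithin_of_isOpen isOpen_compl_singleton hY, hL.fderiv, hv]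

/-! ### Homogeneous functions as tempered distributions -/

/-- Every Schwartz function is dominated by a multiple of one weight, so this single integrability
statement yields the distribution together with its continuity. Only integrability of `q` is
assumed, because elements of L²(S) will be inserted. -/
theorem integrable_weight_homExt [Nontrivial (CN n)] {ν : ℂ} (hν : 0 < 4 * n + ν.re) {M : ℕ}
    (hM : 4 * n + ν.re < M) {q : Sph n → ℂ} (hqm : Measurable q) (hq : Integrable q (sphMeas n)) :
    Integrable fun x : CN n => ((((1 + ‖x‖) ^ M)⁻¹ : ℝ) : ℂ) * homExt ν q x := by
  have hd : 1 ≤ 4 * n := by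
    rw [← finrank_CN]
    exact Module.finrank_pos
  have hm : Measurable fun x : CN n => ((((1 + ‖x‖) ^ M)⁻¹ : ℝ) : ℂ) :=
    Complex.measurable_ofReal.comp (by fun_prop)
  rw [integrable_polar (G := fun x : CN n => ((((1 + ‖x‖) ^ M)⁻¹ : ℝ) : ℂ) * homExt ν q x)
    (hm.mul (measurable_homExt ν hqm)).aestronglyMeasurable]
  have h2 : Integrable (fun r : ℝ => (r : ℂ) ^ ν * ((((1 + r) ^ M)⁻¹ : ℝ) : ℂ)) (radial n) := by
    rw [integrable_radial]
    have h3 := integrableOn_rpow_mul_inv_one_add_pow one_pos hν hM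
    refine Integrable.mono' h3 ?_ ?_
    · refine Measurable.aestronglyMeasurable (Measurable.mul (by fun_prop) (Measurable.mul ?_ ?_))
      · exact Complex.measurable_ofReal.pow_const _
      · exact Complex.measurable_ofReal.comp (by fun_prop)
    · filter_upwards [ae_restrict_mem measurableSet_Ioi] with r hr
      have hr' : 0 < r := hr
      rw [norm_mul, norm_mul, Complex.norm_real, Complex.norm_real,
        Complex.norm_cpow_eq_rpow_re_of_pos hr', Real.norm_of_nonneg (by positivity),
        Real.norm_of_nonneg (by positivity), ← mul_assoc, mul_one, ← Real.rpow_natCast,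
        ← Real.rpow_add hr', Nat.cast_sub hd]
      refine le_of_eq ?_
      congr 2
      push_cast
      ring
  refine (hq.mul_prod h2).congr ?_
  have : ∀ᵐ p : Sph n × ℝ ∂(sphMeas n).prod (radial n), 0 < p.2 :=
    Measure.quasiMeasurePreserving_snd.ae (ae_radial_pos n)
  filter_upwards [this] with p hp
  rw [homExt_smul_sphere _ _ hp, norm_smul, norm_sphere, mul_one, Real.norm_of_nonneg hp.le]
  ring

theorem integrable_schwartz_mul_of_weight {f : CN n → ℂ} (hfm : Measurable f) {M : ℕ}
    (hf : Integrable fun x : CN n => ((((1 + ‖x‖) ^ M)⁻¹ : ℝ) : ℂ) * f x) (φ : 𝓢(CN n, ℂ)) :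
    Integrable fun x => φ x * f x := by
  obtain ⟨C, hC, h⟩ := schwartz_decay φ M
  refine Integrable.mono' (hf.norm.const_mul C) (φ.continuous.measurable.mul
    hfm).aestronglyMeasurable (ae_of_all _ fun x => ?_)
  rw [norm_mul, norm_mul, Complex.norm_real, Real.norm_of_nonneg (by positivity), ← mul_assoc]
  exact mul_le_mul_of_nonneg_right (h x) (norm_nonneg _)

theorem exists_isGivenBy {f : CN n → ℂ} (hfm : Measurable f) {M : ℕ}
    (hf : Integrable fun x : CN n => ((((1 + ‖x‖) ^ M)⁻¹ : ℝ) : ℂ) * f x) :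
    ∃ T : 𝓢'(CN n, ℂ), IsGivenBy T f := by
  have hint := integrable_schwartz_mul_of_weight hfm hf
  let L : 𝓢(CN n, ℂ) →L[ℂ] ℂ := SchwartzMap.mkCLMtoNormedSpace (fun φ => ∫ x, φ x * f x)
    (fun φ ψ => by
      simp only [_root_.add_apply, add_mul]
      exact integral_add (hint φ) (hint ψ))
    (fun a φ => by
      simp only [_root_.smul_apply, smul_eq_mul, mul_assoc, RingHom.id_apply]
      exact integral_const_mul _ _)
    ⟨Finset.Iic (M, 0), 2 ^ M * ∫ x, ‖((((1 + ‖x‖) ^ M)⁻¹ : ℝ) : ℂ) * f x‖, by positivity, by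
      intro φ
      refine (norm_integral_le_integral_norm _).trans ?_
      rw [mul_right_comm, ← integral_const_mul]
      refine integral_mono (hint φ).norm (hf.norm.const_mul _) fun x => ?_
      simp only [norm_mul, Complex.norm_real]
      rw [Real.norm_of_nonneg (by positivity), ← mul_assoc]
      refine mul_le_mul_of_nonneg_right ?_ (norm_nonneg _)
      have := SchwartzMap.one_add_le_sup_seminorm_apply (𝕜 := ℂ) (m := (M, 0)) (k := M) (n := 0)
        le_rfl le_rfl φ x
      rw [norm_iteratedFDeriv_zero] at this
      rw [← div_eq_mul_inv, le_div_iff₀ (by positivity), mul_comm]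
      exact this⟩
  exact ⟨ContinuousLinearMap.toPointwiseConvergenceCLM _ _ _ _ L, fun φ => ⟨hint φ, rfl⟩⟩

theorem integrable_schwartz_mul_homExt [Nontrivial (CN n)] {ν : ℂ} (hν : 0 < 4 * n + ν.re)
    {q : Sph n → ℂ} (hqm : Measurable q) (hq : Integrable q (sphMeas n)) (φ : 𝓢(CN n, ℂ)) :
    Integrable fun x => φ x * homExt ν q x := by
  obtain ⟨M, hM⟩ := exists_nat_gt (4 * n + ν.re)
  exact integrable_schwartz_mul_of_weight (measurable_homExt ν hqm)
    (integrable_weight_homExt hν hM hqm hq) φ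

theorem exists_isGivenBy_homExt [Nontrivial (CN n)] {ν : ℂ} (hν : 0 < 4 * n + ν.re)
    {q : Sph n → ℂ} (hqm : Measurable q) (hq : Integrable q (sphMeas n)) :
    ∃ T : 𝓢'(CN n, ℂ), IsGivenBy T (homExt ν q) := by
  obtain ⟨M, hM⟩ := exists_nat_gt (4 * n + ν.re)
  exact exists_isGivenBy (measurable_homExt ν hqm) (integrable_weight_homExt hν hM hqm hq)

/-- Integrals of Schwartz functions against homogeneous functions in polar coordinates. -/
theorem integral_schwartz_mul_homExt [Nontrivial (CN n)] {ν : ℂ} (hν : 0 < 4 * n + ν.re)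
    {q : Sph n → ℂ} (hqm : Measurable q) (hq : Integrable q (sphMeas n)) (φ : 𝓢(CN n, ℂ)) :
    ∫ x, φ x * homExt ν q x = ∫ X : Sph n, q X * rayMellin (4 * n + ν) φ X ∂sphMeas n := by
  have hd : 1 ≤ 4 * n := by
    rw [← finrank_CN]
    exact Module.finrank_pos
  have hint := integrable_schwartz_mul_homExt hν hqm hq φ
  rw [integrable_polar hint.1] at hint
  rw [integral_polar (G := fun x => φ x * homExt ν q x) (φ.continuous.measurable.mul
    (measurable_homExt ν hqm)).aestronglyMeasurable, integral_prod _ hint]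
  refine integral_congr_ae (ae_of_all _ fun X => ?_)
  simp only
  rw [integral_radial, rayMellin_eq, ← integral_const_mul]
  refine setIntegral_congr_fun measurableSet_Ioi fun r (hr : 0 < r) => ?_
  have hr' : (r : ℂ) ≠ 0 := by exact_mod_cast hr.ne'
  rw [homExt_smul_sphere _ _ hr, mul_left_comm (φ _), ← mul_assoc, ← mul_assoc, ← mul_assoc, mul_comm (q X),
    Complex.ofReal_pow, ← Complex.cpow_natCast, ← Complex.cpow_add _ _ hr', Nat.cast_sub hd]
  have e : ((4 * n : ℕ) : ℂ) - ((1 : ℕ) : ℂ) + ν = 4 * n + ν - 1 := by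
    push_cast
    ring
  rw [e]
  ring

end rays

/-! ### The Knapp–Stein kernel -/

section kernel

variable {n : ℕ}

theorem bracket_ofReal_of_pos {t : ℝ} (ht : 0 < t) : bracket (t : ℂ) = 1 := by
  have : (t : ℂ) ≠ 0 := by exact_mod_cast ht.ne'
  simp [bracket, abs_of_pos ht, this]

theorem bracket_ofReal_of_neg {t : ℝ} (ht : t < 0) : bracket (t : ℂ) = -1 := by
  have : (t : ℂ) ≠ 0 := by exact_mod_cast ht.ne
  simp [bracket, abs_of_neg ht, this]

theorem norm_bracket {a : ℂ} (ha : a ≠ 0) : ‖bracket a‖ = 1 := by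
  simp [bracket, ha]

theorem sympForm_smul_left (c : ℂ) (X Y : CN n) : sympForm (c • X) Y = c * sympForm X Y := by
  simp [sympForm, mul_sub, Finset.mul_sum, mul_assoc]

theorem sympForm_smul_right (c : ℂ) (X Y : CN n) : sympForm X (c • Y) = c * sympForm X Y := by
  simp [sympForm, mul_sub, Finset.mul_sum, mul_left_comm]

theorem re_sympForm_smul_left (r : ℝ) (X Y : CN n) :
    (sympForm (r • X) Y).re = r * (sympForm X Y).re := by
  rw [← inner_conjJ, ← inner_conjJ, inner_smul_left]
  rfl

theorem re_sympForm_smul_right (r : ℝ) (X Y : CN n) :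
    (sympForm X (r • Y)).re = r * (sympForm X Y).re := by
  rw [← inner_conjJ, ← inner_conjJ, map_smul, inner_smul_right]

theorem sympForm_neg_left (X Y : CN n) : sympForm (-X) Y = -sympForm X Y := by
  have := sympForm_smul_left (-1) X Y
  rwa [neg_one_smul, neg_one_mul] at this

theorem continuous_re_sympForm : Continuous fun p : CN n × CN n => (sympForm p.1 p.2).re := by
  simp only [← inner_conjJ]
  fun_prop

theorem norm_ksKernel (μ : ℂ) (δ : ℤ) {X Y : CN n} (h : (sympForm X Y).re ≠ 0) :
    ‖ksKernel μ δ X Y‖ = |(sympForm X Y).re| ^ (-(μ + 2 * n).re) := by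
  rw [ksKernel, norm_mul, norm_zpow, norm_bracket (by exact_mod_cast h), one_zpow, mul_one,
    Complex.norm_cpow_eq_rpow_re_of_pos (abs_pos.2 h)]
  congr 1
  simp
  ring

theorem ksKernel_smul_left (μ : ℂ) (δ : ℤ) {r : ℝ} (hr : 0 < r) (X Y : CN n) :
    ksKernel μ δ (r • X) Y = (r : ℂ) ^ (-(μ + 2 * n)) * ksKernel μ δ X Y := by
  have hr' : (r : ℂ) ≠ 0 := by exact_mod_cast hr.ne'
  have hb : bracket (((sympForm (r • X) Y).re : ℝ) : ℂ) = bracket ((sympForm X Y).re : ℂ) := by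
    rw [re_sympForm_smul_left]
    simp only [bracket, Complex.ofReal_mul, norm_mul, Complex.norm_real, Real.norm_eq_abs,
      abs_of_pos hr]
    exact mul_div_mul_left _ _ hr'
  rw [ksKernel, hb, re_sympForm_smul_left, abs_mul, abs_of_pos hr, Complex.ofReal_mul,
    Complex.mul_cpow_ofReal_nonneg hr.le (abs_nonneg _), ksKernel, neg_add, ← sub_eq_add_neg, mul_assoc]

theorem ksKernel_smul_right (μ : ℂ) (δ : ℤ) {r : ℝ} (hr : 0 < r) (X Y : CN n) :
    ksKernel μ δ X (r • Y) = (r : ℂ) ^ (-(μ + 2 * n)) * ksKernel μ δ X Y := by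
  rw [← ksKernel_smul_left μ δ hr, ksKernel, ksKernel, re_sympForm_smul_left,
    re_sympForm_smul_right]

theorem measurable_bracket : Measurable bracket :=
  measurable_id.div (Complex.measurable_ofReal.comp measurable_norm)

theorem measurable_ksKernel (μ : ℂ) (δ : ℤ) :
    Measurable fun p : CN n × CN n => ksKernel μ δ p.1 p.2 := by
  have h := (continuous_re_sympForm (n := n)).measurable
  refine Measurable.mul ?_ ?_
  · exact (Complex.measurable_ofReal.comp (by
      simpa only [Real.norm_eq_abs] using h.norm)).pow_const _
  · exact (measurable_bracket.comp (Complex.measurable_ofReal.comp h)).pow_const _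

end kernel

/-! ### The normalising constant -/

/-- Expressed through Γ_ℝ, the constant C_N loses its powers of π and the functional equations of
Γ_ℝ become applicable. -/
theorem Gammaℝ_ratio (a b : ℂ) : Complex.Gammaℝ a / Complex.Gammaℝ b =
    (Real.pi : ℂ) ^ ((b - a) / 2) * (Complex.Gamma (a / 2) / Complex.Gamma (b / 2)) := by
  have hpi : (Real.pi : ℂ) ≠ 0 := by exact_mod_cast Real.pi_ne_zero
  rw [Complex.Gammaℝ_def, Complex.Gammaℝ_def, mul_div_mul_comm, ← Complex.cpow_sub _ _ hpi]
  congr 2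
  ring

theorem normConst_of_even (n : ℕ) (μ : ℂ) {δ : ℤ} (hδ : Even δ) :
    normConst n μ δ =
      2 * (Complex.Gammaℝ (1 - (μ + 2 * n)) / Complex.Gammaℝ (μ + 2 * n)) := by
  rw [normConst, if_pos hδ, Gammaℝ_ratio, mul_assoc]
  congr 3
  · ring
  · ring_nf

theorem normConst_of_odd (n : ℕ) (μ : ℂ) {δ : ℤ} (hδ : ¬ Even δ) :
    normConst n μ δ =
      2 * Complex.I * (Complex.Gammaℝ (2 - (μ + 2 * n)) / Complex.Gammaℝ (μ + 2 * n + 1)) := by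
  rw [normConst, if_neg hδ, Gammaℝ_ratio, mul_assoc]
  congr 3
  · ring
  · ring_nf
  · ring_nf

/-- This is the shape in which 1/C_N emerges from Γ(s)(2πit)^{-s} after symmetrisation. The
half-plane avoids the exceptional values of the functional equation. -/
theorem inv_normConst_of_even (n : ℕ) {μ : ℂ} (hμ : 0 < (μ + 2 * n).re) {δ : ℤ} (hδ : Even δ) :
    (normConst n μ δ)⁻¹ = (2 * Real.pi : ℂ) ^ (-(μ + 2 * n)) * Complex.Gamma (μ + 2 * n) *
      Complex.cos (Real.pi * (μ + 2 * n) / 2) := by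
  rw [normConst_of_even n μ hδ, mul_inv, inv_div, Complex.Gammaℝ_div_Gammaℝ_one_sub, Complex.Gammaℂ_def]
  · ring
  · intro k hk
    rw [hk] at hμ
    simp at hμ
    have : (0 : ℝ) ≤ k := Nat.cast_nonneg k
    linarith

theorem inv_normConst_of_odd (n : ℕ) {μ : ℂ} (hμ : 0 < (μ + 2 * n).re) {δ : ℤ} (hδ : ¬ Even δ) :
    (normConst n μ δ)⁻¹ = (2 * Real.pi : ℂ) ^ (-(μ + 2 * n)) * Complex.Gamma (μ + 2 * n) *
      (-Complex.I * Complex.sin (Real.pi * (μ + 2 * n) / 2)) := by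
  have h0 : Complex.Gammaℝ (μ + 2 * n + 1) ≠ 0 :=
    Complex.Gammaℝ_ne_zero_of_re_pos (by rw [Complex.add_re, Complex.one_re]; linarith)
  rw [normConst_of_odd n μ hδ, mul_inv, inv_div, div_eq_mul_inv, Complex.inv_Gammaℝ_two_sub,
    Complex.Gammaℂ_def, mul_inv, Complex.inv_I]
  · field_simp
  · intro k hk
    rw [hk] at hμ
    simp at hμ
    have : (0 : ℝ) ≤ k := Nat.cast_nonneg k
    linarith

/-! ### The local functional equation -/

/-- Known for positive real z; both sides are holomorphic in the right half-plane, so the identity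
theorem extends it. -/
theorem integral_cpow_mul_cexp_neg {s z : ℂ} (hs : 0 < s.re) (hz : 0 < z.re) :
    ∫ u in Ioi (0 : ℝ), (u : ℂ) ^ (s - 1) * Complex.exp (-(z * u)) = z ^ (-s) * Complex.Gamma s := by
  have hopen : IsOpen {z : ℂ | z.re ∈ Ioi (0 : ℝ)} := isOpen_Ioi.preimage Complex.continuous_re
  have hconn : IsPreconnected {z : ℂ | z.re ∈ Ioi (0 : ℝ)} :=
    (convex_halfSpace_re_gt 0).isPreconnected
  have hexp : ∀ (u : ℝ) (w : ℂ), ((Real.exp (-u) : ℝ) : ℂ) ^ w = Complex.exp (-(w * u)) := by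
    intro u w
    rw [Complex.cpow_def_of_ne_zero (by exact_mod_cast (Real.exp_pos _).ne'),
      ← Complex.ofReal_log (Real.exp_pos _).le, Real.log_exp]
    congr 1
    push_cast
    ring
  have h1 : DifferentiableOn ℂ (fun z : ℂ =>
      ∫ u in Ioi (0 : ℝ), (u : ℂ) ^ (s - 1) * Complex.exp (-(z * u))) {z | z.re ∈ Ioi (0 : ℝ)} := by
    -- With k = e^{-u} the exponential e^{-zu} is the power k^z.
    have := differentiableOn_integral_cpow (ν := volume.restrict (Ioi (0 : ℝ)))
      (f := fun u : ℝ => (u : ℂ) ^ (s - 1)) (k := fun u => Real.exp (-u)) (s := Ioi 0) isOpen_Ioi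
      (Complex.measurable_ofReal.pow_const _).aestronglyMeasurable
      (by fun_prop) (ae_of_all _ fun u => Real.exp_pos _) (fun σ (hσ : 0 < σ) => by
        have h2 := (integrableOn_rpow_mul_exp_neg_mul_rpow (p := 1) (s := s.re - 1) (b := σ)
          (by linarith) one_pos hσ)
        refine h2.congr_fun (fun u (hu : 0 < u) => ?_) measurableSet_Ioi
        simp only
        rw [Complex.norm_cpow_eq_rpow_re_of_pos hu, ← Real.exp_mul, Real.rpow_one, Complex.sub_re,
          Complex.one_re]
        ring_nf)
    simpa only [hexp] using this
  have h2 : DifferentiableOn ℂ (fun z : ℂ => z ^ (-s) * Complex.Gamma s)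
      {z | z.re ∈ Ioi (0 : ℝ)} := by
    intro z hz
    have hz' : z ∈ Complex.slitPlane := Or.inl hz
    exact ((differentiableAt_id.cpow_const hz').mul_const _).differentiableWithinAt
  refine (h1.analyticOnNhd hopen).eqOn_of_preconnected_of_frequently_eq (h2.analyticOnNhd hopen)
    hconn (z₀ := 1) (by simp) ?_ hz
  have hreal : ∀ r : ℝ, 0 < r →
      ∫ u in Ioi (0 : ℝ), (u : ℂ) ^ (s - 1) * Complex.exp (-((r : ℂ) * u)) =
        (r : ℂ) ^ (-s) * Complex.Gamma s := by
    intro r hr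
    rw [Complex.integral_cpow_mul_exp_neg_mul_Ioi hs hr, one_div, Complex.cpow_neg,
      Complex.inv_cpow _ _ (by
        rw [Complex.arg_ofReal_of_nonneg hr.le]
        exact Real.pi_pos.ne)]
  -- The real points accumulate at 1, which suffices for the identity theorem.
  have htend : Tendsto (fun r : ℝ => (r : ℂ)) (𝓝[≠] 1) (𝓝[≠] 1) := by
    refine tendsto_nhdsWithin_of_tendsto_nhds_of_eventually_within _ ?_ ?_
    · have := Complex.continuous_ofReal.tendsto 1
      rw [Complex.ofReal_one] at this
      exact this.mono_left nhdsWithin_le_nhds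
    · filter_upwards [self_mem_nhdsWithin] with r hr
      have hr' : r ≠ 1 := hr
      exact fun h => hr' (by simpa using h)
  refine htend.frequently (Eventually.frequently ?_)
  filter_upwards [mem_nhdsWithin_of_mem_nhds (Ioi_mem_nhds (zero_lt_one' ℝ))] with r hr
  exact hreal r hr

/-- Only the imaginary part enters the bound. Applied to z = ε + 2πi Re ω(x, Y) it is therefore
uniform in ε. -/
theorem norm_cpow_neg_le {z s : ℂ} (hz : z.im ≠ 0) (hs : 0 ≤ s.re) :
    ‖z ^ (-s)‖ ≤ |z.im| ^ (-s.re) * Real.exp (Real.pi * |s.im|) := by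
  refine (Complex.norm_cpow_le z (-s)).trans ?_
  rw [div_eq_mul_inv, ← Real.exp_neg, Complex.neg_re, Complex.neg_im]
  have h0 : 0 < |z.im| := abs_pos.2 hz
  refine mul_le_mul ?_ ?_ (Real.exp_pos _).le (by positivity)
  · exact Real.rpow_le_rpow_of_nonpos h0 (Complex.abs_im_le_norm z) (by linarith)
  · rw [Real.exp_le_exp, mul_neg, neg_neg]
    refine (le_abs_self _).trans ?_
    rw [abs_mul]
    exact mul_le_mul_of_nonneg_right (Complex.abs_arg_le_pi z) (abs_nonneg _)

theorem cpow_mul_I {r : ℝ} (hr : 0 < r) (s : ℂ) :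
    ((r : ℂ) * Complex.I) ^ (-s) = (r : ℂ) ^ (-s) * Complex.exp (-(Real.pi * s / 2 * Complex.I)) ∧
    (-((r : ℂ) * Complex.I)) ^ (-s) = (r : ℂ) ^ (-s) * Complex.exp (Real.pi * s / 2 * Complex.I) := by
  have hr' : (r : ℂ) ≠ 0 := by exact_mod_cast hr.ne'
  constructor
  · rw [Complex.cpow_def_of_ne_zero (mul_ne_zero hr' Complex.I_ne_zero),
      Complex.log_ofReal_mul hr Complex.I_ne_zero, Complex.cpow_def_of_ne_zero hr', Complex.log_I,
      ← Complex.exp_add, Complex.ofReal_log hr.le]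
    ring_nf
  · rw [← mul_neg, Complex.cpow_def_of_ne_zero (mul_ne_zero hr' (neg_ne_zero.2 Complex.I_ne_zero)),
      Complex.log_ofReal_mul hr (neg_ne_zero.2 Complex.I_ne_zero), Complex.cpow_def_of_ne_zero hr',
      Complex.log_neg_I, ← Complex.exp_add, Complex.ofReal_log hr.le]
    ring_nf

section functionalEquation

variable {n : ℕ}

theorem sympFourier_ray (G : 𝓢(CN n, ℂ)) (Y : CN n) (u : ℝ) :
    sympFourier n G (u • Y) =
      ∫ x, G x * Complex.exp (-(2 * Real.pi * (sympForm x Y).re * Complex.I * u)) := by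
  rw [sympFourier_apply]
  refine integral_congr_ae (ae_of_all _ fun x => ?_)
  simp only [re_sympForm_smul_right]
  congr 2
  push_cast
  ring

/-- The factor e^{-εu} makes the double integral over u and x absolutely convergent, so that Fubini
applies and the u-integral becomes a Gamma integral. -/
theorem integral_regularised_ray (G : 𝓢(CN n, ℂ)) (Y : CN n) {s : ℂ} (hs : 0 < s.re) {ε : ℝ}
    (hε : 0 < ε) :
    ∫ u in Ioi (0 : ℝ), Complex.exp (-(ε * u)) * ((u : ℂ) ^ (s - 1) * sympFourier n G (u • Y)) =
      Complex.Gamma s *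
        ∫ x, G x * (ε + 2 * Real.pi * (sympForm x Y).re * Complex.I : ℂ) ^ (-s) := by
  have hform : Continuous fun x : CN n => (sympForm x Y).re := by
    simp only [← inner_conjJ]
    fun_prop
  have hm1 : Integrable (fun u : ℝ => Complex.exp (-(ε * u)) * (u : ℂ) ^ (s - 1))
      (volume.restrict (Ioi 0)) := by
    have h2 := (integrableOn_rpow_mul_exp_neg_mul_rpow (p := 1) (s := s.re - 1) (b := ε)
      (by linarith) one_pos hε)
    refine Integrable.mono' h2 (Measurable.aestronglyMeasurable ?_) ?_
    · exact (by fun_prop : Measurable fun u : ℝ => Complex.exp (-(ε * u))).mul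
        (Complex.measurable_ofReal.pow_const _)
    · filter_upwards [ae_restrict_mem measurableSet_Ioi] with u hu
      have hu' : 0 < u := hu
      rw [norm_mul, Complex.norm_cpow_eq_rpow_re_of_pos hu', Complex.norm_exp, Real.rpow_one,
        mul_comm]
      simp
  have hint : Integrable (fun p : ℝ × CN n => (Complex.exp (-(ε * p.1)) * (p.1 : ℂ) ^ (s - 1)) *
      G p.2 * Complex.exp (-(2 * Real.pi * (sympForm p.2 Y).re * Complex.I * p.1)))
      ((volume.restrict (Ioi 0)).prod volume) := by
    refine (hm1.mul_prod G.integrable).mul_bdd (c := 1) ?_ (ae_of_all _ fun p => ?_)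
    · refine Continuous.aestronglyMeasurable ?_
      have : Continuous fun p : ℝ × CN n => (sympForm p.2 Y).re := hform.comp continuous_snd
      fun_prop
    · rw [Complex.norm_exp]
      simp
  calc _ = ∫ u in Ioi (0 : ℝ), ∫ x, (Complex.exp (-(ε * u)) * (u : ℂ) ^ (s - 1)) *
      G x * Complex.exp (-(2 * Real.pi * (sympForm x Y).re * Complex.I * u)) := by
        refine integral_congr_ae (ae_of_all _ fun u => ?_)
        simp only [sympFourier_ray]
        rw [← integral_const_mul, ← integral_const_mul]
        refine integral_congr_ae (ae_of_all _ fun x => ?_)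
        simp only
        ring
    _ = ∫ x, ∫ u in Ioi (0 : ℝ), (Complex.exp (-(ε * u)) * (u : ℂ) ^ (s - 1)) *
      G x * Complex.exp (-(2 * Real.pi * (sympForm x Y).re * Complex.I * u)) :=
        integral_integral_swap hint
    _ = _ := by
        rw [← integral_const_mul]
        refine integral_congr_ae (ae_of_all _ fun x => ?_)
        simp only
        have hz : 0 < (ε + 2 * Real.pi * (sympForm x Y).re * Complex.I : ℂ).re := by simpa using hε
        rw [mul_left_comm, mul_comm (Complex.Gamma s), ← integral_cpow_mul_cexp_neg hs hz,
          ← integral_const_mul]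
        refine integral_congr_ae (ae_of_all _ fun u => ?_)
        simp only
        rw [add_mul, neg_add, Complex.exp_add]
        ring

/-- The limit ε → 0 of the regularised identity. Dominated convergence rests on the Schwartz decay
of the transform on one side and on `hG`, which tames the zeros of the linear form, on the other. -/
theorem rayMellin_sympFourier (G : 𝓢(CN n, ℂ)) {Y : CN n} (hY : Y ≠ 0) {s : ℂ} (hs : 0 < s.re)
    (hG : Integrable fun x : CN n => ‖G x‖ * |(sympForm x Y).re| ^ (-s.re)) :
    rayMellin s (sympFourier n G) Y = Complex.Gamma s *
      ∫ x, G x * (2 * Real.pi * (sympForm x Y).re * Complex.I : ℂ) ^ (-s) := by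
  have hform : Continuous fun x : CN n => (sympForm x Y).re := by
    simp only [← inner_conjJ]
    fun_prop
  have hpi : (0 : ℝ) < 2 * Real.pi := by positivity
  have h1 : Tendsto (fun ε : ℝ => ∫ u in Ioi (0 : ℝ),
      Complex.exp (-(ε * u)) * ((u : ℂ) ^ (s - 1) * sympFourier n G (u • Y))) (𝓝[>] 0)
      (𝓝 (rayMellin s (sympFourier n G) Y)) := by
    rw [rayMellin_eq]
    refine tendsto_integral_filter_of_dominated_convergence
      (fun u => ‖(u : ℂ) ^ (s - 1) * sympFourier n G (u • Y)‖) ?_ ?_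
      (integrableOn_ray _ hs hY).norm ?_
    · refine Eventually.of_forall fun ε => ?_
      exact (Continuous.aestronglyMeasurable (by fun_prop)).mul (measurable_ray _ _ _)
    · filter_upwards [self_mem_nhdsWithin] with ε hε
      filter_upwards [ae_restrict_mem measurableSet_Ioi] with u hu
      have hε' : 0 < ε := hε
      have hu' : 0 < u := hu
      rw [norm_mul]
      refine mul_le_of_le_one_left (norm_nonneg _) ?_
      rw [Complex.norm_exp, Real.exp_le_one_iff]
      simp
      positivity
    · refine ae_of_all _ fun u => ?_
      have : Continuous fun ε : ℝ =>
          Complex.exp (-(ε * u)) * ((u : ℂ) ^ (s - 1) * sympFourier n G (u • Y)) := by fun_prop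
      have h := (this.tendsto 0).mono_left (nhdsWithin_le_nhds (s := Ioi (0 : ℝ)))
      simpa using h
  have h2 : Tendsto (fun ε : ℝ =>
      ∫ x, G x * (ε + 2 * Real.pi * (sympForm x Y).re * Complex.I : ℂ) ^ (-s)) (𝓝[>] 0)
      (𝓝 (∫ x, G x * (2 * Real.pi * (sympForm x Y).re * Complex.I : ℂ) ^ (-s))) := by
    refine tendsto_integral_filter_of_dominated_convergence
      (fun x => ((2 * Real.pi) ^ (-s.re) * Real.exp (Real.pi * |s.im|)) *
        (‖G x‖ * |(sympForm x Y).re| ^ (-s.re))) ?_ ?_ (hG.const_mul _) ?_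
    · refine Eventually.of_forall fun ε => Measurable.aestronglyMeasurable ?_
      refine G.continuous.measurable.mul (Measurable.pow_const ?_ _)
      exact Continuous.measurable (by fun_prop)
    · refine Eventually.of_forall fun ε => ?_
      filter_upwards [ae_form_ne_zero hY] with x hx
      have him : (ε + 2 * Real.pi * (sympForm x Y).re * Complex.I : ℂ).im =
          2 * Real.pi * (sympForm x Y).re := by simp
      have hle := norm_cpow_neg_le (z := (ε + 2 * Real.pi * (sympForm x Y).re * Complex.I : ℂ))
        (by rw [him]; positivity) hs.le
      rw [him, abs_mul, abs_of_pos hpi, Real.mul_rpow hpi.le (abs_nonneg _)] at hle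
      rw [norm_mul]
      refine (mul_le_mul_of_nonneg_left hle (norm_nonneg _)).trans (le_of_eq ?_)
      ring
    · filter_upwards [ae_form_ne_zero hY] with x hx
      refine Tendsto.const_mul _ ?_
      have hc : ContinuousAt (fun ε : ℝ =>
          (ε + 2 * Real.pi * (sympForm x Y).re * Complex.I : ℂ) ^ (-s)) 0 := by
        -- The imaginary part 2π Re ω(x, Y) is nonzero, so the base stays off the branch cut as ε →
        -- 0.
        refine ContinuousAt.cpow (by fun_prop) continuousAt_const (Or.inr ?_)
        simp [Real.pi_ne_zero, hx]
      have h := hc.tendsto.mono_left (nhdsWithin_le_nhds (s := Ioi (0 : ℝ)))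
      simpa using h
  refine tendsto_nhds_unique h1 ((h2.const_mul (Complex.Gamma s)).congr' ?_)
  filter_upwards [self_mem_nhdsWithin] with ε hε
  exact (integral_regularised_ray G Y hs hε).symm

/-- For t = Re ω(x, Y) the powers (±2πit)^{-s} carry the phases e^{∓iπs/2} or their inverses
according to the sign of t. The combination with sign (-1)^δ is 2 cos(πs/2) for even δ and a
multiple of sin(πs/2) that changes sign with t for odd δ: the kernel of parity δ, with constant
2/C_N. -/
theorem cpow_form_add (μ : ℂ) (δ : ℤ) (hμ : 0 < (μ + 2 * n).re) {x Y : CN n}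
    (hx : (sympForm x Y).re ≠ 0) :
    Complex.Gamma (μ + 2 * n) *
      ((2 * Real.pi * (sympForm x Y).re * Complex.I : ℂ) ^ (-(μ + 2 * n)) +
        (-1) ^ δ * (2 * Real.pi * (sympForm (-x) Y).re * Complex.I : ℂ) ^ (-(μ + 2 * n))) =
      2 * ((normConst n μ δ)⁻¹ * ksKernel μ δ x Y) := by
  set s := μ + 2 * n with hs
  set t := (sympForm x Y).re with ht
  have hpi : (0 : ℝ) < 2 * Real.pi := by positivity
  have habs : 0 < 2 * Real.pi * |t| := mul_pos hpi (abs_pos.2 hx)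
  obtain ⟨e1, e2⟩ := cpow_mul_I habs s
  have hprod : ((2 * Real.pi * |t| : ℝ) : ℂ) ^ (-s) =
      (2 * Real.pi : ℂ) ^ (-s) * ((|t| : ℝ) : ℂ) ^ (-s) := by
    rw [Complex.ofReal_mul, Complex.mul_cpow_ofReal_nonneg hpi.le (abs_nonneg _)]
    push_cast
    rfl
  have hcos : Complex.exp (-(Real.pi * s / 2 * Complex.I)) +
      Complex.exp (Real.pi * s / 2 * Complex.I) = 2 * Complex.cos (Real.pi * s / 2) := by
    rw [Complex.cos, add_comm, neg_mul]
    ring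
  have hsin : Complex.exp (-(Real.pi * s / 2 * Complex.I)) -
      Complex.exp (Real.pi * s / 2 * Complex.I) =
        -(2 * Complex.I * Complex.sin (Real.pi * s / 2)) := by
    rw [Complex.sin, neg_mul]
    linear_combination (Complex.exp (-(Real.pi * s / 2 * Complex.I)) -
      Complex.exp (Real.pi * s / 2 * Complex.I)) * Complex.I_sq
  have hneg : ((sympForm (-x) Y).re : ℂ) = -(t : ℂ) := by
    rw [sympForm_neg_left, Complex.neg_re, Complex.ofReal_neg]
  have hexp : -μ - 2 * (n : ℂ) = -s := by
    rw [hs]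
    ring
  rw [hneg, ksKernel, hexp, ← ht]
  rcases lt_or_gt_of_ne hx with hlt | hgt
  · have a1 : (2 * Real.pi * t * Complex.I : ℂ) = -(((2 * Real.pi * |t| : ℝ) : ℂ) * Complex.I) := by
      rw [abs_of_neg hlt]
      push_cast
      ring
    have a2 : (2 * Real.pi * -t * Complex.I : ℂ) = ((2 * Real.pi * |t| : ℝ) : ℂ) * Complex.I := by
      rw [abs_of_neg hlt]
      push_cast
      ring
    rw [a1, a2, e1, e2, hprod, bracket_ofReal_of_neg hlt]
    by_cases hδ : Even δ
    · rw [inv_normConst_of_even n hμ hδ, hδ.neg_one_zpow, hδ.neg.neg_one_zpow]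
      linear_combination (Complex.Gamma s * ((2 * Real.pi : ℂ) ^ (-s) * ((|t| : ℝ) : ℂ) ^ (-s))) *
        hcos
    · have hδ' := Int.not_even_iff_odd.1 hδ
      rw [inv_normConst_of_odd n hμ hδ, hδ'.neg_one_zpow, hδ'.neg.neg_one_zpow]
      linear_combination -(Complex.Gamma s * ((2 * Real.pi : ℂ) ^ (-s) * ((|t| : ℝ) : ℂ) ^ (-s))) *
        hsin
  · have a1 : (2 * Real.pi * t * Complex.I : ℂ) = ((2 * Real.pi * |t| : ℝ) : ℂ) * Complex.I := by
      rw [abs_of_pos hgt]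
      push_cast
      ring
    have a2 : (2 * Real.pi * -t * Complex.I : ℂ) = -(((2 * Real.pi * |t| : ℝ) : ℂ) * Complex.I) := by
      rw [abs_of_pos hgt]
      push_cast
      ring
    rw [a1, a2, e1, e2, hprod, bracket_ofReal_of_pos hgt, one_zpow]
    by_cases hδ : Even δ
    · rw [inv_normConst_of_even n hμ hδ, hδ.neg_one_zpow]
      linear_combination (Complex.Gamma s * ((2 * Real.pi : ℂ) ^ (-s) * ((|t| : ℝ) : ℂ) ^ (-s))) *
        hcos
    · have hδ' := Int.not_even_iff_odd.1 hδ
      rw [inv_normConst_of_odd n hμ hδ, hδ'.neg_one_zpow]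
      linear_combination (Complex.Gamma s * ((2 * Real.pi : ℂ) ^ (-s) * ((|t| : ℝ) : ℂ) ^ (-s))) *
        hsin

theorem rayMellin_sympFourier_eq_kernel (G : 𝓢(CN n, ℂ)) {δ : ℤ} (hpar : ∀ x, G (-x) = (-1) ^ δ * G x)
    {Y : CN n} (hY : Y ≠ 0) {μ : ℂ} (hs : 0 < (μ + 2 * n).re)
    (hG : Integrable fun x : CN n => ‖G x‖ * |(sympForm x Y).re| ^ (-(μ + 2 * n).re)) :
    rayMellin (μ + 2 * n) (sympFourier n G) Y =
      (normConst n μ δ)⁻¹ * ∫ x, G x * ksKernel μ δ x Y := by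
  rw [rayMellin_sympFourier G hY hs hG]
  set κ : CN n → ℂ := fun x =>
    G x * (2 * Real.pi * (sympForm x Y).re * Complex.I : ℂ) ^ (-(μ + 2 * n)) with hκ
  have hpi : (0 : ℝ) < 2 * Real.pi := by positivity
  have hform : Continuous fun x : CN n => (sympForm x Y).re := by
    simp only [← inner_conjJ]
    fun_prop
  have hκi : Integrable κ := by
    refine Integrable.mono' (hG.const_mul
      ((2 * Real.pi) ^ (-(μ + 2 * n).re) * Real.exp (Real.pi * |(μ + 2 * n).im|))) ?_ ?_
    · refine (G.continuous.measurable.mul (Measurable.pow_const ?_ _)).aestronglyMeasurable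
      exact Continuous.measurable (by fun_prop)
    · filter_upwards [ae_form_ne_zero hY] with x hx
      have him : (2 * Real.pi * (sympForm x Y).re * Complex.I : ℂ).im =
          2 * Real.pi * (sympForm x Y).re := by simp
      have hle := norm_cpow_neg_le (z := (2 * Real.pi * (sympForm x Y).re * Complex.I : ℂ))
        (by rw [him]; positivity) hs.le
      rw [him, abs_mul, abs_of_pos hpi, Real.mul_rpow hpi.le (abs_nonneg _)] at hle
      rw [hκ, norm_mul]
      refine (mul_le_mul_of_nonneg_left hle (norm_nonneg _)).trans (le_of_eq ?_)
      ring
  -- Doubling the integral and reflecting one copy sets up the symmetrisation of `cpow_form_add`.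
  have h2 : (2 : ℂ) * ∫ x, κ x = ∫ x, (κ x + κ (-x)) := by
    rw [integral_add hκi hκi.comp_neg, integral_neg_eq_self κ, two_mul]
  have h3 : Complex.Gamma (μ + 2 * n) * ∫ x, (κ x + κ (-x)) =
      2 * ((normConst n μ δ)⁻¹ * ∫ x, G x * ksKernel μ δ x Y) := by
    rw [← integral_const_mul, ← integral_const_mul, ← integral_const_mul]
    refine integral_congr_ae ?_
    filter_upwards [ae_form_ne_zero hY] with x hx
    have := cpow_form_add μ δ hs hx
    rw [hκ]
    simp only [hpar]
    linear_combination (G x) * this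
  have h4 : (2 : ℂ) ≠ 0 := two_ne_zero
  apply mul_left_cancel₀ h4
  rw [← h3, ← h2]
  ring

end functionalEquation

/-! ### The Knapp–Stein integral -/

section ksIntegral

variable {n : ℕ}

theorem integrable_mul_form_rpow [Nontrivial (CN n)] {h : Sph n → ℂ} (hh : Continuous h) {a : ℝ}
    (ha : -1 < a) {Y : CN n} (hY : Y ≠ 0) :
    Integrable (fun X : Sph n => ‖h X‖ * |(sympForm (X : CN n) Y).re| ^ a) (sphMeas n) := by
  obtain ⟨C, hC⟩ := (isCompact_range hh).isBounded.exists_norm_le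
  refine (integrable_sphere_form_rpow ha hY).bdd_mul (c := C) hh.norm.aestronglyMeasurable
    (ae_of_all _ fun X => ?_)
  rw [norm_norm]
  exact hC _ ⟨X, rfl⟩

theorem measurable_ksKernel_left (μ : ℂ) (δ : ℤ) (Y : CN n) :
    Measurable fun x : CN n => ksKernel μ δ x Y :=
  Measurable.comp (g := fun p : CN n × CN n => ksKernel μ δ p.1 p.2) (f := fun x => (x, Y))
    (measurable_ksKernel μ δ) (by fun_prop)

theorem measurable_ksKernel_sphere (μ : ℂ) (δ : ℤ) (Y : CN n) :
    Measurable fun X : Sph n => ksKernel μ δ (X : CN n) Y :=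
  Measurable.comp (g := fun x : CN n => ksKernel μ δ x Y) (f := fun X : Sph n => (X : CN n))
    (measurable_ksKernel_left μ δ Y) measurable_subtype_coe

theorem mem_ksDomain_iff {μ : ℂ} : μ ∈ ksDomain n ↔ (μ + 2 * n).re < 1 := by
  simp [ksDomain, lt_sub_iff_add_lt]

theorem isOpen_ksDomain (n : ℕ) : IsOpen (ksDomain n) :=
  isOpen_lt Complex.continuous_re continuous_const

theorem integrable_ksKernel [Nontrivial (CN n)] {h : Sph n → ℂ} (hh : Continuous h) {μ : ℂ}
    (hμ : μ ∈ ksDomain n) (δ : ℤ) {Y : CN n} (hY : Y ≠ 0) :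
    Integrable (fun X : Sph n => h X * ksKernel μ δ X Y) (sphMeas n) := by
  rw [mem_ksDomain_iff] at hμ
  refine Integrable.mono' (integrable_mul_form_rpow hh (a := -(μ + 2 * n).re) (by linarith) hY)
    (hh.measurable.mul (measurable_ksKernel_sphere μ δ Y)).aestronglyMeasurable ?_
  filter_upwards [ae_sphere_form_ne_zero hY] with X hX
  rw [norm_mul, norm_ksKernel _ _ hX]

theorem ksIntegral_smul (μ : ℂ) (δ : ℤ) (h : Sph n → ℂ) {r : ℝ} (hr : 0 < r) (Y : CN n) :
    ksIntegral μ δ h (r • Y) = (r : ℂ) ^ (-(μ + 2 * n)) * ksIntegral μ δ h Y := by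
  rw [ksIntegral, ksIntegral, ← integral_const_mul]
  refine integral_congr_ae (ae_of_all _ fun X => ?_)
  simp only [ksKernel_smul_right μ δ hr]
  ring

theorem differentiableOn_ksIntegral [Nontrivial (CN n)] {h : Sph n → ℂ} (hh : Continuous h)
    (δ : ℤ) {Y : CN n} (hY : Y ≠ 0) :
    DifferentiableOn ℂ (fun μ => ksIntegral μ δ h Y) (ksDomain n) := by
  have hform : Continuous fun X : Sph n => (sympForm (X : CN n) Y).re :=
    continuous_re_sympForm.comp (continuous_subtype_val.prodMk continuous_const)
  have h1 := differentiableOn_integral_cpow (ν := sphMeas n)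
    (f := fun X : Sph n => h X * bracket ((sympForm (X : CN n) Y).re : ℂ) ^ (-δ))
    (k := fun X : Sph n => |(sympForm (X : CN n) Y).re|) (s := Ioi (-1)) isOpen_Ioi
    (hh.measurable.mul ((measurable_bracket.comp (Complex.measurable_ofReal.comp
      hform.measurable)).pow_const _)).aestronglyMeasurable
    hform.abs.measurable.aemeasurable
    ((ae_sphere_form_ne_zero hY).mono fun X hX => abs_pos.2 hX)
    (fun σ hσ => by
      refine (integrable_mul_form_rpow hh hσ hY).congr ?_
      filter_upwards [ae_sphere_form_ne_zero hY] with X hX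
      rw [norm_mul, norm_zpow, norm_bracket (by exact_mod_cast hX), one_zpow, mul_one])
  have h2 : DifferentiableOn ℂ (fun μ : ℂ => -μ - 2 * (n : ℂ)) (ksDomain n) := by fun_prop
  refine (h1.comp h2 fun μ hμ => ?_).congr fun μ _ => ?_
  · rw [mem_ksDomain_iff] at hμ
    simp at hμ ⊢
    linarith
  · simp only [ksIntegral, ksKernel, Function.comp]
    refine integral_congr_ae (ae_of_all _ fun X => ?_)
    simp only
    ring

/-- The degrees μ₀ - N and -(μ + N), together with 2N from the polar Jacobian, leave μ₀ - μ as
Mellin variable. A cut-off exponent μ₀ independent of μ allows μ to vary while the Schwartz function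
is fixed. -/
theorem integral_annular_mul_ksKernel [Nontrivial (CN n)] {h : Sph n → ℂ}
    (hh : ContDiffOn ℝ ∞ (homExt 0 h) {0}ᶜ) (μ₀ μ : ℂ) (δ : ℤ) (Y : CN n) :
    ∫ x, annular (μ₀ - 2 * n) h x * ksKernel μ δ x Y =
      ksIntegral μ δ h Y * bumpMellin (μ₀ - μ) := by
  have hm := measurable_ksKernel_left μ δ Y
  have h1 := integral_annular_mul (lam := μ₀ - 2 * n) (ν := -(μ + 2 * n)) hh
    (Q := fun x => ksKernel μ δ x Y) hm.aestronglyMeasurable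
    (fun r hr X => by rw [ksKernel_smul_left μ δ hr (X : CN n) Y])
  have h2 : 4 * (n : ℂ) + (μ₀ - 2 * n) + -(μ + 2 * n) = μ₀ - μ := by ring
  rw [h2] at h1
  exact h1

theorem integrable_mul_of_hasCompactSupport [Nontrivial (CN n)] {G : CN n → ℂ} (hG : Continuous G)
    (hGs : HasCompactSupport G) {a : ℝ} (ha : -1 < a) {Y : CN n} (hY : Y ≠ 0) :
    Integrable fun x : CN n => ‖G x‖ * |(sympForm x Y).re| ^ a := by
  have hc : Continuous fun x : CN n => ‖G x‖ * Real.exp (‖x‖ ^ 2) := by fun_prop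
  obtain ⟨C, hC⟩ := hc.bounded_above_of_compact_support
    (f := fun x : CN n => ‖G x‖ * Real.exp (‖x‖ ^ 2)) (hGs.norm.mul_right)
  refine ((integrable_abs_form_rpow_mul_exp ha hY).bdd_mul (c := C) hc.aestronglyMeasurable
    (ae_of_all _ hC)).congr (ae_of_all _ fun x => ?_)
  have : Real.exp (‖x‖ ^ 2) * Real.exp (-‖x‖ ^ 2) = 1 := by
    rw [← Real.exp_add, add_neg_cancel, Real.exp_zero]
  simp only
  linear_combination (‖G x‖ * |(sympForm x Y).re| ^ a) * this

/-- The functional equation that links the two constructions of the normalised operator. -/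
theorem rayMellin_annular_of_strip [Nontrivial (CN n)] {δ : ℤ} {h : Sph n → ℂ}
    (hh : h ∈ SmoothSphere n (-δ)) (μ₀ : ℂ) {μ : ℂ} (h0 : 0 < (μ + 2 * n).re)
    (h1 : μ ∈ ksDomain n) {Y : CN n} (hY : Y ≠ 0) :
    rayMellin (μ + 2 * n) (sympFourier n (annularSchwartz (μ₀ - 2 * n) hh.1)) Y =
      (normConst n μ δ)⁻¹ * ksIntegral μ δ h Y * bumpMellin (μ₀ - μ) := by
  rw [mem_ksDomain_iff] at h1
  rw [rayMellin_sympFourier_eq_kernel (δ := δ) _ ?_ hY h0, mul_assoc,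
    ← integral_annular_mul_ksKernel hh.1]
  · rfl
  · exact integrable_mul_of_hasCompactSupport (contDiff_annular _ hh.1).continuous
      (hasCompactSupport_annular _ _) (by linarith) hY
  · intro x
    simp only [annularSchwartz_apply, annular, norm_neg, homExt_neg hh, neg_neg]
    ring

/-- On the strip both sides equal C_N⁻¹ times the Knapp–Stein integral times both bump factors, and
the identity theorem extends this to Re μ > -N. Hence the quotient by `bumpMellin (μ₀ - μ)` does not
depend on the cut-off exponent. -/
theorem rayMellin_annular_consistent [Nontrivial (CN n)] {δ : ℤ} {h : Sph n → ℂ}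
    (hh : h ∈ SmoothSphere n (-δ)) (μ₀ μ₁ : ℂ) {μ : ℂ} (h0 : 0 < (μ + 2 * n).re) {Y : CN n}
    (hY : Y ≠ 0) :
    rayMellin (μ + 2 * n) (sympFourier n (annularSchwartz (μ₀ - 2 * n) hh.1)) Y *
        bumpMellin (μ₁ - μ) =
      rayMellin (μ + 2 * n) (sympFourier n (annularSchwartz (μ₁ - 2 * n) hh.1)) Y *
        bumpMellin (μ₀ - μ) := by
  have hset : {μ : ℂ | 0 < (μ + 2 * n).re} = {μ : ℂ | -(2 * n : ℝ) < μ.re} := by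
    ext z
    simp [neg_lt_iff_pos_add]
  have hopen : IsOpen {μ : ℂ | 0 < (μ + 2 * n).re} := by
    rw [hset]
    exact isOpen_lt continuous_const Complex.continuous_re
  have hconn : IsPreconnected {μ : ℂ | 0 < (μ + 2 * n).re} := by
    rw [hset]
    exact (convex_halfSpace_re_gt _).isPreconnected
  have hd : ∀ μ₀ μ₁ : ℂ, DifferentiableOn ℂ (fun μ : ℂ =>
      rayMellin (μ + 2 * n) (sympFourier n (annularSchwartz (μ₀ - 2 * n) hh.1)) Y *
        bumpMellin (μ₁ - μ)) {μ : ℂ | 0 < (μ + 2 * n).re} := by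
    intro μ₀ μ₁ μ hμ
    refine DifferentiableAt.differentiableWithinAt (DifferentiableAt.mul ?_ ?_)
    · exact (differentiableAt_rayMellin (sympFourier n (annularSchwartz (μ₀ - 2 * n) hh.1)) hμ
        hY).comp μ (by fun_prop : DifferentiableAt ℂ (fun μ : ℂ => μ + 2 * n) μ)
    · exact (differentiable_bumpMellin _).comp μ
        (by fun_prop : DifferentiableAt ℂ (fun μ : ℂ => μ₁ - μ) μ)
  -- The base point μ = 1/2 - N is the real midpoint of the strip, where μ + N = 1/2.
  have hz : ((1 / 2 : ℝ) : ℂ) - 2 * n + 2 * n = ((1 / 2 : ℝ) : ℂ) := by ring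
  refine ((hd μ₀ μ₁).analyticOnNhd hopen).eqOn_of_preconnected_of_eventuallyEq
    ((hd μ₁ μ₀).analyticOnNhd hopen) hconn (z₀ := ((1 / 2 : ℝ) : ℂ) - 2 * n) (by
      show 0 < (((1 / 2 : ℝ) : ℂ) - 2 * n + 2 * n).re
      rw [hz, Complex.ofReal_re]
      norm_num) ?_ h0
  have hmem : {μ : ℂ | 0 < (μ + 2 * n).re} ∩ ksDomain n ∈ 𝓝 (((1 / 2 : ℝ) : ℂ) - 2 * n) := by
    refine (hopen.inter (isOpen_ksDomain n)).mem_nhds ⟨?_, ?_⟩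
    · show 0 < (((1 / 2 : ℝ) : ℂ) - 2 * n + 2 * n).re
      rw [hz, Complex.ofReal_re]
      norm_num
    · rw [mem_ksDomain_iff, hz, Complex.ofReal_re]
      norm_num
  filter_upwards [hmem] with z hz
  rw [rayMellin_annular_of_strip hh μ₀ hz.1 hz.2 hY, rayMellin_annular_of_strip hh μ₁ hz.1 hz.2 hY]
  ring

end ksIntegral

/-! ### Smoothness of the Knapp–Stein integral -/

section smoothness

variable {n : ℕ}

theorem locallyIntegrable_ksKernel [Nontrivial (CN n)] {μ : ℂ} (hμ : μ ∈ ksDomain n) (δ : ℤ)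
    {Y : CN n} (hY : Y ≠ 0) : LocallyIntegrable fun x : CN n => ksKernel μ δ x Y := by
  rw [mem_ksDomain_iff] at hμ
  have hm := measurable_ksKernel_left μ δ Y
  have h1 : LocallyIntegrable fun x : CN n =>
      |(sympForm x Y).re| ^ (-(μ + 2 * n).re) * Real.exp (-‖x‖ ^ 2) :=
    (integrable_abs_form_rpow_mul_exp (by linarith) hY).locallyIntegrable
  rw [← locallyIntegrableOn_univ] at h1 ⊢
  have h2 := h1.mul_continuousOn (g := fun x : CN n => Real.exp (‖x‖ ^ 2))
    (Continuous.continuousOn (by fun_prop)) isOpen_univ.isLocallyClosed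
  refine h2.mono hm.aestronglyMeasurable ?_
  filter_upwards [ae_form_ne_zero hY] with x hx
  have : Real.exp (-‖x‖ ^ 2) * Real.exp (‖x‖ ^ 2) = 1 := by
    rw [← Real.exp_add, neg_add_cancel, Real.exp_zero]
  rw [norm_ksKernel _ _ hx, mul_assoc, this, mul_one, Real.norm_of_nonneg (by positivity)]

/-- A shear with determinant `1` that carries the linear form `⟪·, y⟫` to a multiple of
`⟪·, y₀⟫`. -/
def shear (y₀ y x : CN n) : CN n :=
  x - (inner ℝ x (y - (inner ℝ y y₀ / ‖y₀‖ ^ 2) • y₀) / inner ℝ y y₀) • y₀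

theorem inner_shear {y₀ y : CN n} (hy : inner ℝ y y₀ ≠ 0) (x : CN n) :
    inner ℝ (shear y₀ y x) y = inner ℝ y y₀ / ‖y₀‖ ^ 2 * inner ℝ x y₀ := by
  rw [shear, inner_sub_left, inner_smul_left, real_inner_comm y y₀]
  simp only [conj_trivial]
  rw [div_mul_cancel₀ _ hy, inner_sub_right, inner_smul_right]
  ring

theorem inner_shear_direction {y₀ : CN n} (hy₀ : y₀ ≠ 0) (y : CN n) :
    inner ℝ y₀ (y - (inner ℝ y y₀ / ‖y₀‖ ^ 2) • y₀) = 0 := by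
  have : ‖y₀‖ ≠ 0 := norm_ne_zero_iff.2 hy₀
  rw [inner_sub_right, inner_smul_right, real_inner_self_eq_norm_sq, real_inner_comm]
  field_simp
  ring

/-- The vector y - c y₀ is orthogonal to y₀, so the shear is a transvection along y₀ and has
determinant 1. -/
theorem integral_comp_shear {y₀ : CN n} (hy₀ : y₀ ≠ 0) (y : CN n) (F : CN n → ℂ) :
    ∫ x, F (shear y₀ y x) = ∫ x, F x := by
  set c := inner ℝ y y₀ / ‖y₀‖ ^ 2 with hc
  let f : Module.Dual ℝ (CN n) := (-(inner ℝ y y₀)⁻¹) • innerₗ (CN n) (y - c • y₀)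
  have hf : ∀ x, f x = -(inner ℝ x (y - c • y₀) / inner ℝ y y₀) := by
    intro x
    simp only [f, LinearMap.smul_apply, innerₗ_apply_apply, smul_eq_mul]
    rw [real_inner_comm x, div_eq_inv_mul, neg_mul]
  have hfv : f y₀ = 0 := by
    rw [hf, inner_shear_direction hy₀, zero_div, neg_zero]
  have hsh : ∀ x, shear y₀ y x = LinearEquiv.transvection hfv x := by
    intro x
    rw [LinearEquiv.transvection.apply, hf, shear, sub_eq_add_neg, neg_smul]
  let e : CN n ≃L[ℝ] CN n := (LinearEquiv.transvection hfv).toContinuousLinearEquiv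
  have hmp : MeasurePreserving e (volume : Measure (CN n)) volume := by
    refine ⟨e.continuous.measurable, ?_⟩
    have hdet : LinearMap.det (e : CN n →ₗ[ℝ] CN n) = 1 := by
      have := LinearEquiv.transvection.det_eq_one hfv
      rw [← Units.val_inj, LinearEquiv.coe_det] at this
      exact this
    have h := Measure.map_linearMap_addHaar_eq_smul_addHaar (volume : Measure (CN n))
      (f := (e : CN n →ₗ[ℝ] CN n)) (by rw [hdet]; exact one_ne_zero)
    rw [hdet] at h
    simpa using h
  simp only [hsh]
  exact hmp.integral_comp e.toHomeomorph.measurableEmbedding F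

/-- Differentiating the kernel in Y would worsen its singularity on Re ω = 0. The shear, a change of
variables that depends on Y, straightens the singular hyperplane to that of Y₀: the kernel becomes
fixed and locally integrable up to a smooth scalar, and all dependence on Y moves into the smooth
function `G`. -/
theorem contDiffAt_integral_mul_ksKernel [Nontrivial (CN n)] {μ : ℂ} (hμ : μ ∈ ksDomain n) (δ : ℤ)
    {G : CN n → ℂ} (hG : ContDiff ℝ ∞ G) (hGs : HasCompactSupport G) {Y₀ : CN n} (hY₀ : Y₀ ≠ 0) :
    ContDiffAt ℝ ∞ (fun Y => ∫ x, G x * ksKernel μ δ x Y) Y₀ := by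
  set y₀ := conjJ n Y₀ with hy₀
  have hy₀0 : y₀ ≠ 0 := by simpa [hy₀] using hY₀
  have hn : 0 < ‖y₀‖ := norm_pos_iff.2 hy₀0
  set S : Set (CN n) := Metric.ball Y₀ (‖y₀‖ / 2) with hS
  have hdist : ∀ Y ∈ S, ‖conjJ n Y - y₀‖ < ‖y₀‖ / 2 := by
    intro Y hY
    rw [hy₀, ← map_sub, norm_conjJ]
    exact mem_ball_iff_norm.1 hY
  have hinner : ∀ Y ∈ S, ‖y₀‖ ^ 2 / 2 < inner ℝ (conjJ n Y) y₀ := by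
    intro Y hY
    have h1 : inner ℝ (conjJ n Y) y₀ = ‖y₀‖ ^ 2 + inner ℝ (conjJ n Y - y₀) y₀ := by
      rw [inner_sub_left, real_inner_self_eq_norm_sq]
      ring
    have h2 := neg_le_of_abs_le (abs_real_inner_le_norm (conjJ n Y - y₀) y₀)
    have h3 := hdist Y hY
    nlinarith
  have hpos : ∀ Y ∈ S, 0 < inner ℝ (conjJ n Y) y₀ := fun Y hY =>
    lt_trans (by positivity) (hinner Y hY)
  have hform : ∀ Y ∈ S, ∀ x, ksKernel μ δ (shear y₀ (conjJ n Y) x) Y =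
      ((inner ℝ (conjJ n Y) y₀ / ‖y₀‖ ^ 2 : ℝ) : ℂ) ^ (-(μ + 2 * n)) * ksKernel μ δ x Y₀ := by
    intro Y hY x
    rw [← ksKernel_smul_left μ δ (div_pos (hpos Y hY) (by positivity)), ksKernel, ksKernel,
      re_sympForm_smul_left, ← inner_conjJ, ← inner_conjJ, inner_shear (hpos Y hY).ne']
  have key : ∀ Y ∈ S, ∫ x, G x * ksKernel μ δ x Y =
      ((inner ℝ (conjJ n Y) y₀ / ‖y₀‖ ^ 2 : ℝ) : ℂ) ^ (-(μ + 2 * n)) *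
        ∫ x, ksKernel μ δ x Y₀ * G (shear y₀ (conjJ n Y) x) := by
    intro Y hY
    rw [← integral_comp_shear hy₀0 (conjJ n Y) (fun x => G x * ksKernel μ δ x Y),
      ← integral_const_mul]
    refine integral_congr_ae (ae_of_all _ fun x => ?_)
    simp only [hform Y hY]
    ring
  obtain ⟨R, hR0, hR⟩ : ∃ R : ℝ, 0 ≤ R ∧ ∀ x, G x ≠ 0 → ‖x‖ ≤ R := by
    obtain ⟨R, hR⟩ := hGs.isCompact.isBounded.exists_norm_le
    exact ⟨max R 0, le_max_right _ _, fun x hx =>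
      (hR x (subset_tsupport _ hx)).trans (le_max_left _ _)⟩
  -- Keeps the supports of all the sheared functions in one ball of radius 7R. Undoing the shear
  -- adds at most 6‖z‖ to ‖z‖, because ‖y - c y₀‖ ≤ 3‖y₀‖ and ⟨y, y₀⟩ > ‖y₀‖²/2 on `S`.
  have hshift : ∀ Y ∈ S, ∀ x, ‖x‖ ≤ 7 * ‖shear y₀ (conjJ n Y) x‖ := by
    intro Y hY x
    set y := conjJ n Y with hy
    set c := inner ℝ y y₀ / ‖y₀‖ ^ 2 with hc
    set z := shear y₀ y x with hz
    have hzi : inner ℝ z (y - c • y₀) = inner ℝ x (y - c • y₀) := by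
      rw [hz, shear, inner_sub_left, inner_smul_left, inner_shear_direction hy₀0, mul_zero,
        sub_zero]
    have hx : x = z + (inner ℝ z (y - c • y₀) / inner ℝ y y₀) • y₀ := by
      rw [hzi, hz, shear, sub_add_cancel]
    have hnorm1 : ‖y‖ ≤ 3 / 2 * ‖y₀‖ := by
      have := norm_le_insert' y y₀
      have := hdist Y hY
      linarith
    have hp := hpos Y hY
    have hi := hinner Y hY
    have hnorm2 : ‖c • y₀‖ ≤ ‖y‖ := by
      have h1 := real_inner_le_norm y y₀
      rw [norm_smul, hc, Real.norm_of_nonneg (by positivity), div_mul_eq_mul_div,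
        div_le_iff₀ (by positivity)]
      nlinarith
    have hnorm3 : ‖y - c • y₀‖ ≤ 3 * ‖y₀‖ := by
      have := norm_sub_le y (c • y₀)
      linarith
    have habs : |inner ℝ z (y - c • y₀) / inner ℝ y y₀| * ‖y₀‖ ≤ 6 * ‖z‖ := by
      rw [abs_div, abs_of_pos hp, div_mul_eq_mul_div, div_le_iff₀ hp]
      have h1 := abs_real_inner_le_norm z (y - c • y₀)
      have h2 : ‖z‖ * ‖y - c • y₀‖ ≤ ‖z‖ * (3 * ‖y₀‖) :=
        mul_le_mul_of_nonneg_left hnorm3 (norm_nonneg _)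
      calc _ ≤ ‖z‖ * (3 * ‖y₀‖) * ‖y₀‖ :=
            mul_le_mul_of_nonneg_right (h1.trans h2) hn.le
        _ = 6 * ‖z‖ * (‖y₀‖ ^ 2 / 2) := by ring
        _ ≤ _ := mul_le_mul_of_nonneg_left hi.le (by positivity)
    calc ‖x‖ = ‖z + (inner ℝ z (y - c • y₀) / inner ℝ y y₀) • y₀‖ := by rw [← hx]
      _ ≤ ‖z‖ + |inner ℝ z (y - c • y₀) / inner ℝ y y₀| * ‖y₀‖ := by
          refine (norm_add_le _ _).trans ?_
          rw [norm_smul, Real.norm_eq_abs]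
      _ ≤ _ := by linarith
  have hinnerC : ContDiff ℝ ∞ fun Y : CN n => (inner ℝ (conjJ n Y) y₀ : ℝ) :=
    (conjJ n).contDiff.inner ℝ contDiff_const
  have hgc : ContDiffOn ℝ ∞ (Function.uncurry fun (Y t : CN n) => G (shear y₀ (conjJ n Y) (-t)))
      (S ×ˢ univ) := by
    refine hG.comp_contDiffOn ?_
    have hi : ContDiff ℝ ∞ fun p : CN n × CN n => (inner ℝ (conjJ n p.1) y₀ : ℝ) :=
      hinnerC.comp contDiff_fst
    have hneg : ContDiff ℝ ∞ fun p : CN n × CN n => -p.2 := contDiff_snd.neg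
    have hw : ContDiff ℝ ∞ fun p : CN n × CN n =>
        conjJ n p.1 - (inner ℝ (conjJ n p.1) y₀ / ‖y₀‖ ^ 2) • y₀ :=
      ((conjJ n).contDiff.comp contDiff_fst).sub ((hi.div_const _).smul contDiff_const)
    refine hneg.contDiffOn.sub (ContDiffOn.smul (ContDiffOn.div ?_ hi.contDiffOn ?_)
      contDiffOn_const)
    · exact (hneg.inner ℝ hw).contDiffOn
    · rintro ⟨Y, t⟩ ⟨hY, -⟩
      exact (hpos Y hY).ne'
  -- The integral is a convolution with parameter Y, evaluated at the constant point 0; the sign in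
  -- `-t` cancels the reflection built into the convolution.
  have hconv := contDiffOn_convolution_right_with_param_comp (μ := (volume : Measure (CN n)))
    (n := ⊤) (ContinuousLinearMap.mul ℝ ℂ) (v := fun _ : CN n => (0 : CN n)) (s := S)
    contDiffOn_const (f := fun x => ksKernel μ δ x Y₀)
    (g := fun (Y t : CN n) => G (shear y₀ (conjJ n Y) (-t)))
    (k := Metric.closedBall 0 (7 * R)) Metric.isOpen_ball (isCompact_closedBall _ _) (by
      intro Y t hY ht
      by_contra hne
      apply ht
      rw [mem_closedBall_zero_iff, ← norm_neg]
      exact (hshift Y hY (-t)).trans (mul_le_mul_of_nonneg_left (hR _ hne) (by norm_num)))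
    (locallyIntegrable_ksKernel hμ δ hY₀) hgc
  have hYS : S ∈ 𝓝 Y₀ := Metric.ball_mem_nhds _ (half_pos hn)
  have hfac : ContDiffAt ℝ ∞ (fun Y : CN n =>
      ((inner ℝ (conjJ n Y) y₀ / ‖y₀‖ ^ 2 : ℝ) : ℂ) ^ (-(μ + 2 * n))) Y₀ := by
    have h1 : ContDiffAt ℝ ∞ (fun Y : CN n => Complex.exp
        (((Real.log (inner ℝ (conjJ n Y) y₀ / ‖y₀‖ ^ 2) : ℝ) : ℂ) * (-(μ + 2 * n)))) Y₀ := by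
      refine Complex.contDiff_exp.contDiffAt.comp Y₀ (ContDiffAt.mul ?_ contDiffAt_const)
      refine Complex.ofRealCLM.contDiff.contDiffAt.comp Y₀ ?_
      refine ContDiffAt.log (hinnerC.div_const _).contDiffAt ?_
      exact (div_pos (hpos Y₀ (mem_of_mem_nhds hYS)) (by positivity)).ne'
    refine h1.congr_of_eventuallyEq ?_
    filter_upwards [hYS] with Y hY
    have hp := div_pos (hpos Y hY) (by positivity : 0 < ‖y₀‖ ^ 2)
    rw [Complex.cpow_def_of_ne_zero (by exact_mod_cast hp.ne'), ← Complex.ofReal_log hp.le]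
  refine (hfac.mul (hconv.contDiffAt hYS)).congr_of_eventuallyEq ?_
  filter_upwards [hYS] with Y hY
  rw [key Y hY]
  simp [convolution]

/-- With cut-off exponent μ₀ = μ the sphere integral is an integral over the whole space divided by
the constant `bumpMellin 0`, which brings it within reach of the shear argument. -/
theorem contDiffOn_ksIntegral [Nontrivial (CN n)] {h : Sph n → ℂ}
    (hh : ContDiffOn ℝ ∞ (homExt 0 h) {0}ᶜ) {μ : ℂ} (hμ : μ ∈ ksDomain n) (δ : ℤ) :
    ContDiffOn ℝ ∞ (ksIntegral μ δ h) {0}ᶜ := by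
  intro Y hY
  have h1 := contDiffAt_integral_mul_ksKernel hμ δ (contDiff_annular (μ - 2 * n) hh)
    (hasCompactSupport_annular _ _) hY
  have h2 := h1.mul (contDiffAt_const (c := (bumpMellin 0)⁻¹))
  refine (h2.congr_of_eventuallyEq (Eventually.of_forall fun Z => ?_)).contDiffWithinAt
  show _ = (∫ x, annular (μ - 2 * n) h x * ksKernel μ δ x Z) * (bumpMellin 0)⁻¹
  rw [integral_annular_mul_ksKernel hh, sub_self, mul_assoc, mul_inv_cancel₀ bumpMellin_zero_ne,
    mul_one]

end smoothness

/-! ### The symplectic Fourier transform is an involution -/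

section fourier

variable {n : ℕ}

/-- The map `ξ ↦ -conj (J ξ)` as an isometry. -/
def negConjJ (n : ℕ) : CN n ≃ₗᵢ[ℝ] CN n :=
  { toLinearEquiv := ((conjJ n).toLinearEquiv).trans (LinearEquiv.neg ℝ)
    norm_map' := fun x => by
      show ‖-(conjJ n x)‖ = ‖x‖
      rw [norm_neg, norm_conjJ] }

theorem negConjJ_apply (x : CN n) : negConjJ n x = -conjJ n x := rfl

theorem negConjJ_negConjJ (x : CN n) : negConjJ n (negConjJ n x) = -x := by
  rw [negConjJ_apply, negConjJ_apply, map_neg, neg_neg]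
  ext (k | k) <;> simp [conjJ]

theorem sympFourierTranspose_coe (φ : 𝓢(CN n, ℂ)) :
    (sympFourierTranspose n φ : CN n → ℂ) = 𝓕 (φ : CN n → ℂ) ∘ negConjJ n := by
  funext x
  show (𝓕 (φ : CN n → ℂ)) (conjJ n (-x)) = _
  rw [map_neg]
  rfl

/-- The transform is the Euclidean one composed with an isometry whose square is -1. Applying it
twice reproduces Fourier inversion, reflection included. -/
theorem sympFourierTranspose_involutive (φ : 𝓢(CN n, ℂ)) :
    sympFourierTranspose n (sympFourierTranspose n φ) = φ := by
  ext x
  rw [sympFourierTranspose_coe, Function.comp_apply, sympFourierTranspose_coe,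
    Real.fourier_comp_linearIsometry, negConjJ_negConjJ, ← Real.fourierInv_eq_fourier_neg]
  have h := FourierTransform.fourierInv_fourier_eq (F := 𝓢(CN n, ℂ)) φ
  have h2 := congrArg (fun f : 𝓢(CN n, ℂ) => f x) h
  simp only [SchwartzMap.fourierInv_coe, SchwartzMap.fourier_coe] at h2
  exact h2

theorem sympFourierDist_apply (T : 𝓢'(CN n, ℂ)) (φ : 𝓢(CN n, ℂ)) :
    sympFourierDist n T φ = T (sympFourierTranspose n φ) := rfl

/-- Parseval with a dilation: u enters only through u Re ω(x, ξ), so it can be moved from ξ to x. -/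
theorem integral_mul_sympFourier_ray (φ G : 𝓢(CN n, ℂ)) (u : ℝ) :
    ∫ ξ, φ ξ * sympFourier n G (u • ξ) = ∫ x, G x * sympFourierTranspose n φ (u • x) := by
  have hint : Integrable (fun p : CN n × CN n => φ p.1 * G p.2 *
      Complex.exp (-2 * Complex.I * Real.pi * ((u * (sympForm p.2 p.1).re : ℝ) : ℂ)))
      (volume.prod volume) := by
    refine (φ.integrable.mul_prod G.integrable).mul_bdd (c := 1) ?_ (ae_of_all _ fun p => ?_)
    · have h := continuous_re_sympForm (n := n)
      have h2 : Continuous fun p : CN n × CN n => (sympForm p.2 p.1).re :=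
        h.comp (continuous_snd.prodMk continuous_fst)
      exact (by fun_prop : Continuous fun p : CN n × CN n =>
        Complex.exp (-2 * Complex.I * Real.pi * ((u * (sympForm p.2 p.1).re : ℝ) : ℂ))
        ).aestronglyMeasurable
    · rw [Complex.norm_exp]
      simp
  calc _ = ∫ ξ, ∫ x, φ ξ * G x *
      Complex.exp (-2 * Complex.I * Real.pi * ((u * (sympForm x ξ).re : ℝ) : ℂ)) := by
        refine integral_congr_ae (ae_of_all _ fun ξ => ?_)
        simp only [sympFourier_apply, re_sympForm_smul_right, mul_assoc]
        rw [← integral_const_mul]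
    _ = ∫ x, ∫ ξ, φ ξ * G x *
      Complex.exp (-2 * Complex.I * Real.pi * ((u * (sympForm x ξ).re : ℝ) : ℂ)) :=
        integral_integral_swap hint
    _ = _ := by
        refine integral_congr_ae (ae_of_all _ fun x => ?_)
        simp only [sympFourierTranspose_apply, re_sympForm_smul_left]
        rw [← integral_const_mul]
        refine integral_congr_ae (ae_of_all _ fun ξ => ?_)
        simp only
        ring

theorem integral_ray_weight {σ : ℝ} {M : ℕ} {b : ℝ} (hb : 0 < b) :
    ∫ u in Ioi (0 : ℝ), u ^ (σ - 1) * ((1 + u * b) ^ M)⁻¹ =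
      b ^ (-σ) * ∫ u in Ioi (0 : ℝ), u ^ (σ - 1) * ((1 + u) ^ M)⁻¹ := by
  have h := integral_comp_mul_left_Ioi (fun v : ℝ => v ^ (σ - 1) * ((1 + v) ^ M)⁻¹) 0 hb
  rw [mul_zero, smul_eq_mul] at h
  have h2 : ∫ u in Ioi (0 : ℝ), (b * u) ^ (σ - 1) * ((1 + b * u) ^ M)⁻¹ =
      b ^ (σ - 1) * ∫ u in Ioi (0 : ℝ), u ^ (σ - 1) * ((1 + u * b) ^ M)⁻¹ := by
    rw [← integral_const_mul]
    refine setIntegral_congr_fun measurableSet_Ioi fun u (hu : 0 < u) => ?_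
    rw [Real.mul_rpow hb.le hu.le, mul_comm u b, mul_assoc]
  rw [h2] at h
  have h3 : b ^ (σ - 1) ≠ 0 := (Real.rpow_pos_of_pos hb _).ne'
  apply mul_left_cancel₀ h3
  rw [h, ← mul_assoc, ← Real.rpow_add hb]
  congr 1
  rw [← Real.rpow_neg_one]
  congr 1
  ring

/-- Fubini. The hypothesis `hφ` controls the singularity of order ‖x‖^{-Re s} that a ray transform
has at the origin. -/
theorem integral_mul_rayMellin {φ ψ : 𝓢(CN n, ℂ)} [Nontrivial (CN n)] {s : ℂ} (hs : 0 < s.re)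
    (hφ : Integrable fun x : CN n => ‖φ x‖ * ‖x‖ ^ (-s.re)) :
    ∫ x, φ x * rayMellin s ψ x =
      ∫ u in Ioi (0 : ℝ), (u : ℂ) ^ (s - 1) * ∫ x, φ x * ψ (u • x) := by
  obtain ⟨M, hM⟩ := exists_nat_gt s.re
  obtain ⟨C, hC, h⟩ := schwartz_decay ψ M
  have hne : ∀ᵐ x : CN n, x ≠ 0 := Measure.ae_ne volume 0
  have hw : ∀ x : CN n, x ≠ 0 → ∀ᵐ u : ℝ ∂volume.restrict (Ioi (0 : ℝ)),
      ‖(u : ℂ) ^ (s - 1) * (φ x * ψ (u • x))‖ ≤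
        ‖φ x‖ * C * (u ^ (s.re - 1) * ((1 + u * ‖x‖) ^ M)⁻¹) := by
    intro x hx
    filter_upwards [ae_restrict_mem measurableSet_Ioi] with u hu
    have hu' : 0 < u := hu
    have h1 := h (u • x)
    rw [norm_smul, Real.norm_of_nonneg hu'.le] at h1
    rw [norm_mul, norm_mul, Complex.norm_cpow_eq_rpow_re_of_pos hu', Complex.sub_re,
      Complex.one_re]
    calc _ ≤ u ^ (s.re - 1) * (‖φ x‖ * (C * ((1 + u * ‖x‖) ^ M)⁻¹)) := by gcongr
      _ = _ := by ring
  have hmeas : AEStronglyMeasurable (fun p : CN n × ℝ => (p.2 : ℂ) ^ (s - 1) *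
      (φ p.1 * ψ (p.2 • p.1))) (volume.prod (volume.restrict (Ioi 0))) := by
    refine Measurable.aestronglyMeasurable (Measurable.mul ?_ (Continuous.measurable ?_))
    · exact (Complex.measurable_ofReal.comp measurable_snd).pow_const _
    · exact (φ.continuous.comp continuous_fst).mul
        (ψ.continuous.comp (continuous_snd.smul continuous_fst))
  have hint : Integrable (fun p : CN n × ℝ => (p.2 : ℂ) ^ (s - 1) * (φ p.1 * ψ (p.2 • p.1)))
      (volume.prod (volume.restrict (Ioi 0))) := by
    rw [integrable_prod_iff hmeas]
    have hslice : ∀ x : CN n, AEStronglyMeasurable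
        (fun u : ℝ => (u : ℂ) ^ (s - 1) * (φ x * ψ (u • x))) (volume.restrict (Ioi 0)) := by
      intro x
      refine Measurable.aestronglyMeasurable (Measurable.mul ?_ (Continuous.measurable ?_))
      · exact Complex.measurable_ofReal.pow_const _
      · exact continuous_const.mul (ψ.continuous.comp (continuous_id.smul continuous_const))
    have hwi : ∀ x : CN n, x ≠ 0 → Integrable
        (fun u : ℝ => ‖φ x‖ * C * (u ^ (s.re - 1) * ((1 + u * ‖x‖) ^ M)⁻¹))
        (volume.restrict (Ioi 0)) := fun x hx =>
      (integrableOn_rpow_mul_inv_one_add_pow (norm_pos_iff.2 hx) hs hM).const_mul _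
    constructor
    · filter_upwards [hne] with x hx
      exact Integrable.mono' (hwi x hx) (hslice x) (hw x hx)
    -- By `integral_ray_weight` the majorant, integrated over u, scales like ‖x‖^{-Re s}, the weight
    -- in `hφ`.
    · refine Integrable.mono' (hφ.mul_const
        (C * ∫ u in Ioi (0 : ℝ), u ^ (s.re - 1) * ((1 + u) ^ M)⁻¹))
        hmeas.norm.integral_prod_right' ?_
      filter_upwards [hne] with x hx
      rw [Real.norm_of_nonneg (integral_nonneg fun u => norm_nonneg _)]
      refine (integral_mono_ae ((Integrable.mono' (hwi x hx) (hslice x) (hw x hx)).norm) (hwi x hx)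
        (hw x hx)).trans (le_of_eq ?_)
      rw [integral_const_mul, integral_ray_weight (norm_pos_iff.2 hx)]
      ring
  calc _ = ∫ x, ∫ u in Ioi (0 : ℝ), (u : ℂ) ^ (s - 1) * (φ x * ψ (u • x)) := by
        refine integral_congr_ae (ae_of_all _ fun x => ?_)
        simp only [rayMellin_eq]
        rw [← integral_const_mul]
        refine integral_congr_ae (ae_of_all _ fun u => ?_)
        simp only
        ring
    _ = ∫ u in Ioi (0 : ℝ), ∫ x, (u : ℂ) ^ (s - 1) * (φ x * ψ (u • x)) :=
        integral_integral_swap hint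
    _ = _ := by
        refine integral_congr_ae (ae_of_all _ fun u => ?_)
        simp only
        rw [← integral_const_mul]

/-- The Fourier transform of a cut-off homogeneous function, integrated along rays, represents the
Fourier transform of the homogeneous function. -/
theorem integral_mul_rayMellin_sympFourier [Nontrivial (CN n)] {h : Sph n → ℂ}
    (hh : ContDiffOn ℝ ∞ (homExt 0 h) {0}ᶜ) {μ : ℂ} (hμ : 0 < (μ + 2 * n).re) {φ : 𝓢(CN n, ℂ)}
    (hφ : Integrable fun x : CN n => ‖φ x‖ * ‖x‖ ^ (-(μ + 2 * n).re)) :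
    ∫ ξ, φ ξ * rayMellin (μ + 2 * n) (sympFourier n (annularSchwartz (μ - 2 * n) hh)) ξ =
      (∫ x, sympFourierTranspose n φ x * homExt (μ - 2 * n) h x) * bumpMellin 0 := by
  set G := annularSchwartz (μ - 2 * n) hh with hG
  -- `G` vanishes near the origin, so the weight is harmless.
  have hGi : Integrable fun x : CN n => ‖G x‖ * ‖x‖ ^ (-(μ + 2 * n).re) := by
    have hc : Continuous fun x : CN n => ‖G x‖ * ‖x‖ ^ (-(μ + 2 * n).re) := by
      rw [continuous_iff_continuousAt]
      intro x
      by_cases hx : x = 0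
      · have : (fun x : CN n => ‖G x‖ * ‖x‖ ^ (-(μ + 2 * n).re)) =ᶠ[𝓝 x] fun _ => 0 := by
          have hb : Metric.ball (0 : CN n) (1 / 2) ∈ 𝓝 x := by
            rw [hx]
            exact Metric.ball_mem_nhds _ (by norm_num)
          filter_upwards [hb] with y hy
          rw [Metric.mem_ball, dist_zero_right] at hy
          rw [hG, annularSchwartz_apply, annular_eq_zero _ _ hy.le, norm_zero, zero_mul]
        exact continuousAt_const.congr this.symm
      · exact G.continuous.norm.continuousAt.mul
          (continuous_norm.continuousAt.rpow_const (Or.inl (norm_ne_zero_iff.2 hx)))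
    refine hc.integrable_of_hasCompactSupport ?_
    exact (hasCompactSupport_annular (μ - 2 * n) h).norm.mul_right
  have hcont := continuous_of_contDiffOn_homExt hh
  rw [integral_mul_rayMellin hμ hφ]
  simp only [integral_mul_sympFourier_ray]
  -- The ray integral now falls on the transform of φ. That function is homogeneous of degree -(μ +
  -- N), so pairing it with `G` has total radial exponent 0 and gives a sphere integral times
  -- `bumpMellin 0`; polar coordinates (`h4`) give the same sphere integral for the other side.
  rw [← integral_mul_rayMellin hμ hGi]
  have hm : Measurable (rayMellin (μ + 2 * n) (sympFourierTranspose n φ)) :=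
    measurable_of_continuousOn_compl_singleton 0
      (contDiffOn_rayMellin (sympFourierTranspose n φ) hμ).continuousOn
  have h1 := integral_annular_mul (lam := μ - 2 * n) (ν := -(μ + 2 * n)) hh
    (Q := rayMellin (μ + 2 * n) (sympFourierTranspose n φ)) hm.aestronglyMeasurable
    (fun r hr X => rayMellin_smul _ _ hr _)
  have h2 : 4 * (n : ℂ) + (μ - 2 * n) + -(μ + 2 * n) = 0 := by ring
  have h3 : 4 * (n : ℂ) + (μ - 2 * n) = μ + 2 * n := by ring
  rw [h2] at h1
  have h4 := integral_schwartz_mul_homExt (ν := μ - 2 * n) (by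
    have := congrArg Complex.re h3
    rw [Complex.add_re] at this
    have h5 : (4 * (n : ℂ)).re = 4 * n := by simp
    rw [← h5, this]
    exact hμ) hcont.measurable (integrable_sphere_of_continuous hcont) (sympFourierTranspose n φ)
  rw [h4, h3]
  exact h1

end fourier

/-! ### Analyticity of the normalising constant -/

/-- `1 / C_N(μ, δ)` is a quotient of entire functions, the denominator being zero only at the
poles. -/
theorem inv_normConst_eq_div (n : ℕ) (δ : ℤ) : ∃ A B : ℂ → ℂ, Differentiable ℂ A ∧
    Differentiable ℂ B ∧ (∀ μ, (normConst n μ δ)⁻¹ = A μ * (B μ)⁻¹) ∧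
    (∀ μ ∉ ksPoles n δ, B μ ≠ 0) ∧ (∃ μ, A μ ≠ 0) ∧ ∃ μ, B μ ≠ 0 := by
  have hre : ∀ z : ℂ, 0 < z.re → (Complex.Gammaℝ z)⁻¹ ≠ 0 := fun z hz =>
    inv_ne_zero (Complex.Gammaℝ_ne_zero_of_re_pos hz)
  by_cases hδ : Even δ
  -- The points μ + N = 0 and μ + N = 1 witness that `A` and `B` are not identically zero: there the
  -- argument of Γ_ℝ has positive real part.
  · refine ⟨fun μ => 2⁻¹ * (Complex.Gammaℝ (1 - (μ + 2 * n)))⁻¹,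
      fun μ => (Complex.Gammaℝ (μ + 2 * n))⁻¹,
      (Complex.differentiable_Gammaℝ_inv.comp
        (by fun_prop : Differentiable ℂ fun μ : ℂ => 1 - (μ + 2 * n))).const_mul _,
      Complex.differentiable_Gammaℝ_inv.comp
        (by fun_prop : Differentiable ℂ fun μ : ℂ => μ + 2 * n), fun μ => ?_, fun μ hμ => ?_,
      ⟨-(2 * n), ?_⟩, ⟨1 - 2 * n, ?_⟩⟩
    -- This holds at every μ, poles included, because Γ_ℝ takes the value 0 at its poles and 0⁻¹ =
    -- 0.
    · rw [normConst_of_even n μ hδ, mul_inv, inv_div, inv_inv]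
      ring
    · rw [ne_eq, inv_eq_zero, Complex.Gammaℝ_eq_zero_iff]
      rintro ⟨k, hk⟩
      refine hμ ⟨2 * k, ?_, ?_⟩
      · push_cast
        exact (even_two_mul _).sub hδ
      · rw [hk]
        push_cast
        rfl
    · refine mul_ne_zero (by norm_num) (hre _ ?_)
      simp
    · refine hre _ ?_
      simp
  · have hδ' := Int.not_even_iff_odd.1 hδ
    refine ⟨fun μ => (2 * Complex.I)⁻¹ * (Complex.Gammaℝ (2 - (μ + 2 * n)))⁻¹,
      fun μ => (Complex.Gammaℝ (μ + 2 * n + 1))⁻¹,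
      (Complex.differentiable_Gammaℝ_inv.comp
        (by fun_prop : Differentiable ℂ fun μ : ℂ => 2 - (μ + 2 * n))).const_mul _,
      Complex.differentiable_Gammaℝ_inv.comp
        (by fun_prop : Differentiable ℂ fun μ : ℂ => μ + 2 * n + 1), fun μ => ?_, fun μ hμ => ?_,
      ⟨-(2 * n), ?_⟩, ⟨1 - 2 * n, ?_⟩⟩
    · rw [normConst_of_odd n μ hδ, mul_inv, inv_div, inv_inv]
      ring
    · rw [ne_eq, inv_eq_zero, Complex.Gammaℝ_eq_zero_iff]
      rintro ⟨k, hk⟩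
      refine hμ ⟨2 * k + 1, ?_, ?_⟩
      · push_cast
        exact (odd_two_mul_add_one (k : ℤ)).sub_odd hδ'
      · rw [← sub_eq_zero] at hk ⊢
        rw [← hk]
        push_cast
        ring
    · refine mul_ne_zero (by simp) (hre _ ?_)
      simp
    · refine hre _ ?_
      simp

theorem analyticAt_inv_normConst {n : ℕ} {δ : ℤ} {μ : ℂ} (hμ : μ ∉ ksPoles n δ) :
    AnalyticAt ℂ (fun ν => (normConst n ν δ)⁻¹) μ := by
  obtain ⟨A, B, hA, hB, he, hB0, -⟩ := inv_normConst_eq_div n δ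
  simp only [he]
  exact (hA.analyticAt μ).mul ((hB.analyticAt μ).inv (hB0 μ hμ))

theorem meromorphicAt_inv_normConst (n : ℕ) (δ : ℤ) (μ : ℂ) :
    MeromorphicAt (fun ν => (normConst n ν δ)⁻¹) μ := by
  obtain ⟨A, B, hA, hB, he, -⟩ := inv_normConst_eq_div n δ
  simp only [he]
  exact (hA.analyticAt μ).meromorphicAt.mul (hB.analyticAt μ).meromorphicAt.inv

theorem eventually_ne_zero_of_differentiable {f : ℂ → ℂ} (hf : Differentiable ℂ f)
    (h0 : ∃ z, f z ≠ 0) (z : ℂ) : ∀ᶠ w in 𝓝[≠] z, f w ≠ 0 := by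
  have han : AnalyticOnNhd ℂ f univ := fun w _ => hf.analyticAt w
  rcases (han z (mem_univ z)).eventually_eq_zero_or_eventually_ne_zero with h | h
  · obtain ⟨w, hw⟩ := h0
    exact absurd (han.eqOn_zero_of_preconnected_of_eventuallyEq_zero isPreconnected_univ
      (mem_univ z) h (mem_univ w)) hw
  · exact h

/-- Zeros of `A` and `B` are isolated. This permits division by C_N near every point, which is all
that meromorphic identities need. -/
theorem eventually_normConst_ne_zero (n : ℕ) (δ : ℤ) (μ : ℂ) :
    ∀ᶠ ν in 𝓝[≠] μ, normConst n ν δ ≠ 0 := by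
  obtain ⟨A, B, hA, hB, he, -, hA0, hB0⟩ := inv_normConst_eq_div n δ
  filter_upwards [eventually_ne_zero_of_differentiable hA hA0 μ,
    eventually_ne_zero_of_differentiable hB hB0 μ] with ν h1 h2
  intro h0
  have h3 := he ν
  rw [h0, inv_zero] at h3
  exact mul_ne_zero h1 (inv_ne_zero h2) h3.symm

/-! ### Elements of `V^∞_{μ,δ}` -/

section Vsmooth

variable {n : ℕ}

theorem Vsmooth_smul_real {μ : ℂ} {δ : ℤ} {f : CN n → ℂ} (hf : f ∈ Vsmooth n μ δ) {r : ℝ}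
    (hr : 0 < r) (x : CN n) : f (r • x) = (r : ℂ) ^ (-μ - 2 * n) * f x := by
  by_cases hx : x = 0
  · rw [hx, smul_zero, hf.2.1, mul_zero]
  · have h := hf.2.2 (r : ℂ) (by exact_mod_cast hr.ne') x hx
    rw [bracket_ofReal_of_pos hr, one_zpow, mul_one, Complex.norm_real,
      Real.norm_of_nonneg hr.le] at h
    exact h

theorem Vsmooth_phase {μ : ℂ} {δ : ℤ} {f : CN n → ℂ} (hf : f ∈ Vsmooth n μ δ) {c : ℂ}
    (hc : ‖c‖ = 1) {x : CN n} (hx : x ≠ 0) : f (c • x) = c ^ (-δ) * f x := by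
  have hc0 : c ≠ 0 := by
    rintro rfl
    simp at hc
  have h := hf.2.2 c hc0 x hx
  rwa [bracket, hc, Complex.ofReal_one, div_one, Complex.one_cpow, one_mul] at h

theorem homExt_restr_of_homogeneous {ν : ℂ} {f : CN n → ℂ} (h0 : f 0 = 0)
    (hf : ∀ r : ℝ, 0 < r → ∀ x, f (r • x) = (r : ℂ) ^ ν * f x) : homExt ν (restr f) = f := by
  funext x
  by_cases hx : x = 0
  · rw [hx, homExt_zero, h0]
  · obtain ⟨X, hX⟩ := exists_smul_sphere hx
    have hn : 0 < ‖x‖ := norm_pos_iff.2 hx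
    rw [hX, homExt_smul_sphere _ _ hn, hf _ hn]
    rfl

theorem homExt_restr {μ : ℂ} {δ : ℤ} {f : CN n → ℂ} (hf : f ∈ Vsmooth n μ δ) :
    homExt (-μ - 2 * n) (restr f) = f :=
  homExt_restr_of_homogeneous hf.2.1 fun _ hr x => Vsmooth_smul_real hf hr x

theorem restr_mem_smoothSphere {μ : ℂ} {δ : ℤ} {f : CN n → ℂ} (hf : f ∈ Vsmooth n μ δ) :
    restr f ∈ SmoothSphere n δ := by
  refine ⟨?_, fun c X X' hc hX => ?_⟩
  · have h1 : ContDiffOn ℝ ∞ (fun x => (‖x‖ : ℂ) ^ (μ + 2 * n) * f x) {0}ᶜ :=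
      (contDiffOn_norm_cpow _).mul hf.1
    refine h1.congr fun x hx => ?_
    have hx' : (‖x‖ : ℂ) ≠ 0 := by
      have : x ≠ 0 := hx
      exact_mod_cast norm_ne_zero_iff.2 this
    conv_rhs => rw [← homExt_restr hf, homExt_eq, ← mul_assoc, ← Complex.cpow_add _ _ hx']
    have : μ + 2 * n + (-μ - 2 * n) = 0 := by ring
    rw [this, Complex.cpow_zero, one_mul]
  · show f X' = _
    rw [hX]
    exact Vsmooth_phase hf hc (sphere_ne_zero X)

theorem mem_Vsmooth_of_homogeneous {μ : ℂ} {δ : ℤ} {f : CN n → ℂ} (hf : ContDiffOn ℝ ∞ f {0}ᶜ)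
    (h0 : f 0 = 0) (hr : ∀ r : ℝ, 0 < r → ∀ x, x ≠ 0 → f (r • x) = (r : ℂ) ^ (-(μ + 2 * n)) * f x)
    (hc : ∀ c : ℂ, ‖c‖ = 1 → ∀ x, x ≠ 0 → f (c • x) = c ^ (-δ) * f x) : f ∈ Vsmooth n μ δ := by
  refine ⟨hf, h0, fun a ha X hX => ?_⟩
  have ha' : 0 < ‖a‖ := norm_pos_iff.2 ha
  have hb : ‖bracket a‖ = 1 := norm_bracket ha
  have hb0 : bracket a ≠ 0 := norm_ne_zero_iff.1 (by rw [hb]; exact one_ne_zero)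
  have e : a • X = ‖a‖ • (bracket a • X) := by
    have : (a : ℂ) = (‖a‖ : ℂ) * bracket a := by
      rw [bracket, mul_div_cancel₀]
      exact_mod_cast ha'.ne'
    conv_lhs => rw [this]
    rw [mul_smul]
    rfl
  rw [e, hr _ ha' _ (smul_ne_zero hb0 hX), hc _ hb _ hX, neg_add, ← sub_eq_add_neg, mul_assoc]

theorem exists_norm_homExt_le {q : Sph n → ℂ} (hq : Continuous q) (ν : ℂ) :
    ∃ C : ℝ, 0 ≤ C ∧ ∀ x : CN n, x ≠ 0 → ‖homExt ν q x‖ ≤ C * ‖x‖ ^ ν.re := by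
  obtain ⟨C, hC⟩ := (isCompact_range hq).isBounded.exists_norm_le
  refine ⟨max C 0, le_max_right _ _, fun x hx => ?_⟩
  obtain ⟨X, hX⟩ := exists_smul_sphere hx
  have hn : 0 < ‖x‖ := norm_pos_iff.2 hx
  conv_lhs => rw [hX]
  rw [homExt_smul_sphere _ _ hn, norm_mul, Complex.norm_cpow_eq_rpow_re_of_pos hn, mul_comm]
  exact mul_le_mul_of_nonneg_right ((hC _ ⟨X, rfl⟩).trans (le_max_left _ _)) (by positivity)

theorem integral_comp_phase {c : ℂ} (hc : ‖c‖ = 1) (F : CN n → ℂ) :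
    ∫ x, F (c • x) = ∫ x, F x := by
  have hc0 : c ≠ 0 := by
    rintro rfl
    simp at hc
  let e : CN n ≃ₗᵢ[ℝ] CN n :=
    { toLinearEquiv := (LinearEquiv.smulOfNeZero ℂ (CN n) c hc0).restrictScalars ℝ
      norm_map' := fun x => by
        show ‖c • x‖ = ‖x‖
        rw [norm_smul, hc, one_mul] }
  exact e.measurePreserving.integral_comp e.toHomeomorph.measurableEmbedding F

end Vsmooth

/-! ### The normalised operator -/

section normKS

variable {n : ℕ} {δ : ℤ} {h : Sph n → ℂ}

open Classical in
/-- The normalised Knapp–Stein operator, given by a Mellin transform along rays for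
`Re μ > -N` and by the integral over the sphere otherwise. -/
def normKS (hh : h ∈ SmoothSphere n (-δ)) (μ : ℂ) (Y : CN n) : ℂ :=
  if Y = 0 then 0
  else if 0 < (μ + 2 * n).re then
    (bumpMellin 0)⁻¹ * rayMellin (μ + 2 * n) (sympFourier n (annularSchwartz (μ - 2 * n) hh.1)) Y
  -- At a pole of 1/C_N this takes the default value 0.
  else (normConst n μ δ)⁻¹ * ksIntegral μ δ h Y

theorem normKS_zero (hh : h ∈ SmoothSphere n (-δ)) (μ : ℂ) : normKS hh μ 0 = 0 := by
  simp [normKS]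

/-- In the definition the Schwartz function changes with μ, which hides holomorphy. Here the cut-off
exponent μ₀ is free, so it can be frozen near any given point. -/
theorem normKS_mul_bumpMellin [Nontrivial (CN n)] (hh : h ∈ SmoothSphere n (-δ)) (μ₀ : ℂ) {μ : ℂ}
    (hμ : 0 < (μ + 2 * n).re) {Y : CN n} (hY : Y ≠ 0) :
    normKS hh μ Y * bumpMellin (μ₀ - μ) =
      rayMellin (μ + 2 * n) (sympFourier n (annularSchwartz (μ₀ - 2 * n) hh.1)) Y := by
  have h1 := rayMellin_annular_consistent hh μ₀ μ hμ hY
  rw [sub_self] at h1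
  rw [normKS, if_neg hY, if_pos hμ, mul_assoc, ← h1, mul_left_comm,
    inv_mul_cancel₀ bumpMellin_zero_ne, mul_one]

/-- On the overlap 0 < Re (μ + N) < 1 this is the functional equation; it makes the second formula
valid on the whole of its half-plane. -/
theorem normKS_of_mem_ksDomain [Nontrivial (CN n)] (hh : h ∈ SmoothSphere n (-δ)) {μ : ℂ}
    (hμ : μ ∈ ksDomain n) {Y : CN n} (hY : Y ≠ 0) :
    normKS hh μ Y = (normConst n μ δ)⁻¹ * ksIntegral μ δ h Y := by
  by_cases h0 : 0 < (μ + 2 * n).re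
  · have h1 := rayMellin_annular_of_strip hh μ h0 hμ hY
    rw [← normKS_mul_bumpMellin hh μ h0 hY, sub_self] at h1
    exact mul_right_cancel₀ bumpMellin_zero_ne h1
  · rw [normKS, if_neg hY, if_neg h0]

theorem mem_ksDomain_or_pos (n : ℕ) (μ : ℂ) : μ ∈ ksDomain n ∨ 0 < (μ + 2 * n).re := by
  rw [mem_ksDomain_iff]
  by_contra! h
  linarith

theorem eventually_pos {μ : ℂ} (hμ : 0 < (μ + 2 * n).re) : ∀ᶠ ν : ℂ in 𝓝 μ, 0 < (ν + 2 * n).re :=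
  (isOpen_lt continuous_const (by fun_prop : Continuous fun ν : ℂ => (ν + 2 * n).re)).mem_nhds hμ

theorem re_nonpos_of_mem_ksPoles {μ : ℂ} (hμ : μ ∈ ksPoles n δ) : (μ + 2 * n).re ≤ 0 := by
  obtain ⟨k, -, hk⟩ := hμ
  rw [hk]
  simp

theorem analyticAt_ksIntegral [Nontrivial (CN n)] (hh : h ∈ SmoothSphere n (-δ)) {μ : ℂ}
    (hμ : μ ∈ ksDomain n) {Y : CN n} (hY : Y ≠ 0) :
    AnalyticAt ℂ (fun ν => ksIntegral ν δ h Y) μ :=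
  (differentiableOn_ksIntegral (continuous_of_contDiffOn_homExt hh.1) δ hY).analyticAt
    ((isOpen_ksDomain n).mem_nhds hμ)

theorem analyticAt_normKS [Nontrivial (CN n)] (hh : h ∈ SmoothSphere n (-δ)) {μ : ℂ}
    (hμ : μ ∉ ksPoles n δ) {Y : CN n} (hY : Y ≠ 0) :
    AnalyticAt ℂ (fun ν => normKS hh ν Y) μ := by
  rcases mem_ksDomain_or_pos n μ with h1 | h1
  · refine ((analyticAt_inv_normConst hμ).mul (analyticAt_ksIntegral hh h1 hY)).congr ?_
    filter_upwards [(isOpen_ksDomain n).mem_nhds h1] with ν hν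
    exact (normKS_of_mem_ksDomain hh hν hY).symm
  · have hb : AnalyticAt ℂ (fun ν : ℂ => bumpMellin (μ - ν)) μ :=
      (differentiable_bumpMellin.comp
        (by fun_prop : Differentiable ℂ fun ν : ℂ => μ - ν)).analyticAt μ
    have hb0 : bumpMellin (μ - μ) ≠ 0 := by
      rw [sub_self]
      exact bumpMellin_zero_ne
    have hr : AnalyticAt ℂ (fun ν : ℂ => rayMellin (ν + 2 * n)
        (sympFourier n (annularSchwartz (μ - 2 * n) hh.1)) Y) μ := by
      have hd : DifferentiableOn ℂ (fun ν : ℂ => rayMellin (ν + 2 * n)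
          (sympFourier n (annularSchwartz (μ - 2 * n) hh.1)) Y) {ν : ℂ | 0 < (ν + 2 * n).re} :=
        fun ν hν => ((differentiableAt_rayMellin (sympFourier n (annularSchwartz (μ - 2 * n) hh.1))
          hν hY).comp ν (by fun_prop : DifferentiableAt ℂ (fun μ : ℂ => μ + 2 * n) ν)
          ).differentiableWithinAt
      exact hd.analyticAt (eventually_pos h1)
    refine (hr.mul (hb.inv hb0)).congr ?_
    filter_upwards [eventually_pos h1, hb.continuousAt.eventually_ne hb0] with ν hν hν0
    simp only [Pi.mul_apply, Pi.inv_apply]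
    rw [← normKS_mul_bumpMellin hh μ hν hY, mul_assoc, mul_inv_cancel₀ hν0, mul_one]

theorem meromorphicAt_normKS [Nontrivial (CN n)] (hh : h ∈ SmoothSphere n (-δ)) (μ : ℂ) {Y : CN n}
    (hY : Y ≠ 0) : MeromorphicAt (fun ν => normKS hh ν Y) μ := by
  by_cases hμ : μ ∈ ksPoles n δ
  -- All poles have Re (μ + N) ≤ 0, where the sphere integral itself is holomorphic.
  · have h1 : μ ∈ ksDomain n := by
      rw [mem_ksDomain_iff]
      linarith [re_nonpos_of_mem_ksPoles hμ]
    refine ((meromorphicAt_inv_normConst n δ μ).mul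
      (analyticAt_ksIntegral hh h1 hY).meromorphicAt).congr ?_
    filter_upwards [mem_nhdsWithin_of_mem_nhds ((isOpen_ksDomain n).mem_nhds h1)] with ν hν
    exact (normKS_of_mem_ksDomain hh hν hY).symm
  · exact (analyticAt_normKS hh hμ hY).meromorphicAt

theorem normKS_smul [Nontrivial (CN n)] (hh : h ∈ SmoothSphere n (-δ)) (μ : ℂ) {r : ℝ} (hr : 0 < r)
    {Y : CN n} (hY : Y ≠ 0) :
    normKS hh μ (r • Y) = (r : ℂ) ^ (-(μ + 2 * n)) * normKS hh μ Y := by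
  have hrY : r • Y ≠ 0 := smul_ne_zero hr.ne' hY
  by_cases h0 : 0 < (μ + 2 * n).re
  · rw [normKS, if_neg hrY, if_pos h0, rayMellin_smul _ _ hr, normKS, if_neg hY, if_pos h0]
    ring
  · rw [normKS, if_neg hrY, if_neg h0, ksIntegral_smul _ _ _ hr, normKS, if_neg hY, if_neg h0]
    ring

theorem sympForm_phase (c : ℂ) (X Y : CN n) : sympForm X (c • Y) = sympForm (c • X) Y := by
  rw [sympForm_smul_left, sympForm_smul_right]

theorem annular_inv_phase (hh : h ∈ SmoothSphere n (-δ)) (lam : ℂ) {c : ℂ} (hc : ‖c‖ = 1)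
    (x : CN n) : annular lam h (c⁻¹ • x) = c ^ (-δ) * annular lam h x := by
  have hc' : ‖c⁻¹‖ = 1 := by rw [norm_inv, hc, inv_one]
  rw [annular, annular, homExt_phase hh lam hc', norm_smul, hc', one_mul, neg_neg, inv_zpow,
    zpow_neg]
  ring

theorem integral_annular_phase (hh : h ∈ SmoothSphere n (-δ)) (lam : ℂ) {c : ℂ} (hc : ‖c‖ = 1)
    (F : CN n → ℂ) : ∫ x, annular lam h x * F (c • x) =
      c ^ (-δ) * ∫ x, annular lam h x * F x := by
  have hc0 : c ≠ 0 := by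
    rintro rfl
    simp at hc
  rw [← integral_const_mul, ← integral_comp_phase hc (fun x => c ^ (-δ) * (annular lam h x * F x))]
  refine integral_congr_ae (ae_of_all _ fun x => ?_)
  simp only
  rw [← mul_assoc, ← annular_inv_phase hh lam hc, smul_smul, inv_mul_cancel₀ hc0, one_smul]

/-- Passing through the annular integral replaces invariance of the surface measure under phases by
that of Lebesgue measure. -/
theorem ksIntegral_phase [Nontrivial (CN n)] (hh : h ∈ SmoothSphere n (-δ)) (μ : ℂ) {c : ℂ}
    (hc : ‖c‖ = 1) (Y : CN n) :
    ksIntegral μ δ h (c • Y) = c ^ (-δ) * ksIntegral μ δ h Y := by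
  have h1 := integral_annular_mul_ksKernel hh.1 μ μ δ (c • Y)
  have h2 := integral_annular_phase hh (μ - 2 * n) hc (fun x => ksKernel μ δ x Y)
  have h3 : ∀ x, ksKernel μ δ x (c • Y) = ksKernel μ δ (c • x) Y := by
    intro x
    rw [ksKernel, ksKernel, sympForm_phase]
  simp only [h3] at h1
  rw [h2, integral_annular_mul_ksKernel hh.1, sub_self, ← mul_assoc] at h1
  exact (mul_right_cancel₀ bumpMellin_zero_ne h1).symm

theorem sympFourier_annular_phase (hh : h ∈ SmoothSphere n (-δ)) (lam : ℂ) {c : ℂ} (hc : ‖c‖ = 1)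
    (Y : CN n) : sympFourier n (annularSchwartz lam hh.1) (c • Y) =
      c ^ (-δ) * sympFourier n (annularSchwartz lam hh.1) Y := by
  rw [sympFourier_apply, sympFourier_apply]
  simp only [annularSchwartz_apply, sympForm_phase]
  exact integral_annular_phase hh lam hc
    (fun x => Complex.exp (-2 * Complex.I * Real.pi * ((sympForm x Y).re : ℂ)))

theorem normKS_phase [Nontrivial (CN n)] (hh : h ∈ SmoothSphere n (-δ)) (μ : ℂ) {c : ℂ}
    (hc : ‖c‖ = 1) {Y : CN n} (hY : Y ≠ 0) :
    normKS hh μ (c • Y) = c ^ (-δ) * normKS hh μ Y := by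
  have hc0 : c ≠ 0 := by
    rintro rfl
    simp at hc
  have hrY : c • Y ≠ 0 := smul_ne_zero hc0 hY
  by_cases h0 : 0 < (μ + 2 * n).re
  · rw [normKS, if_neg hrY, if_pos h0, normKS, if_neg hY, if_pos h0, rayMellin_eq, rayMellin_eq,
      mul_left_comm, ← integral_const_mul (c ^ (-δ))]
    congr 1
    refine integral_congr_ae (ae_of_all _ fun u => ?_)
    simp only
    rw [smul_comm u c Y, sympFourier_annular_phase hh _ hc]
    ring
  · rw [normKS, if_neg hrY, if_neg h0, ksIntegral_phase hh μ hc, normKS, if_neg hY, if_neg h0]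
    ring

theorem normKS_mem_Vsmooth [Nontrivial (CN n)] (hh : h ∈ SmoothSphere n (-δ)) (μ : ℂ) :
    normKS hh μ ∈ Vsmooth n μ δ := by
  refine mem_Vsmooth_of_homogeneous ?_ (normKS_zero hh μ) (fun r hr x hx => normKS_smul hh μ hr hx)
    (fun c hc x hx => normKS_phase hh μ hc hx)
  have hcst : ∀ c : ℂ, ContDiffOn ℝ ∞ (fun _ : CN n => c) {0}ᶜ := fun c => contDiffOn_const
  rcases mem_ksDomain_or_pos n μ with h1 | h1
  · have h2 := (hcst (normConst n μ δ)⁻¹).mul (contDiffOn_ksIntegral hh.1 h1 δ)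
    exact h2.congr fun Y hY => normKS_of_mem_ksDomain hh h1 hY
  · have h2 := (hcst (bumpMellin 0)⁻¹).mul (contDiffOn_rayMellin
      (sympFourier n (annularSchwartz (μ - 2 * n) hh.1)) h1)
    refine h2.congr fun Y hY => ?_
    have hY' : Y ≠ 0 := hY
    rw [normKS, if_neg hY', if_pos h1]

end normKS

/-! ### The meromorphic family of homogeneous distributions -/

section family

variable {n : ℕ} {δ : ℤ} {h : Sph n → ℂ}

theorem pos_of_nontrivial (n : ℕ) [Nontrivial (CN n)] : (0 : ℝ) < n := by
  have h := Module.finrank_pos (R := ℝ) (M := CN n)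
  rw [finrank_CN] at h
  have : 0 < n := by omega
  exact_mod_cast this

theorem re_add_two_mul (n : ℕ) (μ : ℂ) : (μ + 2 * n).re = μ.re + 2 * n := by simp

theorem integrable_norm_mul_rpow [Nontrivial (CN n)] {σ : ℝ} (hσ : σ < 4 * n) (φ : 𝓢(CN n, ℂ)) :
    Integrable fun x : CN n => ‖φ x‖ * ‖x‖ ^ (-σ) := by
  have h1 := integrable_schwartz_mul_homExt (n := n) (ν := ((-σ : ℝ) : ℂ)) (q := fun _ => 1)
    (by rw [Complex.ofReal_re]; linarith) measurable_const (integrable_const 1) φ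
  refine h1.norm.congr ?_
  filter_upwards [Measure.ae_ne volume (0 : CN n)] with x hx
  obtain ⟨X, hX⟩ := exists_smul_sphere hx
  have hn : 0 < ‖x‖ := norm_pos_iff.2 hx
  have h2 : homExt ((-σ : ℝ) : ℂ) (fun _ => (1 : ℂ)) x = (‖x‖ : ℂ) ^ ((-σ : ℝ) : ℂ) := by
    conv_lhs => rw [hX]
    rw [homExt_smul_sphere _ _ hn, mul_one]
  rw [norm_mul, h2, Complex.norm_cpow_eq_rpow_re_of_pos hn, Complex.ofReal_re]

theorem integrable_norm_mul_rpow_of_notMem (σ : ℝ) {φ : 𝓢(CN n, ℂ)} (hφ : (0 : CN n) ∉ tsupport φ) :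
    Integrable fun x : CN n => ‖φ x‖ * ‖x‖ ^ (-σ) := by
  have hnhds : (tsupport φ)ᶜ ∈ 𝓝 (0 : CN n) := (isClosed_tsupport φ).isOpen_compl.mem_nhds hφ
  obtain ⟨ε, hε, hb⟩ := Metric.mem_nhds_iff.1 hnhds
  obtain ⟨m, hm⟩ := exists_nat_ge (-σ)
  have h1 : Integrable fun x : CN n => ‖x‖ ^ 0 * ‖φ x‖ := φ.integrable_pow_mul volume 0
  have h2 : Integrable fun x : CN n => ‖x‖ ^ m * ‖φ x‖ := φ.integrable_pow_mul volume m
  refine Integrable.mono' ((h1.const_mul (ε ^ (-σ))).add ((h1.add h2)))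
    (φ.continuous.norm.measurable.mul (measurable_norm.pow_const _)).aestronglyMeasurable
    (ae_of_all _ fun x => ?_)
  rw [Real.norm_of_nonneg (by positivity)]
  simp only [Pi.add_apply, pow_zero, one_mul]
  have hp : 0 ≤ ‖φ x‖ := norm_nonneg _
  by_cases hx : x ∈ Metric.ball (0 : CN n) ε
  · have : φ x = 0 := image_eq_zero_of_notMem_tsupport (hb hx)
    simp [this]
  · rw [Metric.mem_ball, dist_zero_right, not_lt] at hx
    have hx0 : 0 < ‖x‖ := hε.trans_le hx
    have key : ‖x‖ ^ (-σ) ≤ ε ^ (-σ) + (1 + ‖x‖ ^ m) := by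
      rcases le_total (-σ) 0 with hs | hs
      · have := Real.rpow_le_rpow_of_nonpos hε hx hs
        have : 0 ≤ ‖x‖ ^ m := by positivity
        linarith
      · have h3 : 0 ≤ ε ^ (-σ) := by positivity
        rcases le_total ‖x‖ 1 with h4 | h4
        · have := Real.rpow_le_one hx0.le h4 hs
          have : 0 ≤ ‖x‖ ^ m := by positivity
          linarith
        · have := Real.rpow_le_rpow_of_exponent_le h4 hm
          rw [Real.rpow_natCast] at this
          linarith
    calc ‖φ x‖ * ‖x‖ ^ (-σ) ≤ ‖φ x‖ * (ε ^ (-σ) + (1 + ‖x‖ ^ m)) := by gcongr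
      _ = _ := by ring

theorem measurable_of_mem_Vsmooth {μ : ℂ} {f : CN n → ℂ} (hf : f ∈ Vsmooth n μ δ) : Measurable f :=
  measurable_of_continuousOn_compl_singleton 0 hf.1.continuousOn

theorem continuous_restr_of_mem {μ : ℂ} {f : CN n → ℂ} (hf : f ∈ Vsmooth n μ δ) :
    Continuous (restr f) :=
  continuous_restr (⟨f, hf⟩ : Vsmooth n μ δ)

theorem integrable_mul_Vsmooth {μ : ℂ} {f : CN n → ℂ} (hf : f ∈ Vsmooth n μ δ)
    [Nontrivial (CN n)] {φ : 𝓢(CN n, ℂ)}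
    (hφ : Integrable fun x : CN n => ‖φ x‖ * ‖x‖ ^ (-(μ + 2 * n).re)) :
    Integrable fun x => φ x * f x := by
  obtain ⟨C, hC, hle⟩ := exists_norm_homExt_le (continuous_restr_of_mem hf) (-μ - 2 * n)
  rw [homExt_restr hf] at hle
  refine Integrable.mono' (hφ.const_mul C)
    (φ.continuous.measurable.mul (measurable_of_mem_Vsmooth hf)).aestronglyMeasurable ?_
  filter_upwards [Measure.ae_ne volume (0 : CN n)] with x hx
  have h1 := hle x hx
  have h2 : (-μ - 2 * n : ℂ).re = -(μ + 2 * n).re := by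
    rw [← Complex.neg_re]
    congr 1
    ring
  rw [h2] at h1
  rw [norm_mul]
  calc ‖φ x‖ * ‖f x‖ ≤ ‖φ x‖ * (C * ‖x‖ ^ (-(μ + 2 * n).re)) := by gcongr
    _ = _ := by ring

theorem exists_isGivenBy_Vsmooth [Nontrivial (CN n)] {μ : ℂ} {f : CN n → ℂ}
    (hf : f ∈ Vsmooth n μ δ) (hμ : μ.re < 2 * n) : ∃ T : 𝓢'(CN n, ℂ), IsGivenBy T f := by
  have hc := continuous_restr_of_mem hf
  rw [← homExt_restr hf]
  refine exists_isGivenBy_homExt ?_ hc.measurable (integrable_sphere_of_continuous hc)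
  simp
  linarith

/-- The normalised operator represents the Fourier transform of the homogeneous extension. -/
theorem integral_mul_normKS [Nontrivial (CN n)] (hh : h ∈ SmoothSphere n (-δ)) {μ : ℂ}
    (hμ : 0 < (μ + 2 * n).re) {φ : 𝓢(CN n, ℂ)}
    (hφ : Integrable fun x : CN n => ‖φ x‖ * ‖x‖ ^ (-(μ + 2 * n).re)) :
    ∫ x, φ x * normKS hh μ x = ∫ x, sympFourierTranspose n φ x * homExt (μ - 2 * n) h x := by
  have h1 := integral_mul_rayMellin_sympFourier hh.1 hμ hφ
  refine mul_right_cancel₀ bumpMellin_zero_ne (Eq.trans ?_ h1)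
  rw [← integral_mul_const]
  refine integral_congr_ae ?_
  filter_upwards [Measure.ae_ne volume (0 : CN n)] with x hx
  have h2 := normKS_mul_bumpMellin hh μ hμ hx
  rw [sub_self] at h2
  rw [mul_assoc, h2]

/-- The homogeneous extensions of a smooth function on the sphere as a family of tempered
distributions. -/
theorem exists_homogeneous_distribution [Nontrivial (CN n)] (hh : h ∈ SmoothSphere n (-δ)) (μ : ℂ) :
    ∃ T : 𝓢'(CN n, ℂ), (0 < (μ + 2 * n).re → IsGivenBy T (homExt (μ - 2 * n) h)) ∧
      (μ.re < 2 * n → IsGivenBy (sympFourierDist n T) (normKS hh μ)) ∧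
      ∀ φ : 𝓢(CN n, ℂ), (0 : CN n) ∉ tsupport φ → Integrable (fun Y => φ Y * normKS hh μ Y) ∧
          sympFourierDist n T φ = ∫ Y, φ Y * normKS hh μ Y := by
  have hn := pos_of_nontrivial n
  have hV := normKS_mem_Vsmooth hh μ
  have hre := re_add_two_mul n μ
  by_cases hμ : 0 < (μ + 2 * n).re
  · have hc := continuous_of_contDiffOn_homExt hh.1
    obtain ⟨T, hT⟩ := exists_isGivenBy_homExt (n := n) (ν := μ - 2 * n) (q := h) (by
      simp only [Complex.sub_re, Complex.mul_re, Complex.re_ofNat, Complex.natCast_re,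
        Complex.im_ofNat, Complex.natCast_im]
      linarith) hc.measurable (integrable_sphere_of_continuous hc)
    refine ⟨T, fun _ => hT, fun h1 φ => ?_, fun φ hφ => ?_⟩
    · have hφ := integrable_norm_mul_rpow (n := n) (σ := (μ + 2 * n).re) (by linarith) φ
      refine ⟨integrable_mul_Vsmooth hV hφ, ?_⟩
      rw [integral_mul_normKS hh hμ hφ, sympFourierDist_apply]
      exact (hT _).2
    · have hφ := integrable_norm_mul_rpow_of_notMem (μ + 2 * n).re hφ
      refine ⟨integrable_mul_Vsmooth hV hφ, ?_⟩
      rw [integral_mul_normKS hh hμ hφ, sympFourierDist_apply]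
      exact (hT _).2
  -- For Re μ ≤ -N the function h_{μ-N} need not be locally integrable at 0, but `normKS` is. The
  -- distribution is therefore defined as the Fourier transform of `normKS`, and the involution
  -- gives the claim back.
  · obtain ⟨T, hT⟩ := exists_isGivenBy_Vsmooth hV (by linarith)
    have h1 : sympFourierDist n (sympFourierDist n T) = T := by
      apply UniformConvergenceCLM.ext
      intro φ
      rw [sympFourierDist_apply, sympFourierDist_apply, sympFourierTranspose_involutive]
    refine ⟨sympFourierDist n T, fun h0 => absurd h0 hμ, fun _ => ?_, fun φ _ => ?_⟩
    · rwa [h1]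
    · rw [h1]
      exact hT φ

theorem differentiableOn_integral_homExt [Nontrivial (CN n)] (hh : ContDiffOn ℝ ∞ (homExt 0 h) {0}ᶜ)
    (φ : 𝓢(CN n, ℂ)) : DifferentiableOn ℂ (fun μ : ℂ => ∫ x, φ x * homExt (μ - 2 * n) h x)
      {μ : ℂ | 0 < (μ + 2 * n).re} := by
  have hc := continuous_of_contDiffOn_homExt hh
  have hm : Measurable (homExt 0 h) := measurable_homExt 0 hc.measurable
  obtain ⟨C, hC, hle⟩ := exists_norm_homExt_le hc 0
  have h1 := differentiableOn_integral_cpow (ν := (volume : Measure (CN n)))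
    (f := fun x : CN n => φ x * homExt 0 h x) (k := fun x => ‖x‖) (s := Ioi (-(4 * n : ℝ)))
    isOpen_Ioi (φ.continuous.measurable.mul hm).aestronglyMeasurable
    measurable_norm.aemeasurable
    ((Measure.ae_ne volume (0 : CN n)).mono fun x hx => norm_pos_iff.2 hx)
    (fun σ hσ => by
      rw [mem_Ioi] at hσ
      have h2 := integrable_norm_mul_rpow (n := n) (σ := -σ) (by linarith) φ
      rw [neg_neg] at h2
      refine Integrable.mono' (h2.const_mul C) ((φ.continuous.measurable.mul
        hm).norm.mul (measurable_norm.pow_const _)).aestronglyMeasurable ?_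
      filter_upwards [Measure.ae_ne volume (0 : CN n)] with x hx
      have h3 := hle x hx
      rw [Complex.zero_re, Real.rpow_zero, mul_one] at h3
      rw [Real.norm_of_nonneg (by positivity), norm_mul]
      calc ‖φ x‖ * ‖homExt 0 h x‖ * ‖x‖ ^ σ ≤ ‖φ x‖ * C * ‖x‖ ^ σ := by gcongr
        _ = _ := by ring)
  have h2 : DifferentiableOn ℂ (fun μ : ℂ => μ - 2 * (n : ℂ)) {μ : ℂ | 0 < (μ + 2 * n).re} := by
    fun_prop
  refine (h1.comp h2 fun μ hμ => ?_).congr fun μ _ => ?_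
  · simp at hμ ⊢
    linarith
  · simp only [Function.comp]
    refine integral_congr_ae (ae_of_all _ fun x => ?_)
    simp only
    rw [homExt_eq]
    ring

set_option maxHeartbeats 800000 in
-- On the product of ℂ^N and the sphere the kernel is still a power of |Re ω|, so the
-- differentiation lemma handles both integrals at once. Integrability on the product follows
-- because the sphere integral of |Re ω(·, Y)|^σ is an exact multiple of ‖Y‖^σ.
theorem differentiableOn_integral_mul_ksIntegral [Nontrivial (CN n)] (hh : Continuous h) (δ : ℤ)
    (φ : 𝓢(CN n, ℂ)) :
    DifferentiableOn ℂ (fun μ : ℂ => ∫ Y, φ Y * ksIntegral μ δ h Y) (ksDomain n) := by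
  have hn := pos_of_nontrivial n
  obtain ⟨C, hC⟩ := (isCompact_range hh).isBounded.exists_norm_le
  have hC' : ∀ X, ‖h X‖ ≤ C := fun X => hC _ ⟨X, rfl⟩
  have hform : Continuous fun p : CN n × Sph n => (sympForm (p.2 : CN n) p.1).re :=
    continuous_re_sympForm.comp ((continuous_subtype_val.comp continuous_snd).prodMk continuous_fst)
  have hne : ∀ᵐ p : CN n × Sph n ∂(volume.prod (sphMeas n)), (sympForm (p.2 : CN n) p.1).re ≠ 0 := by
    have hms : MeasurableSet {p : CN n × Sph n | (sympForm (p.2 : CN n) p.1).re ≠ 0} :=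
      (measurableSet_eq_fun hform.measurable measurable_const).compl
    refine (Measure.ae_prod_iff_ae_ae hms).2 ?_
    filter_upwards [Measure.ae_ne volume (0 : CN n)] with Y hY
    exact ae_sphere_form_ne_zero hY
  have hmb : Measurable fun p : CN n × Sph n =>
      bracket ((sympForm (p.2 : CN n) p.1).re : ℂ) ^ (-δ) :=
    (measurable_bracket.comp (Complex.measurable_ofReal.comp hform.measurable)).pow_const _
  have hmf : Measurable fun p : CN n × Sph n =>
      φ p.1 * h p.2 * bracket ((sympForm (p.2 : CN n) p.1).re : ℂ) ^ (-δ) :=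
    ((φ.continuous.comp continuous_fst).measurable.mul
      (hh.comp continuous_snd).measurable).mul hmb
  have hint : ∀ σ ∈ Ioi (-1 : ℝ), Integrable (fun p : CN n × Sph n =>
      ‖φ p.1 * h p.2 * bracket ((sympForm (p.2 : CN n) p.1).re : ℂ) ^ (-δ)‖ *
        |(sympForm (p.2 : CN n) p.1).re| ^ σ) (volume.prod (sphMeas n)) := by
    intro σ hσ
    obtain ⟨K, hK, hKe⟩ := exists_integral_sphere_form_rpow (n := n) hσ
    have hbase : Integrable (fun p : CN n × Sph n =>
        ‖φ p.1‖ * |(sympForm (p.2 : CN n) p.1).re| ^ σ) (volume.prod (sphMeas n)) := by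
      have hm : Measurable fun p : CN n × Sph n =>
          ‖φ p.1‖ * |(sympForm (p.2 : CN n) p.1).re| ^ σ :=
        (φ.continuous.comp continuous_fst).norm.measurable.mul
          (hform.abs.measurable.pow_const _)
      rw [integrable_prod_iff hm.aestronglyMeasurable]
      constructor
      · filter_upwards [Measure.ae_ne volume (0 : CN n)] with Y hY
        exact (integrable_sphere_form_rpow hσ hY).const_mul _
      · have hσ' : -1 < σ := hσ
        have hn1 : (1 : ℝ) ≤ n := by
          have : 0 < n := by exact_mod_cast hn
          exact_mod_cast this
        -- Since -σ < 1 < 4n, the power ‖Y‖^σ is locally integrable at the origin.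
        have h2 := (integrable_norm_mul_rpow (n := n) (σ := -σ) (by linarith) φ).const_mul K
        refine h2.congr ?_
        filter_upwards [Measure.ae_ne volume (0 : CN n)] with Y hY
        have h3 : ∀ X : Sph n, ‖‖φ Y‖ * |(sympForm (X : CN n) Y).re| ^ σ‖ =
            ‖φ Y‖ * |(sympForm (X : CN n) Y).re| ^ σ := fun X =>
          Real.norm_of_nonneg (by positivity)
        simp only [h3]
        rw [integral_const_mul, hKe Y hY, neg_neg]
        ring
    refine Integrable.mono' (hbase.const_mul C) (hmf.norm.mul
      (hform.abs.measurable.pow_const _)).aestronglyMeasurable ?_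
    filter_upwards [hne] with p hp
    rw [Real.norm_of_nonneg (by positivity), norm_mul, norm_mul, norm_zpow,
      norm_bracket (by exact_mod_cast hp), one_zpow, mul_one]
    calc ‖φ p.1‖ * ‖h p.2‖ * |(sympForm (p.2 : CN n) p.1).re| ^ σ
        ≤ ‖φ p.1‖ * C * |(sympForm (p.2 : CN n) p.1).re| ^ σ := by
          gcongr
          exact hC' _
      _ = _ := by ring
  have hpos : ∀ᵐ p : CN n × Sph n ∂(volume.prod (sphMeas n)),
      0 < |(sympForm (p.2 : CN n) p.1).re| := hne.mono fun p hp => abs_pos.2 hp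
  have h1 := differentiableOn_integral_cpow (ν := volume.prod (sphMeas n)) isOpen_Ioi
    hmf.aestronglyMeasurable hform.abs.measurable.aemeasurable hpos hint
  have h2 : DifferentiableOn ℂ (fun μ : ℂ => -μ - 2 * (n : ℂ)) (ksDomain n) := by fun_prop
  have hmaps : MapsTo (fun μ : ℂ => -μ - 2 * (n : ℂ)) (ksDomain n) {z : ℂ | z.re ∈ Ioi (-1 : ℝ)} := by
    intro μ hμ
    rw [mem_ksDomain_iff] at hμ
    simp at hμ ⊢
    linarith
  refine (h1.comp h2 hmaps).congr fun μ hμ => ?_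
  simp only [Function.comp]
  have hprod : Integrable (fun p : CN n × Sph n =>
      φ p.1 * h p.2 * bracket ((sympForm (p.2 : CN n) p.1).re : ℂ) ^ (-δ) *
        ((|(sympForm (p.2 : CN n) p.1).re| : ℝ) : ℂ) ^ (-μ - 2 * (n : ℂ))) (volume.prod (sphMeas n)) := by
    refine (hint _ (hmaps hμ)).mono' (hmf.mul ((Complex.measurable_ofReal.comp
      hform.abs.measurable).pow_const _)).aestronglyMeasurable ?_
    filter_upwards [hpos] with p hp
    rw [norm_mul, Complex.norm_cpow_eq_rpow_re_of_pos hp]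
  rw [integral_prod _ hprod]
  refine integral_congr_ae (ae_of_all _ fun Y => ?_)
  simp only
  rw [ksIntegral, ← integral_const_mul]
  refine integral_congr_ae (ae_of_all _ fun X => ?_)
  simp only [ksKernel]
  ring

/-- The homogeneous extensions form a meromorphic family of tempered distributions, whose Fourier
transform is given by the normalised operator. -/
theorem exists_meromorphic_family [Nontrivial (CN n)] (hh : h ∈ SmoothSphere n (-δ)) :
    ∃ D : ℂ → 𝓢'(CN n, ℂ),
      (∀ φ : 𝓢(CN n, ℂ), MeromorphicOn (fun μ => D μ φ) univ ∧
          ∀ μ ∉ ksPoles n δ, AnalyticAt ℂ (fun μ => D μ φ) μ) ∧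
      (∀ μ : ℂ, 0 < (μ + 2 * n).re → IsGivenBy (D μ) (homExt (μ - 2 * n) h)) ∧
      (∀ μ : ℂ, μ.re < 2 * n → IsGivenBy (sympFourierDist n (D μ)) (normKS hh μ)) ∧
      ∀ (μ : ℂ) (φ : 𝓢(CN n, ℂ)), (0 : CN n) ∉ tsupport φ →
        Integrable (fun Y => φ Y * normKS hh μ Y) ∧
          sympFourierDist n (D μ) φ = ∫ Y, φ Y * normKS hh μ Y := by
  have hn := pos_of_nontrivial n
  choose D hD1 hD2 hD3 using exists_homogeneous_distribution hh
  refine ⟨D, fun φ => ?_, hD1, hD2, hD3⟩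
  have e1 : ∀ μ : ℂ, 0 < (μ + 2 * n).re → ∀ᶠ ν in 𝓝 μ,
      ∫ x, φ x * homExt (ν - 2 * n) h x = D ν φ := by
    intro μ hμ
    filter_upwards [eventually_pos hμ] with ν hν
    exact ((hD1 ν hν φ).2).symm
  -- Testing the Fourier transform of `D ν` on the transform of φ recovers `D ν φ`. This formula
  -- shows that the only possible poles are those of 1/C_N.
  have e2 : ∀ μ ∈ ksDomain n, ∀ᶠ ν in 𝓝 μ, (normConst n ν δ)⁻¹ *
      ∫ Y, sympFourierTranspose n φ Y * ksIntegral ν δ h Y = D ν φ := by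
    intro μ hμ
    filter_upwards [(isOpen_ksDomain n).mem_nhds hμ] with ν hν
    have hn1 : (1 : ℝ) ≤ n := by
      have : 0 < n := by exact_mod_cast hn
      exact_mod_cast this
    have hre := re_add_two_mul n ν
    have h1 : ν.re < 2 * n := by
      have := mem_ksDomain_iff.1 hν
      linarith
    have h2 := (hD2 ν h1 (sympFourierTranspose n φ)).2
    rw [sympFourierDist_apply, sympFourierTranspose_involutive] at h2
    rw [h2, ← integral_const_mul]
    refine integral_congr_ae ?_
    filter_upwards [Measure.ae_ne volume (0 : CN n)] with x hx
    rw [normKS_of_mem_ksDomain hh hν hx]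
    ring
  have a1 : ∀ μ : ℂ, 0 < (μ + 2 * n).re → AnalyticAt ℂ (fun ν => D ν φ) μ := fun μ hμ =>
    ((differentiableOn_integral_homExt hh.1 φ).analyticAt (eventually_pos hμ)).congr (e1 μ hμ)
  have a2 : ∀ μ ∈ ksDomain n, AnalyticAt ℂ (fun ν : ℂ =>
      ∫ Y, sympFourierTranspose n φ Y * ksIntegral ν δ h Y) μ := fun μ hμ =>
    (differentiableOn_integral_mul_ksIntegral (continuous_of_contDiffOn_homExt hh.1) δ
      (sympFourierTranspose n φ)).analyticAt ((isOpen_ksDomain n).mem_nhds hμ)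
  refine ⟨fun μ _ => ?_, fun μ hμ => ?_⟩
  · rcases mem_ksDomain_or_pos n μ with h1 | h1
    · exact ((meromorphicAt_inv_normConst n δ μ).mul (a2 μ h1).meromorphicAt).congr
        (mem_nhdsWithin_of_mem_nhds (e2 μ h1))
    · exact (a1 μ h1).meromorphicAt
  · rcases mem_ksDomain_or_pos n μ with h1 | h1
    · exact ((analyticAt_inv_normConst hμ).mul (a2 μ h1)).congr (e2 μ h1)
    · exact a1 μ h1

end family

/-! ### Identification of the meromorphic continuation -/

section continuation

/-- Two functions in normal form at a point that agree on a punctured neighbourhood also agree at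
the point itself. This turns identities off a discrete set into identities of values. -/
theorem toMeromorphicNFOn_eventuallyEq {f g : ℂ → ℂ} (hf : MeromorphicOn f univ) {z : ℂ}
    (hg : MeromorphicNFAt g z) (hfg : f =ᶠ[𝓝[≠] z] g) : toMeromorphicNFOn f univ =ᶠ[𝓝 z] g :=
  ((meromorphicNFOn_toMeromorphicNFOn f univ
    (mem_univ z)).eventuallyEq_nhdsNE_iff_eventuallyEq_nhds hg).1
    ((hf.toMeromorphicNFOn_eq_self_on_nhdsNE (mem_univ z)).trans hfg)

/-- The identity theorem for meromorphic functions: infinite order of f - g at one point propagates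
through the connected plane. -/
theorem eventuallyEq_of_meromorphicOn {f g : ℂ → ℂ} (hf : MeromorphicOn f univ)
    (hg : MeromorphicOn g univ) {U : Set ℂ} (hU : IsOpen U) (hne : U.Nonempty)
    (h : ∀ z ∈ U, f z = g z) (z : ℂ) : f =ᶠ[𝓝[≠] z] g := by
  obtain ⟨w, hw⟩ := hne
  have hfg : MeromorphicOn (f - g) univ := hf.sub hg
  have hw' : meromorphicOrderAt (f - g) w = ⊤ := by
    rw [meromorphicOrderAt_eq_top_iff]
    filter_upwards [mem_nhdsWithin_of_mem_nhds (hU.mem_nhds hw)] with v hv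
    rw [Pi.sub_apply, h v hv, sub_self]
  have hz : meromorphicOrderAt (f - g) z = ⊤ := by
    by_contra hz
    exact hfg.meromorphicOrderAt_ne_top_of_isPreconnected isPreconnected_univ (mem_univ z)
      (mem_univ w) hz hw'
  rw [meromorphicOrderAt_eq_top_iff] at hz
  filter_upwards [hz] with v hv
  exact sub_eq_zero.1 hv

variable {n : ℕ} {δ : ℤ} {h : Sph n → ℂ}

theorem meromorphicOn_normConst_mul_normKS [Nontrivial (CN n)] (hh : h ∈ SmoothSphere n (-δ))
    {Y : CN n} (hY : Y ≠ 0) :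
    MeromorphicOn (fun μ => normConst n μ δ * normKS hh μ Y) univ := by
  intro μ _
  have h1 := (meromorphicAt_inv_normConst n δ μ).inv
  have h2 : (fun ν => (normConst n ν δ)⁻¹)⁻¹ = fun ν => normConst n ν δ := by
    funext ν
    simp
  rw [h2] at h1
  exact h1.mul (meromorphicAt_normKS hh μ hY)

/-- The continuation is C_N times `normKS`. Passing to normal form repairs the values at the zeros
of C_N, where the literal product need not be the integral. -/
theorem isMeroExt_ksIntegral [Nontrivial (CN n)] (hh : h ∈ SmoothSphere n (-δ)) {Y : CN n}
    (hY : Y ≠ 0) : IsMeroExt (ksDomain n) (fun μ => ksIntegral μ δ h Y)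
      (toMeromorphicNFOn (fun μ => normConst n μ δ * normKS hh μ Y) univ) := by
  refine ⟨meromorphicNFOn_toMeromorphicNFOn _ _, fun μ hμ => ?_⟩
  refine (toMeromorphicNFOn_eventuallyEq (meromorphicOn_normConst_mul_normKS hh hY)
    (analyticAt_ksIntegral hh hμ hY).meromorphicNFAt ?_).eq_of_nhds
  filter_upwards [eventually_normConst_ne_zero n δ μ,
    mem_nhdsWithin_of_mem_nhds ((isOpen_ksDomain n).mem_nhds hμ)] with ν h1 h2
  rw [normKS_of_mem_ksDomain hh h2 hY, ← mul_assoc, mul_inv_cancel₀ h1, one_mul]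

theorem ksDomain_nonempty (n : ℕ) : (ksDomain n).Nonempty :=
  ⟨-2 * n, by simp [ksDomain]⟩

/-- The operator is defined through an arbitrarily chosen continuation; uniqueness identifies it
with the explicit one off a discrete set. -/
theorem knappStein_eventuallyEq [Nontrivial (CN n)] (hh : h ∈ SmoothSphere n (-δ)) {Y : CN n}
    (hY : Y ≠ 0) (μ : ℂ) :
    (fun ν => knappStein ν δ h Y) =ᶠ[𝓝[≠] μ] fun ν => normConst n ν δ * normKS hh ν Y := by
  have hext := isMeroExt_ksIntegral hh hY
  have hex : ∃ F : ℂ → ℂ, IsMeroExt (ksDomain n) (fun μ => ksIntegral μ δ h Y) F := ⟨_, hext⟩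
  have h1 : (fun ν => knappStein ν δ h Y) = hex.choose := by
    funext ν
    rw [knappStein, if_neg hY, meroExt, dif_pos hex]
  rw [h1]
  have hF := hex.choose_spec
  exact (eventuallyEq_of_meromorphicOn hF.1.meromorphicOn hext.1.meromorphicOn (isOpen_ksDomain n)
    (ksDomain_nonempty n) (fun ν hν => (hF.2 ν hν).trans (hext.2 ν hν).symm) μ).trans
    ((meromorphicOn_normConst_mul_normKS hh hY).toMeromorphicNFOn_eq_self_on_nhdsNE (mem_univ μ))

theorem quotient_eventuallyEq_normKS [Nontrivial (CN n)] (hh : h ∈ SmoothSphere n (-δ)) (Y : CN n)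
    (μ : ℂ) :
    (fun ν => knappStein ν δ h Y / normConst n ν δ) =ᶠ[𝓝[≠] μ] fun ν => normKS hh ν Y := by
  by_cases hY : Y = 0
  · refine Eventually.of_forall fun ν => ?_
    simp only
    rw [hY, normKS_zero, knappStein, if_pos rfl, zero_div]
  · filter_upwards [knappStein_eventuallyEq hh hY μ, eventually_normConst_ne_zero n δ μ]
      with ν h1 h2
    rw [h1, mul_div_cancel_left₀ _ h2]

theorem analyticAt_normKS_apply [Nontrivial (CN n)] (hh : h ∈ SmoothSphere n (-δ)) {μ : ℂ}
    (hμ : μ ∉ ksPoles n δ) (Y : CN n) : AnalyticAt ℂ (fun ν => normKS hh ν Y) μ := by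
  by_cases hY : Y = 0
  · simp only [hY, normKS_zero]
    exact analyticAt_const
  · exact analyticAt_normKS hh hμ hY

theorem meromorphicOn_quotient [Nontrivial (CN n)] (hh : h ∈ SmoothSphere n (-δ)) (Y : CN n) :
    MeromorphicOn (fun ν => knappStein ν δ h Y / normConst n ν δ) univ := by
  intro μ _
  refine MeromorphicAt.congr ?_ (quotient_eventuallyEq_normKS hh Y μ).symm
  by_cases hY : Y = 0
  · simp only [hY, normKS_zero]
    exact analyticAt_const.meromorphicAt
  · exact meromorphicAt_normKS hh μ hY

theorem meromorphicOn_normKnappStein (δ : ℤ) (h : Sph n → ℂ) (Y : CN n) :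
    MeromorphicOn (fun μ => normKnappStein μ δ h Y) univ :=
  (meromorphicNFOn_toMeromorphicNFOn _ _).meromorphicOn

theorem normKnappStein_eventuallyEq [Nontrivial (CN n)] (hh : h ∈ SmoothSphere n (-δ)) {μ : ℂ}
    (hμ : μ ∉ ksPoles n δ) (Y : CN n) :
    (fun ν => normKnappStein ν δ h Y) =ᶠ[𝓝 μ] fun ν => normKS hh ν Y :=
  toMeromorphicNFOn_eventuallyEq (meromorphicOn_quotient hh Y)
    (analyticAt_normKS_apply hh hμ Y).meromorphicNFAt (quotient_eventuallyEq_normKS hh Y μ)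

theorem analyticAt_normKnappStein [Nontrivial (CN n)] (hh : h ∈ SmoothSphere n (-δ)) {μ : ℂ}
    (hμ : μ ∉ ksPoles n δ) (Y : CN n) : AnalyticAt ℂ (fun ν => normKnappStein ν δ h Y) μ :=
  (analyticAt_normKS_apply hh hμ Y).congr (normKnappStein_eventuallyEq hh hμ Y).symm

theorem normKnappStein_eq_normKS [Nontrivial (CN n)] (hh : h ∈ SmoothSphere n (-δ)) {μ : ℂ}
    (hμ : μ ∉ ksPoles n δ) : normKnappStein μ δ h = normKS hh μ :=
  funext fun Y => (normKnappStein_eventuallyEq hh hμ Y).eq_of_nhds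

end continuation

/-! ### The operator on smooth vectors for imaginary `μ` -/

section imaginary

variable {n : ℕ} {μ : ℂ} {δ : ℤ}

/-- The function `g` is the Fourier transform of the function `f`. -/
def IsFourierPair (f g : CN n → ℂ) : Prop :=
  ∀ φ : 𝓢(CN n, ℂ), ∫ x, φ x * g x = ∫ x, sympFourierTranspose n φ x * f x

theorem IsFourierPair.symm {f g : CN n → ℂ} (h : IsFourierPair f g) : IsFourierPair g f := by
  intro φ
  have h1 := h (sympFourierTranspose n φ)
  rw [sympFourierTranspose_involutive] at h1
  exact h1.symm

theorem integrable_mul_of_mem_Vsmooth [Nontrivial (CN n)] (hμ : μ.re = 0) {f : CN n → ℂ}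
    (hf : f ∈ Vsmooth n μ δ) (φ : 𝓢(CN n, ℂ)) : Integrable fun x => φ x * f x := by
  have hn := pos_of_nontrivial n
  refine integrable_mul_Vsmooth hf (integrable_norm_mul_rpow ?_ φ)
  rw [re_add_two_mul, hμ]
  linarith

/-- Both functions are continuous off the origin and vanish at the origin, so test functions
supported away from it separate them. -/
theorem eq_of_integral_eq [Nontrivial (CN n)] (hμ : μ.re = 0) {f g : CN n → ℂ}
    (hf : f ∈ Vsmooth n μ δ) (hg : g ∈ Vsmooth n μ δ)
    (h : ∀ φ : 𝓢(CN n, ℂ), ∫ x, φ x * f x = ∫ x, φ x * g x) : f = g := by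
  have hd : f - g ∈ Vsmooth n μ δ := sub_mem hf hg
  have hU : IsOpen ({0}ᶜ : Set (CN n)) := isOpen_compl_singleton
  have hc : ContinuousOn (f - g) {0}ᶜ := hd.1.continuousOn
  have h0 := hU.ae_eq_zero_of_integral_contDiff_smul_eq_zero (μ := (volume : Measure (CN n)))
    (hc.locallyIntegrableOn hU.measurableSet) (fun φ hφ hφs _ => by
      have hφ' : ContDiff ℝ ∞ fun x => (φ x : ℂ) := Complex.ofRealCLM.contDiff.comp hφ
      have hφs' : HasCompactSupport fun x => (φ x : ℂ) :=
        hφs.comp_left (g := fun r : ℝ => (r : ℂ)) Complex.ofReal_zero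
      have h1 := h (hφs'.toSchwartzMap hφ')
      have h2 := integral_sub (integrable_mul_of_mem_Vsmooth hμ hf (hφs'.toSchwartzMap hφ'))
        (integrable_mul_of_mem_Vsmooth hμ hg (hφs'.toSchwartzMap hφ'))
      rw [h1, sub_self] at h2
      rw [← h2]
      refine integral_congr_ae (ae_of_all _ fun x => ?_)
      simp only [Pi.sub_apply, Complex.real_smul]
      rw [mul_sub]
      rfl)
  have h1 : f - g =ᵐ[volume.restrict ({0}ᶜ : Set (CN n))] 0 :=
    (ae_restrict_iff' hU.measurableSet).2 h0
  have h2 := Measure.eqOn_open_of_ae_eq h1 hU hc continuousOn_const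
  funext x
  by_cases hx : x = 0
  · rw [hx, hf.2.1, hg.2.1]
  · exact sub_eq_zero.1 (h2 hx)

theorem notMem_ksPoles [Nontrivial (CN n)] (hμ : μ.re = 0) : μ ∉ ksPoles n δ := by
  intro h
  have h1 := re_nonpos_of_mem_ksPoles h
  have hn := pos_of_nontrivial n
  rw [re_add_two_mul, hμ] at h1
  linarith

theorem restr_mem_smoothSphere_neg {f : CN n → ℂ} (hf : f ∈ Vsmooth n (-μ) (-δ)) :
    restr f ∈ SmoothSphere n (-δ) :=
  restr_mem_smoothSphere hf

theorem homExt_restr_neg {f : CN n → ℂ} (hf : f ∈ Vsmooth n (-μ) (-δ)) :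
    homExt (μ - 2 * n) (restr f) = f := by
  have h := homExt_restr hf
  rwa [neg_neg] at h

theorem normKnappStein_mem [Nontrivial (CN n)] (hμ : μ.re = 0) {f : CN n → ℂ}
    (hf : f ∈ Vsmooth n (-μ) (-δ)) : normKnappStein μ δ (restr f) ∈ Vsmooth n μ δ := by
  rw [normKnappStein_eq_normKS (restr_mem_smoothSphere_neg hf) (notMem_ksPoles hμ)]
  exact normKS_mem_Vsmooth _ μ

theorem isFourierPair_normKnappStein [Nontrivial (CN n)] (hμ : μ.re = 0) {f : CN n → ℂ}
    (hf : f ∈ Vsmooth n (-μ) (-δ)) : IsFourierPair f (normKnappStein μ δ (restr f)) := by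
  have hn := pos_of_nontrivial n
  have hre := re_add_two_mul n μ
  intro φ
  rw [normKnappStein_eq_normKS (restr_mem_smoothSphere_neg hf) (notMem_ksPoles hμ),
    integral_mul_normKS (restr_mem_smoothSphere_neg hf) (by linarith)
      (integrable_norm_mul_rpow (by linarith) φ), homExt_restr_neg hf]

theorem IsFourierPair.add [Nontrivial (CN n)] {μ' : ℂ} {δ' : ℤ} (hμ : μ.re = 0) (hμ' : μ'.re = 0)
    {f f' g g' : CN n → ℂ} (hf : f ∈ Vsmooth n μ' δ') (hf' : f' ∈ Vsmooth n μ' δ')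
    (hg : g ∈ Vsmooth n μ δ) (hg' : g' ∈ Vsmooth n μ δ) (h : IsFourierPair f g)
    (h' : IsFourierPair f' g') : IsFourierPair (f + f') (g + g') := by
  intro φ
  simp only [Pi.add_apply, mul_add]
  rw [integral_add (integrable_mul_of_mem_Vsmooth hμ hg φ) (integrable_mul_of_mem_Vsmooth hμ hg' φ),
    integral_add (integrable_mul_of_mem_Vsmooth hμ' hf _) (integrable_mul_of_mem_Vsmooth hμ' hf' _),
    h, h']

theorem IsFourierPair.smul {f g : CN n → ℂ} (h : IsFourierPair f g) (c : ℂ) :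
    IsFourierPair (c • f) (c • g) := by
  intro φ
  simp only [Pi.smul_apply, smul_eq_mul, mul_left_comm _ c]
  rw [integral_const_mul, integral_const_mul, h]

/-- Linearity, invertibility and equivariance of the normalised operator are all deduced from this:
both sides of each identity are Fourier transforms of the same function. -/
theorem IsFourierPair.unique [Nontrivial (CN n)] (hμ : μ.re = 0) {f g g' : CN n → ℂ}
    (hg : g ∈ Vsmooth n μ δ) (hg' : g' ∈ Vsmooth n μ δ) (h : IsFourierPair f g)
    (h' : IsFourierPair f g') : g = g' :=
  eq_of_integral_eq hμ hg hg' fun φ => (h φ).trans (h' φ).symm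

theorem mem_Vsmooth_neg_neg {f : CN n → ℂ} (hf : f ∈ Vsmooth n μ δ) :
    f ∈ Vsmooth n (- -μ) (- -δ) := by
  rwa [neg_neg, neg_neg]

/-- The normalised Knapp–Stein operator on smooth vectors, for imaginary `μ`. -/
def normEquiv [Nontrivial (CN n)] (δ : ℤ) (hμ : μ.re = 0) :
    Vsmooth n (-μ) (-δ) ≃ₗ[ℂ] Vsmooth n μ δ where
  toFun f := ⟨normKnappStein μ δ (restr (f : CN n → ℂ)), normKnappStein_mem hμ f.2⟩
  -- The inverse is the operator with parameters (-μ, -δ), since it represents the same involutive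
  -- transform.
  invFun g := ⟨normKnappStein (-μ) (-δ) (restr (g : CN n → ℂ)),
    normKnappStein_mem (by simp [hμ]) (mem_Vsmooth_neg_neg g.2)⟩
  map_add' f f' := Subtype.ext <| IsFourierPair.unique hμ
    (normKnappStein_mem hμ (f + f').2)
    (add_mem (normKnappStein_mem hμ f.2) (normKnappStein_mem hμ f'.2))
    (isFourierPair_normKnappStein hμ (f + f').2)
    (IsFourierPair.add hμ (by simp [hμ]) f.2 f'.2 (normKnappStein_mem hμ f.2)
      (normKnappStein_mem hμ f'.2) (isFourierPair_normKnappStein hμ f.2)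
      (isFourierPair_normKnappStein hμ f'.2))
  map_smul' c f := Subtype.ext <| IsFourierPair.unique hμ
    (normKnappStein_mem hμ (c • f).2) (Submodule.smul_mem _ c (normKnappStein_mem hμ f.2))
    (isFourierPair_normKnappStein hμ (c • f).2)
    ((isFourierPair_normKnappStein hμ f.2).smul c)
  left_inv f := Subtype.ext <| IsFourierPair.unique (by simp [hμ])
    (normKnappStein_mem (by simp [hμ]) (mem_Vsmooth_neg_neg (normKnappStein_mem hμ f.2))) f.2
    (isFourierPair_normKnappStein (by simp [hμ]) (mem_Vsmooth_neg_neg (normKnappStein_mem hμ f.2)))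
    (isFourierPair_normKnappStein hμ f.2).symm
  right_inv g := Subtype.ext <| IsFourierPair.unique hμ
    (normKnappStein_mem hμ (normKnappStein_mem (by simp [hμ]) (mem_Vsmooth_neg_neg g.2))) g.2
    (isFourierPair_normKnappStein hμ
      (normKnappStein_mem (by simp [hμ]) (mem_Vsmooth_neg_neg g.2)))
    (isFourierPair_normKnappStein (by simp [hμ]) (mem_Vsmooth_neg_neg g.2)).symm

theorem isFourierPair_normEquiv [Nontrivial (CN n)] (hμ : μ.re = 0) (f : Vsmooth n (-μ) (-δ)) :
    IsFourierPair (f : CN n → ℂ) (normEquiv δ hμ f : CN n → ℂ) :=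
  isFourierPair_normKnappStein hμ f.2

/-! ### Unitarity -/

theorem conj_rpow_cpow {r : ℝ} (hr : 0 ≤ r) (z : ℂ) :
    (starRingEnd ℂ) ((r : ℂ) ^ z) = (r : ℂ) ^ (starRingEnd ℂ z) := by
  rw [Complex.cpow_conj, Complex.conj_ofReal]
  rw [Complex.arg_ofReal_of_nonneg hr]
  exact Real.pi_ne_zero.symm

theorem conj_homExt (lam : ℂ) (h : Sph n → ℂ) (x : CN n) :
    (starRingEnd ℂ) (homExt lam h x) =
      homExt (starRingEnd ℂ lam) (fun X => starRingEnd ℂ (h X)) x := by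
  by_cases hx : x = 0
  · rw [hx, homExt_zero, homExt_zero, map_zero]
  · obtain ⟨X, hX⟩ := exists_smul_sphere hx
    have hn : 0 < ‖x‖ := norm_pos_iff.2 hx
    rw [hX, homExt_smul_sphere _ _ hn, homExt_smul_sphere _ _ hn, map_mul, conj_rpow_cpow hn.le]

theorem contDiffOn_homExt_conj {h : Sph n → ℂ} (hh : ContDiffOn ℝ ∞ (homExt 0 h) {0}ᶜ) :
    ContDiffOn ℝ ∞ (homExt 0 fun X => starRingEnd ℂ (h X)) {0}ᶜ := by
  have h1 : ContDiffOn ℝ ∞ (fun x => Complex.conjCLE (homExt 0 h x)) {0}ᶜ :=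
    Complex.conjCLE.contDiff.comp_contDiffOn hh
  refine h1.congr fun x _ => ?_
  rw [Complex.conjCLE_apply, conj_homExt, map_zero]

theorem conj_sympFourier_annular {h : Sph n → ℂ} (hh : ContDiffOn ℝ ∞ (homExt 0 h) {0}ᶜ) (lam : ℂ)
    (ξ : CN n) : (starRingEnd ℂ) (sympFourier n (annularSchwartz lam hh) ξ) =
      sympFourierTranspose n
        (annularSchwartz (starRingEnd ℂ lam) (contDiffOn_homExt_conj hh)) ξ := by
  rw [sympFourier_apply, sympFourierTranspose_apply, ← integral_conj]
  refine integral_congr_ae (ae_of_all _ fun X => ?_)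
  simp only
  rw [map_mul, annularSchwartz_apply, annularSchwartz_apply, annular, annular, map_mul,
    Complex.conj_ofReal, conj_homExt, ← Complex.exp_conj]
  congr 2
  have h1 : (sympForm ξ X).re = -(sympForm X ξ).re := by
    rw [← sympForm_neg_swap, ← neg_one_smul ℂ ξ, sympForm_smul_right, neg_one_mul, Complex.neg_re]
  rw [h1]
  simp only [map_mul, map_neg, Complex.conj_ofReal, Complex.conj_I, Complex.conj_ofNat]
  push_cast
  ring

/-- Parseval for the cut-off of f against g, read in polar coordinates. The image of f is a ray
transform of F G, so its sphere pairing with g unfolds to an integral over ℂ^N; the Fourier pair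
moves the transform to g, and radial integration folds the result back to the sphere. The factors
`bumpMellin 0` cancel. -/
theorem integral_sphere_normKnappStein_mul_conj [Nontrivial (CN n)] (hμ : μ.re = 0)
    {f g g' : CN n → ℂ} (hf : f ∈ Vsmooth n (-μ) (-δ)) (hg : g ∈ Vsmooth n μ δ)
    (hg' : g' ∈ Vsmooth n (-μ) (-δ)) (hp : IsFourierPair g g') :
    ∫ X : Sph n, normKnappStein μ δ (restr f) X * starRingEnd ℂ (g X) ∂sphMeas n =
      ∫ X : Sph n, f X * starRingEnd ℂ (g' X) ∂sphMeas n := by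
  have hn := pos_of_nontrivial n
  have hre := re_add_two_mul n μ
  have hconj : starRingEnd ℂ μ = -μ := by
    apply Complex.ext <;> simp [hμ]
  have hh := restr_mem_smoothSphere_neg hf
  set G := annularSchwartz (μ - 2 * n) hh.1 with hG
  have hcg := (continuous_restr_of_mem hg).star
  have e1 : ∫ X : Sph n, normKnappStein μ δ (restr f) X * starRingEnd ℂ (g X) ∂sphMeas n =
      (bumpMellin 0)⁻¹ * ∫ X : Sph n, starRingEnd ℂ (g X) *
        rayMellin (4 * n + (μ - 2 * n)) (sympFourier n G) X ∂sphMeas n := by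
    have h3 : 4 * (n : ℂ) + (μ - 2 * n) = μ + 2 * n := by ring
    rw [h3, ← integral_const_mul, normKnappStein_eq_normKS hh (notMem_ksPoles hμ)]
    refine integral_congr_ae (ae_of_all _ fun X => ?_)
    simp only
    rw [normKS, if_neg (sphere_ne_zero X), if_pos (by linarith)]
    ring
  have e2 := integral_schwartz_mul_homExt (n := n) (ν := μ - 2 * n)
    (q := fun X => starRingEnd ℂ (g X)) (by simp [hμ]; linarith) hcg.measurable
    (integrable_sphere_of_continuous hcg) (sympFourier n G)
  -- As μ is imaginary, conj μ = -μ, so conj g is homogeneous of degree μ - N, the degree that `e2`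
  -- requires.
  have e3 : homExt (μ - 2 * n) (fun X : Sph n => starRingEnd ℂ (g X)) =
      fun x => starRingEnd ℂ (g x) := by
    funext x
    conv_rhs => rw [← homExt_restr hg, conj_homExt]
    rw [map_sub, map_neg, hconj, neg_neg, map_mul, Complex.conj_natCast]
    simp only [Complex.conj_ofNat]
    rfl
  have e4 : ∫ x, sympFourier n G x * starRingEnd ℂ (g x) =
      starRingEnd ℂ (∫ x, sympFourierTranspose n (annularSchwartz (starRingEnd ℂ (μ - 2 * n))
        (contDiffOn_homExt_conj hh.1)) x * g x) := by
    rw [← integral_conj]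
    refine integral_congr_ae (ae_of_all _ fun x => ?_)
    simp only
    rw [map_mul, ← conj_sympFourier_annular, Complex.conj_conj]
  have e5 : starRingEnd ℂ (∫ x, annularSchwartz (starRingEnd ℂ (μ - 2 * n))
        (contDiffOn_homExt_conj hh.1) x * g' x) =
      ∫ x, annular (μ - 2 * n) (restr f) x * starRingEnd ℂ (g' x) := by
    rw [← integral_conj]
    refine integral_congr_ae (ae_of_all _ fun x => ?_)
    simp only
    rw [map_mul, annularSchwartz_apply, annular, annular, map_mul, conj_homExt,
      Complex.conj_ofReal, Complex.conj_conj]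
    simp only [Complex.conj_conj]
  have e6 := integral_annular_mul (lam := μ - 2 * n) (ν := -μ - 2 * n) hh.1
    (Q := fun x => starRingEnd ℂ (g' x))
    (Complex.continuous_conj.measurable.comp (measurable_of_mem_Vsmooth hg')).aestronglyMeasurable
    (fun r hr X => by
      rw [Vsmooth_smul_real hg' hr, map_mul, conj_rpow_cpow hr.le, map_sub, neg_neg, hconj, map_mul,
        Complex.conj_natCast, Complex.conj_ofNat])
  have h0 : 4 * (n : ℂ) + (μ - 2 * n) + (-μ - 2 * n) = 0 := by ring
  rw [h0] at e6
  rw [e1, ← e2, e3, e4, ← hp, e5, e6, mul_comm, mul_assoc, mul_inv_cancel₀ bumpMellin_zero_ne,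
    mul_one]
  rfl

theorem norm_incl_sq (f : Vsmooth n μ δ) : ((‖incl n μ δ f‖ ^ 2 : ℝ) : ℂ) =
    ∫ X : Sph n, (f : CN n → ℂ) X * starRingEnd ℂ ((f : CN n → ℂ) X) ∂sphMeas n := by
  have h1 : ‖incl n μ δ f‖ = ‖(memLp_restr f).toLp _‖ := rfl
  rw [h1]
  have h2 := inner_self_eq_norm_sq_to_K (𝕜 := ℂ) ((memLp_restr f).toLp (restr (f : CN n → ℂ)))
  rw [L2.inner_def] at h2
  push_cast
  refine h2.symm.trans (integral_congr_ae ?_)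
  filter_upwards [(memLp_restr f).coeFn_toLp] with X hX
  rw [hX, RCLike.inner_apply]
  rfl

/-- The pairing identity with g the image of f, whose Fourier transform is f again. -/
theorem norm_incl_normEquiv [Nontrivial (CN n)] (hμ : μ.re = 0) (f : Vsmooth n (-μ) (-δ)) :
    ‖incl n μ δ (normEquiv δ hμ f)‖ = ‖incl n (-μ) (-δ) f‖ := by
  have h1 := integral_sphere_normKnappStein_mul_conj hμ f.2 (normEquiv δ hμ f).2 f.2
    (isFourierPair_normEquiv hμ f).symm
  have h2 : ((‖incl n μ δ (normEquiv δ hμ f)‖ ^ 2 : ℝ) : ℂ) =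
      ((‖incl n (-μ) (-δ) f‖ ^ 2 : ℝ) : ℂ) := by
    rw [norm_incl_sq, norm_incl_sq]
    exact h1
  have h3 : ‖incl n μ δ (normEquiv δ hμ f)‖ ^ 2 = ‖incl n (-μ) (-δ) f‖ ^ 2 := by exact_mod_cast h2
  exact (pow_left_inj₀ (norm_nonneg _) (norm_nonneg _) two_ne_zero).1 h3

/-- The unitary operator `V_{-μ,-δ} → V_{μ,δ}` that extends the normalised Knapp–Stein operator. -/
def unitaryOp [Nontrivial (CN n)] (δ : ℤ) (hμ : μ.re = 0) : V n (-μ) (-δ) ≃ₗᵢ[ℂ] V n μ δ :=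
  (normEquiv δ hμ).extendOfIsometry (incl n (-μ) (-δ)) (incl n μ δ) (denseRange_incl n (-μ) (-δ))
    (denseRange_incl n μ δ) (norm_incl_normEquiv hμ)

theorem unitaryOp_incl [Nontrivial (CN n)] (hμ : μ.re = 0) (f : Vsmooth n (-μ) (-δ)) :
    unitaryOp δ hμ (incl n (-μ) (-δ) f) = incl n μ δ (normEquiv δ hμ f) :=
  LinearEquiv.extendOfIsometry_eq _ _ _ _ _ _ _

end imaginary

/-! ### The Fourier transform and the group action on the Hilbert space -/

section hilbert

variable {n : ℕ} {μ : ℂ} {δ : ℤ}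

theorem integrable_coeFn (F : Lp ℂ 2 (sphMeas n)) : Integrable (F : Sph n → ℂ) (sphMeas n) :=
  (Lp.memLp F).integrable (by norm_num)

theorem measurable_coeFn (F : Lp ℂ 2 (sphMeas n)) : Measurable (F : Sph n → ℂ) :=
  (Lp.stronglyMeasurable F).measurable

theorem continuous_integral_mul {w : Sph n → ℂ} (hw : Continuous w) :
    Continuous fun F : Lp ℂ 2 (sphMeas n) => ∫ X, F X * w X ∂sphMeas n := by
  have hw' : MemLp (fun X => starRingEnd ℂ (w X)) 2 (sphMeas n) := by
    obtain ⟨C, hC⟩ := (isCompact_range hw.star).isBounded.exists_norm_le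
    exact MemLp.of_bound hw.star.aestronglyMeasurable C (ae_of_all _ fun X => hC _ ⟨X, rfl⟩)
  have h1 : Continuous fun F : Lp ℂ 2 (sphMeas n) => inner ℂ (hw'.toLp _) F :=
    continuous_const.inner continuous_id
  refine h1.congr fun F => ?_
  rw [L2.inner_def]
  refine integral_congr_ae ?_
  filter_upwards [hw'.coeFn_toLp] with X hX
  rw [hX, RCLike.inner_apply, Complex.conj_conj]

theorem continuous_rayMellin_sphere (φ : 𝓢(CN n, ℂ)) {s : ℂ} (hs : 0 < s.re) :
    Continuous fun X : Sph n => rayMellin s φ X :=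
  (contDiffOn_rayMellin φ hs).continuousOn.comp_continuous continuous_subtype_val
    fun X => sphere_ne_zero X

/-- Distributions depend continuously on the restriction of homogeneous functions to the sphere. -/
theorem continuous_integral_mul_homExt [Nontrivial (CN n)] {ν : ℂ} (hν : 0 < 4 * n + ν.re)
    (φ : 𝓢(CN n, ℂ)) :
    Continuous fun F : Lp ℂ 2 (sphMeas n) => ∫ x, φ x * homExt ν F x := by
  have hν' : 0 < (4 * n + ν).re := by simpa using hν
  refine (continuous_integral_mul (continuous_rayMellin_sphere φ hν')).congr fun F => ?_
  exact (integral_schwartz_mul_homExt hν (measurable_coeFn F) (integrable_coeFn F) φ).symm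

theorem integral_mul_homExt_incl [Nontrivial (CN n)] (hμ : μ.re = 0) (f : Vsmooth n μ δ)
    (φ : 𝓢(CN n, ℂ)) :
    ∫ x, φ x * homExt (-μ - 2 * n) (incl n μ δ f : Lp ℂ 2 (sphMeas n)) x =
      ∫ x, φ x * (f : CN n → ℂ) x := by
  have hn := pos_of_nontrivial n
  have hν : 0 < 4 * n + (-μ - 2 * n : ℂ).re := by
    simp [hμ]
    linarith
  have hc := continuous_restr f
  conv_rhs => rw [← homExt_restr f.2]
  rw [integral_schwartz_mul_homExt hν (measurable_coeFn _) (integrable_coeFn _),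
    integral_schwartz_mul_homExt hν hc.measurable (integrable_sphere_of_continuous hc)]
  refine integral_congr_ae ?_
  have h1 : (incl n μ δ f : Lp ℂ 2 (sphMeas n)) = (memLp_restr f).toLp _ := rfl
  rw [h1]
  filter_upwards [(memLp_restr f).coeFn_toLp] with X hX
  rw [hX]

/-- For a fixed test function both sides are continuous in the L²-class of `F`, so density of the
smooth vectors is enough. -/
theorem integral_mul_unitaryOp [Nontrivial (CN n)] (hμ : μ.re = 0) (F : V n (-μ) (-δ))
    (φ : 𝓢(CN n, ℂ)) :
    ∫ x, φ x * homExt (-μ - 2 * n) (unitaryOp δ hμ F : Lp ℂ 2 (sphMeas n)) x =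
      ∫ x, sympFourierTranspose n φ x * homExt (μ - 2 * n) (F : Lp ℂ 2 (sphMeas n)) x := by
  have hn := pos_of_nontrivial n
  refine (denseRange_incl n (-μ) (-δ)).induction_on F (isClosed_eq ?_ ?_) fun f => ?_
  · exact (continuous_integral_mul_homExt (by simp [hμ]; linarith) φ).comp
      (continuous_subtype_val.comp (unitaryOp δ hμ).continuous)
  · exact (continuous_integral_mul_homExt (by simp [hμ]; linarith) _).comp continuous_subtype_val
  · have h1 := integral_mul_homExt_incl (by simp [hμ]) f (sympFourierTranspose n φ)
    rw [neg_neg] at h1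
    rw [unitaryOp_incl, integral_mul_homExt_incl hμ, h1]
    exact isFourierPair_normEquiv hμ f φ

theorem exists_isGivenBy_unitaryOp [Nontrivial (CN n)] (hμ : μ.re = 0) (F : V n (-μ) (-δ)) :
    ∃ T : 𝓢'(CN n, ℂ), IsGivenBy T (homExt (μ - 2 * n) (F : Lp ℂ 2 (sphMeas n))) ∧
      IsGivenBy (sympFourierDist n T)
        (homExt (-μ - 2 * n) (unitaryOp δ hμ F : Lp ℂ 2 (sphMeas n))) := by
  have hn := pos_of_nontrivial n
  obtain ⟨T, hT⟩ := exists_isGivenBy_homExt (n := n) (ν := μ - 2 * n) (by simp [hμ]; linarith)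
    (measurable_coeFn (F : Lp ℂ 2 (sphMeas n))) (integrable_coeFn _)
  refine ⟨T, hT, fun φ => ⟨integrable_schwartz_mul_homExt (by simp [hμ]; linarith)
    (measurable_coeFn _) (integrable_coeFn _) φ, ?_⟩⟩
  rw [sympFourierDist_apply, integral_mul_unitaryOp, (hT _).2]

theorem measurePreserving_act (g : Sp n) :
    MeasurePreserving (act g : CN n → CN n) volume volume := by
  have hm : Measurable (act g : CN n → CN n) := (act g).continuous.measurable
  refine ⟨hm, Measure.ext_of_lintegral _ fun f hf => ?_⟩
  rw [lintegral_map hf hm]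
  exact lintegral_comp_act g f hf

/-- The action of `g` as a homeomorphic real-linear automorphism. -/
def actEquiv (g : Sp n) : CN n ≃L[ℝ] CN n :=
  ContinuousLinearEquiv.equivOfInverse ((act g).restrictScalars ℝ) ((act g⁻¹).restrictScalars ℝ)
    (act_inv_act g) (act_act_inv g)

theorem integral_comp_act (g : Sp n) (f : CN n → ℂ) : ∫ x, f (act g x) = ∫ x, f x :=
  (measurePreserving_act g).integral_comp
    (actEquiv g).toHomeomorph.measurableEmbedding f

/-- The group preserves ω and, having determinant 1, Lebesgue measure. This is the source of the
intertwining property. -/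
theorem sympFourierTranspose_comp_act (g : Sp n) (φ : 𝓢(CN n, ℂ)) (X : CN n) :
    sympFourierTranspose n (SchwartzMap.compCLMOfContinuousLinearEquiv ℂ (actEquiv g) φ) X =
      sympFourierTranspose n φ (act g X) := by
  rw [sympFourierTranspose_apply, sympFourierTranspose_apply]
  conv_rhs => rw [← integral_comp_act g]
  simp only [sympForm_act]
  rfl

theorem IsFourierPair.comp_act {f f' : CN n → ℂ} (h : IsFourierPair f f') (g : Sp n) :
    IsFourierPair (fun x => f (act g⁻¹ x)) fun x => f' (act g⁻¹ x) := by
  intro φ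
  have h1 := h (SchwartzMap.compCLMOfContinuousLinearEquiv ℂ (actEquiv g) φ)
  rw [← integral_comp_act g, ← integral_comp_act g (fun x => sympFourierTranspose n φ x * _)]
  simp only [act_inv_act, ← sympFourierTranspose_comp_act]
  exact h1

/-- Both sides are Fourier transforms of the translate of f. -/
theorem normEquiv_smoothAct [Nontrivial (CN n)] (hμ : μ.re = 0) (g : Sp n)
    (f : Vsmooth n (-μ) (-δ)) :
    normEquiv δ hμ (smoothAct (-μ) (-δ) g f) = smoothAct μ δ g (normEquiv δ hμ f) :=
  Subtype.ext <| IsFourierPair.unique hμ (normEquiv δ hμ (smoothAct (-μ) (-δ) g f)).2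
    (smoothAct μ δ g (normEquiv δ hμ f)).2
    (isFourierPair_normEquiv hμ (smoothAct (-μ) (-δ) g f))
    ((isFourierPair_normEquiv hμ f).comp_act g)

theorem unitaryOp_principalSeries [Nontrivial (CN n)] (hμ : μ.re = 0) (hμ' : (-μ).re = 0) (g : Sp n)
    (F : V n (-μ) (-δ)) :
    unitaryOp δ hμ (principalSeries n (-μ) hμ' (-δ) g F) =
      principalSeries n μ hμ δ g (unitaryOp δ hμ F) := by
  refine (denseRange_incl n (-μ) (-δ)).induction_on F (isClosed_eq ?_ ?_) fun f => ?_
  · exact (unitaryOp δ hμ).continuous.comp (principalSeries n (-μ) hμ' (-δ) g).continuous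
  · exact (principalSeries n μ hμ δ g).continuous.comp (unitaryOp δ hμ).continuous
  · have h1 : principalSeries n (-μ) hμ' (-δ) g (incl n (-μ) (-δ) f) =
        incl n (-μ) (-δ) (smoothAct (-μ) (-δ) g f) := piOp_incl hμ' (-δ) g f
    have h2 : principalSeries n μ hμ δ g (incl n μ δ (normEquiv δ hμ f)) =
        incl n μ δ (smoothAct μ δ g (normEquiv δ hμ f)) := piOp_incl hμ δ g _
    rw [h1, unitaryOp_incl, unitaryOp_incl, h2, normEquiv_smoothAct]

end hilbert

end KnappStein

end

/-! ### The main theorem -/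

theorem proposition2p1 (n : ℕ) (hn : 1 ≤ n) (δ : ℤ) :
    -- the identity of meromorphic families, on the sections `h_{μ-N} ∈ V^∞_{-μ,-δ}`
    (∀ h ∈ SmoothSphere n (-δ),
      -- the Knapp–Stein integral converges on a half-plane and has a meromorphic continuation
      (∀ Y : CN n, Y ≠ 0 →
        (∀ μ ∈ ksDomain n, Integrable (fun X : Sph n => h X * ksKernel μ δ X Y) (sphMeas n)) ∧
        ∃ F : ℂ → ℂ, IsMeroExt (ksDomain n) (fun μ => ksIntegral μ δ h Y) F) ∧
      -- the normalised operator is meromorphic in `μ`, and maps to `V^∞_{μ,δ}` off the poles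
      (∀ Y : CN n, MeromorphicOn (fun μ => normKnappStein μ δ h Y) univ ∧
        ∀ μ ∉ ksPoles n δ, AnalyticAt ℂ (fun μ => normKnappStein μ δ h Y) μ) ∧
      (∀ μ ∉ ksPoles n δ, normKnappStein μ δ h ∈ Vsmooth n μ δ) ∧
      -- `D μ` is `h_{μ-N}` as a meromorphic family of tempered distributions
      ∃ D : ℂ → 𝓢'(CN n, ℂ),
        (∀ φ : 𝓢(CN n, ℂ), MeromorphicOn (fun μ => D μ φ) univ ∧
          ∀ μ ∉ ksPoles n δ, AnalyticAt ℂ (fun μ => D μ φ) μ) ∧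
        (∀ μ : ℂ, -(2 * n : ℝ) < μ.re → IsGivenBy (D μ) (homExt (μ - 2 * n) h)) ∧
        -- its symplectic Fourier transform is the normalised Knapp–Stein operator
        (∀ μ ∉ ksPoles n δ, μ.re < 2 * n →
          IsGivenBy (sympFourierDist n (D μ)) (normKnappStein μ δ h)) ∧
        (∀ μ ∉ ksPoles n δ, ∀ φ : 𝓢(CN n, ℂ), (0 : CN n) ∉ tsupport φ →
          Integrable (fun Y => φ Y * normKnappStein μ δ h Y) ∧
          sympFourierDist n (D μ) φ = ∫ Y, φ Y * normKnappStein μ δ h Y)) ∧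
    -- the unitary equivalence, for imaginary `μ`
    (∀ (μ : ℂ) (hμ : μ.re = 0), ∃ U : V n (-μ) (-δ) ≃ₗᵢ[ℂ] V n μ δ,
      -- `U` extends the normalised Knapp–Stein operator `V^∞_{-μ,-δ} → V^∞_{μ,δ}`
      (∀ f : Vsmooth n (-μ) (-δ), ∃ f' : Vsmooth n μ δ,
        (f' : CN n → ℂ) = normKnappStein μ δ (restr (f : CN n → ℂ)) ∧
        U (incl n (-μ) (-δ) f) = incl n μ δ f') ∧
      -- `U` is the restriction of the symplectic Fourier transform to `V_{-μ,-δ}`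
      (∀ F : V n (-μ) (-δ), ∃ T : 𝓢'(CN n, ℂ),
        IsGivenBy T (homExt (μ - 2 * n) (F : Lp ℂ 2 (sphMeas n))) ∧
        IsGivenBy (sympFourierDist n T) (homExt (-μ - 2 * n) (U F : Lp ℂ 2 (sphMeas n)))) ∧
      -- `U` intertwines the two representations
      (∀ (g : Sp n) (F : V n (-μ) (-δ)),
        U (principalSeries n (-μ) (by simp [hμ]) (-δ) g F) =
          principalSeries n μ hμ δ g (U F))) := by
  -- The assumption n ≥ 1 enters only through the nontriviality of ℂ^N.
  have : Nonempty (Fin n ⊕ Fin n) := ⟨Sum.inl ⟨0, hn⟩⟩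
  have : Nontrivial (CN n) := inferInstance
  refine ⟨fun h hh => ⟨fun Y hY => ⟨fun μ hμ => integrable_ksKernel
    (continuous_of_contDiffOn_homExt hh.1) hμ δ hY, _, isMeroExt_ksIntegral hh hY⟩,
    fun Y => ⟨meromorphicOn_normKnappStein δ h Y,
      fun μ hμ => analyticAt_normKnappStein hh hμ Y⟩, fun μ hμ => ?_, ?_⟩, fun μ hμ => ?_⟩
  · rw [normKnappStein_eq_normKS hh hμ]
    exact normKS_mem_Vsmooth hh μ
  · obtain ⟨D, h1, h2, h3, h4⟩ := exists_meromorphic_family hh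
    refine ⟨D, h1, fun μ hμ => h2 μ ?_, fun μ hμ hlt => ?_, fun μ hμ φ hφ => ?_⟩
    · rw [re_add_two_mul]
      linarith
    · rw [normKnappStein_eq_normKS hh hμ]
      exact h3 μ hlt
    · rw [normKnappStein_eq_normKS hh hμ]
      exact h4 μ φ hφ
  · exact ⟨unitaryOp δ hμ, fun f => ⟨normEquiv δ hμ f, rfl, unitaryOp_incl hμ f⟩,
      fun F => exists_isGivenBy_unitaryOp hμ F,
      fun g F => unitaryOp_principalSeries hμ _ g F⟩
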